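/- All C*-algebras are complex and not necessarily unital, and homomorphisms are *-homomorphisms. For a C*-algebra $A$ let $QA=A\star A$ be the full free product of two copies of $A$, with canonical inclusions $\iota,\bar\iota\colon A\to QA$, let $qA$ be the kernel of the homomorphism $QA\to A$ that restricts to $\mathrm{id}_A$ on both copies of $A$, and put $qx=\iota(x)-\bar\iota(x)\in qA$ for $x\in A$. A linear map $\rho\colon A\to B$ between C*-algebras is called nuclear if there is $K\ge 0$ such that for every C*-algebra $D$ the map $\rho\otimes\mathrm{id}\colon A\otimes_{\mathrm{alg}}D\to B\otimes_{\max}D$ is bounded by $K$, where $A\otimes_{\mathrm{alg}}D$ carries the minimal C*-tensor norm. If $J$ is a closed ideal of a C*-algebra $E$, a homomorphism $\varphi\colon A\to E$ is weakly nuclear relative to $J$ if $x\mapsto\varphi(x)b$, $A\to J$, is nuclear for all $b\in J$. A prequasihomomorphism $A\rightrightarrows E\rhd J\to B$ consists of homomorphisms $\psi_1,\psi_2\colon A\to E$ with $\psi_1(x)-\psi_2(x)\in J$ for all $x\in A$ and a homomorphism $\mu\colon J\to B$; it induces the homomorphism $qA\to B$ that is $\mu$ composed with the restriction to $qA$ of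 the homomorphism $QA\to E$ given by $\psi_1$ and $\psi_2$ on the two copies of $A$. A Kasparov $A$-$B$-module, with $A$ acting on the Hilbert $B$-module $\mathcal E$, is nuclear in the sense of Skandalis if $a\mapsto\langle\xi,a\xi\rangle$, $A\to B$, is nuclear for all $\xi\in\mathcal E$. **Proposition.** Let $A$, $B$ be C*-algebras and $\psi\colon qA\to B$ a homomorphism. Let $H=\overline{\psi(qA)B\psi(qA)}$ be the hereditary subalgebra of $B$ generated by $\psi(qA)$, with multiplier algebra $\mathcal M(H)$, and let $\psi^\circ\colon QA\to\mathcal M(H)$ be the canonical extension of $\psi$, so that $\psi^\circ(z)\psi(y)b=\psi(zy)b$ for $z\in QA$, $y\in qA$ and $b\in B$ with $\psi(y)b\in H$. The following are equivalent: (i) the map $A\ni x\mapsto\psi(qx)\in B$ is nuclear; (ii) the maps $A\to B$, $x\mapsto\psi(\iota(x)y)$ and $x\mapsto\psi(\bar\iota(x)y)$, are nuclear for all $y\in qA$; (iii) $\psi$ is induced by a prequasihomomorphism $(\psi_1,\psi_2)\colon A\rightrightarrows E\rhd J\hookrightarrow B$ with $J\to B$ injective and $\psi_1,\psi_2$ weakly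 nuclear relative to $J$; (iv) $\psi^\circ\iota$ and $\psi^\circ\bar\iota$ are weakly nuclear relative to the ideal $H$ of $\mathcal M(H)$; (v) with $\mathcal E=\overline{\psi(qA)B}$ considered as a Hilbert $B$-module, on which $QA$ acts through $\psi^\circ$ by $z\cdot\psi(y)b=\psi(zy)b$, the Kasparov module $\left(\psi^\circ\iota\oplus\psi^\circ\bar\iota\colon A\to\mathcal B(\mathcal E\oplus\mathcal E^{\mathrm{op}}),\ \begin{pmatrix}0&1\\1&0\end{pmatrix}\right)$ is nuclear in the sense of Skandalis. -/

import Mathlib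

open scoped TensorProduct ENNReal NNReal Topology MultiplierAlgebra WithCStarModule

universe u

noncomputable section

namespace QNuc

/-! ### Tensor norms and nuclear maps -/

section Nuclear

variable {A B D : Type u} [NonUnitalCStarAlgebra A] [NonUnitalCStarAlgebra B]
  [NonUnitalCStarAlgebra D]

/-- For representations `π` of `A` on `H` and `σ` of `D` on `K`, the representation `π ⊗ σ` of the
algebraic tensor product `A ⊗ D` on the pre-Hilbert space `H ⊗ K`. -/
def tensorRep {H K : Type u} [NormedAddCommGroup H] [InnerProductSpace ℂ H] [CompleteSpace H]
    [NormedAddCommGroup K] [InnerProductSpace ℂ K] [CompleteSpace K]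
    (π : A →⋆ₙₐ[ℂ] (H →L[ℂ] H)) (σ : D →⋆ₙₐ[ℂ] (K →L[ℂ] K)) :
    A ⊗[ℂ] D →ₗ[ℂ] (H ⊗[ℂ] K →ₗ[ℂ] H ⊗[ℂ] K) :=
  TensorProduct.lift
    { toFun := fun a =>
        { toFun := fun d => TensorProduct.map (π a : H →ₗ[ℂ] H) (σ d : K →ₗ[ℂ] K)
          map_add' := fun d d' => by simp [TensorProduct.map_add_right]
          map_smul' := fun c d => by simp [TensorProduct.map_smul_right] }
      map_add' := fun a a' => by ext; simp [TensorProduct.add_tmul]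
      map_smul' := fun c a => by ext; simp [TensorProduct.smul_tmul'] }

/-- The minimal (spatial) C*-norm on the algebraic tensor product `A ⊗ D`: the supremum of the
operator norms of `(π ⊗ σ)(x)` over all representations `π` of `A` and `σ` of `D` on Hilbert
spaces. -/
def minNorm (x : A ⊗[ℂ] D) : ℝ≥0∞ :=
  ⨆ (H : Type u) (_ : NormedAddCommGroup H) (_ : InnerProductSpace ℂ H) (_ : CompleteSpace H)
    (K : Type u) (_ : NormedAddCommGroup K) (_ : InnerProductSpace ℂ K) (_ : CompleteSpace K)
    (π : A →⋆ₙₐ[ℂ] (H →L[ℂ] H)) (σ : D →⋆ₙₐ[ℂ] (K →L[ℂ] K))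
    (ζ : H ⊗[ℂ] K) (_ : ‖ζ‖ ≤ 1), ‖tensorRep π σ x ζ‖ₑ

/-- For representations `π` of `B` and `σ` of `D` on the same space, the linear map
`b ⊗ d ↦ π b σ d`. -/
def productRep {H : Type u} [NormedAddCommGroup H] [InnerProductSpace ℂ H] [CompleteSpace H]
    (π : B →⋆ₙₐ[ℂ] (H →L[ℂ] H)) (σ : D →⋆ₙₐ[ℂ] (H →L[ℂ] H)) :
    B ⊗[ℂ] D →ₗ[ℂ] (H →L[ℂ] H) :=
  TensorProduct.lift
    ((LinearMap.mul ℂ (H →L[ℂ] H)).compl₁₂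
      ((π : B →ₙₐ[ℂ] (H →L[ℂ] H)) : B →ₗ[ℂ] (H →L[ℂ] H))
      ((σ : D →ₙₐ[ℂ] (H →L[ℂ] H)) : D →ₗ[ℂ] (H →L[ℂ] H)))

/-- The maximal C*-norm on the algebraic tensor product `B ⊗ D`: the supremum of
`‖∑ π (b i) σ (d i)‖` over all pairs of commuting representations `π` of `B` and `σ` of `D` on a
Hilbert space. -/
def maxNorm (x : B ⊗[ℂ] D) : ℝ≥0∞ :=
  ⨆ (H : Type u) (_ : NormedAddCommGroup H) (_ : InnerProductSpace ℂ H) (_ : CompleteSpace H)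
    (π : B →⋆ₙₐ[ℂ] (H →L[ℂ] H)) (σ : D →⋆ₙₐ[ℂ] (H →L[ℂ] H))
    (_ : ∀ b d, Commute (π b) (σ d)), ‖productRep π σ x‖ₑ

/-- `ρ ⊗ id : A ⊗ D → B ⊗ D` is bounded by `K` from the minimal to the maximal norm, for all
C*-algebras `D`. -/
def NuclearBound (ρ : A →ₗ[ℂ] B) (K : ℝ≥0) : Prop :=
  ∀ (D : Type u) [NonUnitalCStarAlgebra D] (x : A ⊗[ℂ] D),
    maxNorm (ρ.rTensor D x) ≤ K * minNorm x

/-- The nuclear norm of a linear map between C*-algebras. -/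
def nuclearNorm (ρ : A →ₗ[ℂ] B) : ℝ≥0∞ :=
  ⨅ (K : ℝ≥0) (_ : NuclearBound ρ K), (K : ℝ≥0∞)

/-- A linear map between C*-algebras is nuclear if its nuclear norm is finite. -/
def IsNuclear (ρ : A →ₗ[ℂ] B) : Prop :=
  nuclearNorm ρ < ⊤

end Nuclear

/-! ### Closed ideals and weakly nuclear maps -/

/-- A closed two-sided (hence self-adjoint) ideal of a C*-algebra. -/
structure ClosedIdeal (E : Type u) [NonUnitalCStarAlgebra E] extends
    NonUnitalStarSubalgebra ℂ E where
  isClosed : IsClosed carrier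
  mul_mem_left : ∀ (e : E) {j : E}, j ∈ carrier → e * j ∈ carrier
  mul_mem_right : ∀ (e : E) {j : E}, j ∈ carrier → j * e ∈ carrier

namespace ClosedIdeal

variable {E : Type u} [NonUnitalCStarAlgebra E]

instance : CoeSort (ClosedIdeal E) (Type u) := ⟨fun J => J.toNonUnitalStarSubalgebra⟩

instance (J : ClosedIdeal E) : IsClosed (J.toNonUnitalStarSubalgebra : Set E) := J.isClosed

/-- `e * j` as an element of the ideal. -/
def lmul (J : ClosedIdeal E) (e : E) (j : J) : J := ⟨e * j, J.mul_mem_left e j.2⟩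

/-- `j * e` as an element of the ideal. -/
def rmul (J : ClosedIdeal E) (j : J) (e : E) : J := ⟨j * e, J.mul_mem_right e j.2⟩

end ClosedIdeal

/-- A homomorphism as a linear map. -/
def toLin {A C : Type u} [NonUnitalCStarAlgebra A] [NonUnitalCStarAlgebra C]
    (f : A →⋆ₙₐ[ℂ] C) : A →ₗ[ℂ] C where
  toFun := f
  map_add' := map_add f
  map_smul' := map_smul f

/-- The linear map `x ↦ φ x * b`, from `A` to the ideal `J`, for `b ∈ J`. -/
def mulRight {A E : Type u} [NonUnitalCStarAlgebra A] [NonUnitalCStarAlgebra E]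
    (J : ClosedIdeal E) (φ : A →⋆ₙₐ[ℂ] E) (b : J) : A →ₗ[ℂ] J where
  toFun x := J.lmul (φ x) b
  map_add' x y := Subtype.ext (by simp [ClosedIdeal.lmul, add_mul])
  map_smul' c x := Subtype.ext (by simp [ClosedIdeal.lmul, smul_mul_assoc])

/-- `φ : A → E` is weakly nuclear relative to the closed ideal `J` of `E` if `x ↦ φ x * b` is
nuclear as a map `A → J`, for all `b ∈ J`. -/
def IsWeaklyNuclear {A E : Type u} [NonUnitalCStarAlgebra A] [NonUnitalCStarAlgebra E]
    (J : ClosedIdeal E) (φ : A →⋆ₙₐ[ℂ] E) : Prop :=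
  ∀ b : J, IsNuclear (mulRight J φ b)

/-! ### The free product `QA = A ⋆ A` and the ideal `qA` -/

section FreeProduct

/-- Formal noncommutative *-polynomials without constant term in two copies of the elements
of `A`. -/
inductive Term (A : Type u) : Type u
  | inl : A → Term A
  | inr : A → Term A
  | add : Term A → Term A → Term A
  | mul : Term A → Term A → Term A
  | smul : ℂ → Term A → Term A
  | star : Term A → Term A

variable {A C : Type u} [NonUnitalCStarAlgebra A] [NonUnitalCStarAlgebra C]

/-- Evaluation of a formal polynomial under a pair of homomorphisms `A → C`. -/
def Term.eval (φ φ' : A →⋆ₙₐ[ℂ] C) : Term A → C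
  | .inl a => φ a
  | .inr a => φ' a
  | .add s t => s.eval φ φ' + t.eval φ φ'
  | .mul s t => s.eval φ φ' * t.eval φ φ'
  | .smul c t => c • t.eval φ φ'
  | .star t => Star.star (t.eval φ φ')

variable (A) in
/-- The C*-seminorms on formal polynomials induced by pairs of homomorphisms from `A` into some
C*-algebra. -/
def PairSeminorm : Type u :=
  {p : Term A → ℝ // ∃ (C : Type u) (_ : NonUnitalCStarAlgebra C) (φ φ' : A →⋆ₙₐ[ℂ] C),
    ∀ t, p t = ‖t.eval φ φ'‖}

namespace PairSeminorm

/-- A C*-algebra realising the seminorm. -/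
def Alg (p : PairSeminorm A) : Type u := p.2.choose

instance (p : PairSeminorm A) : NonUnitalCStarAlgebra p.Alg := p.2.choose_spec.choose

/-- The first homomorphism of a pair realising the seminorm. -/
def fst (p : PairSeminorm A) : A →⋆ₙₐ[ℂ] p.Alg := p.2.choose_spec.choose_spec.choose

/-- The second homomorphism of a pair realising the seminorm. -/
def snd (p : PairSeminorm A) : A →⋆ₙₐ[ℂ] p.Alg :=
  p.2.choose_spec.choose_spec.choose_spec.choose

theorem apply_eq (p : PairSeminorm A) (t : Term A) : p.1 t = ‖t.eval p.fst p.snd‖ :=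
  p.2.choose_spec.choose_spec.choose_spec.choose_spec t

/-- The seminorm of a given pair. -/
def mk (φ φ' : A →⋆ₙₐ[ℂ] C) : PairSeminorm A := ⟨fun t => ‖t.eval φ φ'‖, C, _, φ, φ', fun _ => rfl⟩

end PairSeminorm

variable (A) in
/-- The C*-algebraic product of the algebras realising all the pairs. -/
abbrev PairProduct : Type u := lp (fun p : PairSeminorm A => p.Alg) ∞

/-- The homomorphism into the product given by a family of homomorphisms. -/
def toProduct (f : ∀ p : PairSeminorm A, A →⋆ₙₐ[ℂ] p.Alg) : A →⋆ₙₐ[ℂ] PairProduct A where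
  toFun a := ⟨fun p => f p a, memℓp_infty ⟨‖a‖, by
    rintro _ ⟨p, rfl⟩; exact NonUnitalStarAlgHom.norm_apply_le (f p) a⟩⟩
  map_smul' c a := by ext p; simp
  map_zero' := by ext p; simp
  map_add' a b := by ext p; exact map_add (f p) a b
  map_mul' a b := by ext p; simp [lp.infty_coeFn_mul]
  map_star' a := by ext p; exact map_star (f p) a

variable (A) in
/-- The closed *-subalgebra of the product generated by the two universal copies of `A`. -/
def freeProduct : NonUnitalStarSubalgebra ℂ (PairProduct A) :=
  (NonUnitalStarAlgebra.adjoin ℂ (Set.range (toProduct (A := A) fun p => p.fst) ∪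
    Set.range (toProduct (A := A) fun p => p.snd))).topologicalClosure

instance : IsClosed (freeProduct A : Set (PairProduct A)) :=
  NonUnitalStarSubalgebra.isClosed_topologicalClosure _

variable (A) in
/-- `QA`, the full C*-algebraic free product of two copies of `A`. It is the C*-algebra generated by
two copies of `A` that is universal for pairs of homomorphisms out of `A`, see
`Q.existsUnique_lift`. -/
abbrev Q : Type u := freeProduct A

/-- The first inclusion of `A` into `QA`. -/
def iota : A →⋆ₙₐ[ℂ] Q A :=
  NonUnitalStarAlgHom.codRestrict (toProduct fun p => p.fst) (freeProduct A) fun a =>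
    NonUnitalStarSubalgebra.le_topologicalClosure _
      (NonUnitalStarAlgebra.subset_adjoin ℂ _ (Or.inl ⟨a, rfl⟩))

/-- The second inclusion of `A` into `QA`. -/
def iotaBar : A →⋆ₙₐ[ℂ] Q A :=
  NonUnitalStarAlgHom.codRestrict (toProduct fun p => p.snd) (freeProduct A) fun a =>
    NonUnitalStarSubalgebra.le_topologicalClosure _
      (NonUnitalStarAlgebra.subset_adjoin ℂ _ (Or.inr ⟨a, rfl⟩))

theorem Term.map_eval {C' : Type u} [NonUnitalCStarAlgebra C'] (f : C →⋆ₙₐ[ℂ] C')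
    (φ φ' : A →⋆ₙₐ[ℂ] C) (t : Term A) :
    f (t.eval φ φ') = t.eval (f.comp φ) (f.comp φ') := by
  induction t with
  | star t ih => exact (map_star f _).trans (congrArg Star.star ih)
  | _ => simp_all [Term.eval]

/-- Elements of the *-algebra generated by the images of a pair of homomorphisms are values of
formal polynomials. -/
theorem exists_eval (φ φ' : A →⋆ₙₐ[ℂ] C) {x : C}
    (hx : x ∈ NonUnitalStarAlgebra.adjoin ℂ (Set.range φ ∪ Set.range φ')) :
    ∃ t : Term A, t.eval φ φ' = x := by
  induction hx using NonUnitalStarAlgebra.adjoin_induction with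
  | mem x hx =>
    rcases hx with ⟨a, rfl⟩ | ⟨a, rfl⟩
    exacts [⟨.inl a, rfl⟩, ⟨.inr a, rfl⟩]
  | add x y _ _ hx hy =>
    obtain ⟨s, rfl⟩ := hx; obtain ⟨t, rfl⟩ := hy; exact ⟨.add s t, rfl⟩
  | zero => exact ⟨.inl 0, map_zero φ⟩
  | mul x y _ _ hx hy =>
    obtain ⟨s, rfl⟩ := hx; obtain ⟨t, rfl⟩ := hy; exact ⟨.mul s t, rfl⟩
  | smul c x _ hx => obtain ⟨s, rfl⟩ := hx; exact ⟨.smul c s, rfl⟩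
  | star x _ hx => obtain ⟨s, rfl⟩ := hx; exact ⟨.star s, rfl⟩

/-- Every pair of homomorphisms is dominated by the universal pair. -/
theorem norm_eval_le (φ φ' : A →⋆ₙₐ[ℂ] C) (t : Term A) :
    ‖t.eval φ φ'‖ ≤ ‖t.eval (iota (A := A)) iotaBar‖ := by
  let p := PairSeminorm.mk φ φ'
  let ev : PairProduct A →⋆ₙₐ[ℂ] p.Alg :=
    { toFun := fun x => x p
      map_smul' := fun c x => by simp
      map_zero' := by simp
      map_add' := fun x y => by simp
      map_mul' := fun x y => by simp [lp.infty_coeFn_mul]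
      map_star' := fun x => by simp }
  let g : Q A →⋆ₙₐ[ℂ] p.Alg := ev.comp (NonUnitalStarSubalgebraClass.subtype (freeProduct A))
  have h1 : g (t.eval iota iotaBar) = t.eval p.fst p.snd := by
    rw [Term.map_eval]; rfl
  calc ‖t.eval φ φ'‖ = p.1 t := rfl
    _ = ‖t.eval p.fst p.snd‖ := p.apply_eq t
    _ = ‖g (t.eval iota iotaBar)‖ := by rw [h1]
    _ ≤ _ := NonUnitalStarAlgHom.norm_apply_le g _

theorem Q.closure_adjoin :
    (NonUnitalStarAlgebra.adjoin ℂ (Set.range (iota (A := A)) ∪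
      Set.range (iotaBar (A := A)))).topologicalClosure = ⊤ := by
  rw [NonUnitalStarAlgebra.eq_top_iff]
  intro x
  have h1 : (Subtype.val : Q A → PairProduct A) ''
      (NonUnitalStarAlgebra.adjoin ℂ (Set.range (iota (A := A)) ∪ Set.range (iotaBar (A := A))) :
        Set (Q A)) =
      NonUnitalStarAlgebra.adjoin ℂ (Set.range (toProduct (A := A) fun p => p.fst) ∪
        Set.range (toProduct (A := A) fun p => p.snd)) := by
    have := NonUnitalStarAlgHom.map_adjoin (R := ℂ)
      (NonUnitalStarSubalgebraClass.subtype (freeProduct A))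
      (Set.range (iota (A := A)) ∪ Set.range (iotaBar (A := A)))
    rw [Set.image_union, ← Set.range_comp, ← Set.range_comp] at this
    exact congrArg (fun S : NonUnitalStarSubalgebra ℂ (PairProduct A) =>
      (S : Set (PairProduct A))) this
  have h2 : x ∈ closure (NonUnitalStarAlgebra.adjoin ℂ (Set.range (iota (A := A)) ∪
      Set.range (iotaBar (A := A))) : Set (Q A)) := by
    rw [closure_subtype, h1]
    exact x.2
  exact h2

theorem hom_continuous {A C : Type u} [NonUnitalCStarAlgebra A] [NonUnitalCStarAlgebra C]
    (f : A →⋆ₙₐ[ℂ] C) : Continuous f :=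
  AddMonoidHomClass.continuous_of_bound f 1 fun a => by
    simpa using NonUnitalStarAlgHom.norm_apply_le f a

section

variable {P : Type u} [NonUnitalCStarAlgebra P]

theorem pair_hom_ext {i i' : A →⋆ₙₐ[ℂ] P} (hi : (NonUnitalStarAlgebra.adjoin ℂ
    (Set.range i ∪ Set.range i')).topologicalClosure = ⊤) {f g : P →⋆ₙₐ[ℂ] C} (h : f.comp i = g.comp i)
    (h' : f.comp i' = g.comp i') : f = g := by
  have hcl : IsClosed {x : P | f x = g x} := isClosed_eq (hom_continuous f) (hom_continuous g)
  ext x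
  have hx : x ∈ (NonUnitalStarAlgebra.adjoin ℂ (Set.range i ∪
      Set.range i')).topologicalClosure := by
    rw [hi]; exact NonUnitalStarAlgebra.mem_top
  refine closure_minimal ?_ hcl hx
  intro y hy
  obtain ⟨t, rfl⟩ := exists_eval _ _ hy
  show f _ = g _
  rw [Term.map_eval, Term.map_eval, h, h']

theorem pair_existsUnique {i i' : A →⋆ₙₐ[ℂ] P} (hi : (NonUnitalStarAlgebra.adjoin ℂ
    (Set.range i ∪ Set.range i')).topologicalClosure = ⊤) (φ φ' : A →⋆ₙₐ[ℂ] C)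
    (hn : ∀ t : Term A, ‖t.eval φ φ'‖ ≤ ‖t.eval i i'‖) :
    ∃! f : P →⋆ₙₐ[ℂ] C, f.comp i = φ ∧ f.comp i' = φ' := by
  let k := i.prod φ
  let k' := i'.prod φ'
  let G := (NonUnitalStarAlgebra.adjoin ℂ (Set.range k ∪ Set.range k')).topologicalClosure
  have hGc : IsClosed (G : Set (P × C)) := NonUnitalStarSubalgebra.isClosed_topologicalClosure _
  have hk : ∀ a, k a ∈ G := fun a => NonUnitalStarSubalgebra.le_topologicalClosure _
    (NonUnitalStarAlgebra.subset_adjoin ℂ _ (Or.inl ⟨a, rfl⟩))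
  have hk' : ∀ a, k' a ∈ G := fun a => NonUnitalStarSubalgebra.le_topologicalClosure _
    (NonUnitalStarAlgebra.subset_adjoin ℂ _ (Or.inr ⟨a, rfl⟩))
  have hG : ∀ x ∈ G, ‖x.2‖ ≤ ‖x.1‖ := by
    intro x hx
    have hcl : IsClosed {x : P × C | ‖x.2‖ ≤ ‖x.1‖} :=
      isClosed_le (by fun_prop) (by fun_prop)
    refine closure_minimal ?_ hcl hx
    intro y hy
    obtain ⟨t, rfl⟩ := exists_eval k k' hy
    have e1 := Term.map_eval (NonUnitalStarAlgHom.fst ℂ (P) C) k k' t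
    have e2 := Term.map_eval (NonUnitalStarAlgHom.snd ℂ (P) C) k k' t
    have e1' : (t.eval k k').1 = t.eval i i' := e1
    have e2' : (t.eval k k').2 = t.eval φ φ' := e2
    show ‖_‖ ≤ ‖_‖
    rw [e1', e2']
    exact hn t
  let pr : G →⋆ₙₐ[ℂ] P :=
    (NonUnitalStarAlgHom.fst ℂ (P) C).comp (NonUnitalStarSubalgebraClass.subtype G)
  have hpr : ∀ x, pr x = x.1.1 := fun _ => rfl
  have hinj : Function.Injective pr := by
    rw [injective_iff_map_eq_zero]
    intro x hx
    have h1 : x.1.1 = 0 := hx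
    have h2 : x.1.2 = 0 := by
      have := hG x.1 x.2
      rw [h1, norm_zero] at this
      exact norm_le_zero_iff.mp this
    exact Subtype.ext (Prod.ext h1 h2)
  have hsurj : Function.Surjective pr := by
    have hcl : IsClosed (NonUnitalStarAlgHom.range pr : Set (P)) := by
      rw [NonUnitalStarAlgHom.coe_range]
      have : CompleteSpace G := hGc.completeSpace_coe
      exact (NonUnitalStarAlgHom.isometry pr hinj).isClosedEmbedding.isClosed_range
    have hle : (⊤ : NonUnitalStarSubalgebra ℂ (P)) ≤ NonUnitalStarAlgHom.range pr := by
      rw [← hi]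
      refine NonUnitalStarSubalgebra.topologicalClosure_minimal _
        (NonUnitalStarAlgebra.adjoin_le ?_) hcl
      rintro _ (⟨a, rfl⟩ | ⟨a, rfl⟩)
      exacts [⟨⟨k a, hk a⟩, rfl⟩, ⟨⟨k' a, hk' a⟩, rfl⟩]
    intro x
    exact hle (NonUnitalStarAlgebra.mem_top (x := x))
  let e : G ≃⋆ₐ[ℂ] P := StarAlgEquiv.ofBijective pr ⟨hinj, hsurj⟩
  obtain ⟨f, hf⟩ : ∃ f : P →⋆ₙₐ[ℂ] C, ∀ x : G, f (pr x) = x.1.2 := by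
    refine ⟨((NonUnitalStarAlgHom.snd ℂ (P) C).comp
      (NonUnitalStarSubalgebraClass.subtype G)).comp (e.symm : P →⋆ₙₐ[ℂ] G), fun x => ?_⟩
    have : e.symm (pr x) = x := e.symm_apply_apply x
    show ((e.symm (pr x)) : P × C).2 = x.1.2
    rw [this]
  have h1 : f.comp i = φ := DFunLike.ext _ _ fun a => hf ⟨k a, hk a⟩
  have h2 : f.comp i' = φ' := DFunLike.ext _ _ fun a => hf ⟨k' a, hk' a⟩
  exact ⟨f, ⟨h1, h2⟩, fun g hg => pair_hom_ext hi (hg.1.trans h1.symm) (hg.2.trans h2.symm)⟩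

end

/-- Universal property of `QA`. -/
theorem Q.existsUnique_lift (φ φ' : A →⋆ₙₐ[ℂ] C) :
    ∃! f : Q A →⋆ₙₐ[ℂ] C, f.comp iota = φ ∧ f.comp iotaBar = φ' :=
  pair_existsUnique Q.closure_adjoin φ φ' (norm_eval_le φ φ')

/-- The homomorphism `QA → C` that restricts to `φ` and `φ'` on the two copies of `A`. -/
def Q.lift (φ φ' : A →⋆ₙₐ[ℂ] C) : Q A →⋆ₙₐ[ℂ] C := (Q.existsUnique_lift φ φ').choose

theorem Q.lift_iota (φ φ' : A →⋆ₙₐ[ℂ] C) (a : A) : Q.lift φ φ' (iota a) = φ a :=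
  DFunLike.congr_fun (Q.existsUnique_lift φ φ').choose_spec.1.1 a

theorem Q.lift_iotaBar (φ φ' : A →⋆ₙₐ[ℂ] C) (a : A) : Q.lift φ φ' (iotaBar a) = φ' a :=
  DFunLike.congr_fun (Q.existsUnique_lift φ φ').choose_spec.1.2 a

/-- The kernel of a homomorphism as a closed ideal. -/
def kernel (f : A →⋆ₙₐ[ℂ] C) : ClosedIdeal A where
  toNonUnitalStarSubalgebra := NonUnitalStarSubalgebra.comap f ⊥
  isClosed := by
    have : ((NonUnitalStarSubalgebra.comap f ⊥ : NonUnitalStarSubalgebra ℂ A) : Set A) =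
        f ⁻¹' {0} := by ext; simp
    show IsClosed ((NonUnitalStarSubalgebra.comap f ⊥ : NonUnitalStarSubalgebra ℂ A) : Set A)
    rw [this]
    exact isClosed_singleton.preimage (hom_continuous f)
  mul_mem_left e j hj := by
    have hj : f j = 0 := NonUnitalStarAlgebra.mem_bot.mp hj
    exact NonUnitalStarAlgebra.mem_bot.mpr (by
      show f (e * j) = 0
      rw [map_mul, hj, mul_zero])
  mul_mem_right e j hj := by
    have hj : f j = 0 := NonUnitalStarAlgebra.mem_bot.mp hj
    exact NonUnitalStarAlgebra.mem_bot.mpr (by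
      show f (j * e) = 0
      rw [map_mul, hj, zero_mul])

theorem mem_kernel {f : A →⋆ₙₐ[ℂ] C} {a : A} :
    a ∈ (kernel f).toNonUnitalStarSubalgebra ↔ f a = 0 :=
  NonUnitalStarAlgebra.mem_bot

variable (A) in
/-- `qA`, the kernel of the map `QA → A` that identifies the two copies of `A`. -/
def qIdeal : ClosedIdeal (Q A) :=
  kernel (Q.lift (NonUnitalStarAlgHom.id ℂ A) (NonUnitalStarAlgHom.id ℂ A))

/-- The linear map `x ↦ qx = ι(x) - ῑ(x)` from `A` to `qA`. -/
def q : A →ₗ[ℂ] qIdeal A where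
  toFun x := ⟨iota x - iotaBar x, mem_kernel.mpr (by
    rw [map_sub, Q.lift_iota, Q.lift_iotaBar, sub_self])⟩
  map_add' x y := Subtype.ext (by
    show iota (x + y) - iotaBar (x + y) = (iota x - iotaBar x) + (iota y - iotaBar y)
    rw [map_add, map_add, add_sub_add_comm])
  map_smul' c x := Subtype.ext (by
    show iota (c • x) - iotaBar (c • x) = c • (iota x - iotaBar x)
    rw [map_smul, map_smul, smul_sub])

/-- If `φ` and `φ'` agree modulo the closed ideal `J`, then the induced homomorphism on `QA` maps
`qA` to `J`. -/
theorem lift_mem (J : ClosedIdeal C) (φ φ' : A →⋆ₙₐ[ℂ] C)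
    (h : ∀ x, φ x - φ' x ∈ J.toNonUnitalStarSubalgebra) (z : qIdeal A) :
    Q.lift φ φ' z ∈ J.toNonUnitalStarSubalgebra := by
  let f : Q A →⋆ₙₐ[ℂ] A := Q.lift (NonUnitalStarAlgHom.id ℂ A) (NonUnitalStarAlgHom.id ℂ A)
  have key : ∀ z : Q A, Q.lift φ φ' z - φ (f z) ∈ J.toNonUnitalStarSubalgebra := by
    have hc : Continuous fun z : Q A => Q.lift φ φ' z - φ (f z) :=
      (hom_continuous _).sub ((hom_continuous φ).comp (hom_continuous f))
    have hcl : IsClosed {z : Q A | Q.lift φ φ' z - φ (f z) ∈ J.toNonUnitalStarSubalgebra} :=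
      J.isClosed.preimage hc
    intro z
    have hz : z ∈ (NonUnitalStarAlgebra.adjoin ℂ (Set.range (iota (A := A)) ∪
        Set.range (iotaBar (A := A)))).topologicalClosure := by
      rw [Q.closure_adjoin]; exact NonUnitalStarAlgebra.mem_top
    refine closure_minimal ?_ hcl hz
    intro y hy
    obtain ⟨t, rfl⟩ := exists_eval _ _ hy
    show Q.lift φ φ' (t.eval iota iotaBar) - φ (f (t.eval iota iotaBar)) ∈ J.toNonUnitalStarSubalgebra
    have e1 : Q.lift φ φ' (t.eval iota iotaBar) = t.eval φ φ' := by
      have h1 : (Q.lift φ φ').comp iota = φ := (Q.existsUnique_lift φ φ').choose_spec.1.1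
      have h2 : (Q.lift φ φ').comp iotaBar = φ' := (Q.existsUnique_lift φ φ').choose_spec.1.2
      rw [Term.map_eval, h1, h2]
    have e2 : φ (f (t.eval iota iotaBar)) = t.eval φ φ := by
      rw [Term.map_eval, Term.map_eval]
      have h1 : f.comp iota = NonUnitalStarAlgHom.id ℂ A :=
        (Q.existsUnique_lift _ _).choose_spec.1.1
      have h2 : f.comp iotaBar = NonUnitalStarAlgHom.id ℂ A :=
        (Q.existsUnique_lift _ _).choose_spec.1.2
      rw [h1, h2]; rfl
    rw [e1, e2]
    clear hy e1 e2
    induction t with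
    | inl a => simp [Term.eval]
    | inr a =>
      show φ' a - φ a ∈ J.toNonUnitalStarSubalgebra
      rw [← neg_sub]; exact neg_mem (h a)
    | add s t hs ht =>
      show (s.eval φ φ' + t.eval φ φ') - (s.eval φ φ + t.eval φ φ) ∈ J.toNonUnitalStarSubalgebra
      rw [add_sub_add_comm]; exact add_mem hs ht
    | mul s t hs ht =>
      show s.eval φ φ' * t.eval φ φ' - s.eval φ φ * t.eval φ φ ∈ J.toNonUnitalStarSubalgebra
      have : s.eval φ φ' * t.eval φ φ' - s.eval φ φ * t.eval φ φ =
          (s.eval φ φ' - s.eval φ φ) * t.eval φ φ' +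
            s.eval φ φ * (t.eval φ φ' - t.eval φ φ) := by
        rw [sub_mul, mul_sub]; abel
      rw [this]
      exact add_mem (J.mul_mem_right _ hs) (J.mul_mem_left _ ht)
    | smul c t ht =>
      show c • t.eval φ φ' - c • t.eval φ φ ∈ J.toNonUnitalStarSubalgebra
      rw [← smul_sub]; exact SMulMemClass.smul_mem c ht
    | star t ht =>
      show Star.star (t.eval φ φ') - Star.star (t.eval φ φ) ∈ J.toNonUnitalStarSubalgebra
      rw [← star_sub]; exact star_mem ht
  have hz : f z = 0 := mem_kernel.mp z.2
  have := key z
  rwa [hz, map_zero, sub_zero] at this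

/-- A prequasihomomorphism `A ⇉ E ▷ J → B`. -/
structure Prequasihom (A B E : Type u) [NonUnitalCStarAlgebra A] [NonUnitalCStarAlgebra B]
    [NonUnitalCStarAlgebra E] (J : ClosedIdeal E) where
  φ : A →⋆ₙₐ[ℂ] E
  φbar : A →⋆ₙₐ[ℂ] E
  sub_mem : ∀ x, φ x - φbar x ∈ J.toNonUnitalStarSubalgebra
  μ : J →⋆ₙₐ[ℂ] B

/-- The homomorphism `q(φ, φbar) : qA → B` induced by a prequasihomomorphism. -/
def Prequasihom.hom {B E : Type u} [NonUnitalCStarAlgebra B] [NonUnitalCStarAlgebra E]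
    {J : ClosedIdeal E} (P : Prequasihom A B E J) : qIdeal A →⋆ₙₐ[ℂ] B :=
  P.μ.comp (NonUnitalStarAlgHom.codRestrict
    ((Q.lift P.φ P.φbar).comp
      (NonUnitalStarSubalgebraClass.subtype (qIdeal A).toNonUnitalStarSubalgebra))
    J.toNonUnitalStarSubalgebra (lift_mem J P.φ P.φbar P.sub_mem))

end FreeProduct

/-! ### The hereditary subalgebra, the Hilbert module and the canonical extension -/

section Extension

variable {R B : Type u} [NonUnitalCStarAlgebra R] [NonUnitalCStarAlgebra B]
  {I : ClosedIdeal R}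

theorem exists_approxUnit (C : Type u) [NonUnitalCStarAlgebra C] :
    ∃ l : Filter C, l.NeBot ∧ (∀ᶠ u in l, ‖u‖ ≤ 1) ∧
      (∀ c : C, Filter.Tendsto (fun u => u * c) l (𝓝 c)) ∧
      ∀ c : C, Filter.Tendsto (fun u => c * u) l (𝓝 c) := by
  let _ := CStarAlgebra.spectralOrder C
  have := CStarAlgebra.spectralOrderedRing C
  have h := CStarAlgebra.increasingApproximateUnit C
  exact ⟨_, h.neBot, h.eventually_norm, h.tendsto_mul_right, h.tendsto_mul_left⟩

/-- The hereditary subalgebra `closure (X B X)` of `B` generated by the image `X` of `ψ`. -/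
def hereditary (ψ : I →⋆ₙₐ[ℂ] B) : NonUnitalStarSubalgebra ℂ B :=
  (NonUnitalStarAlgebra.adjoin ℂ
    {x : B | ∃ (y : I) (b : B) (y' : I), x = ψ y * b * ψ y'}).topologicalClosure

instance (ψ : I →⋆ₙₐ[ℂ] B) : IsClosed (hereditary ψ : Set B) :=
  NonUnitalStarSubalgebra.isClosed_topologicalClosure _

/-- The closed right ideal `ψ(I)B` of `B`, as a closed subspace. -/
def rightIdeal (ψ : I →⋆ₙₐ[ℂ] B) : Submodule ℂ B :=
  (Submodule.span ℂ {x : B | ∃ (y : I) (b : B), x = ψ y * b}).topologicalClosure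

theorem isClosed_rightIdeal (ψ : I →⋆ₙₐ[ℂ] B) : IsClosed (rightIdeal ψ : Set B) :=
  Submodule.isClosed_topologicalClosure _

instance (ψ : I →⋆ₙₐ[ℂ] B) : CompleteSpace (rightIdeal ψ) :=
  (isClosed_rightIdeal ψ).completeSpace_coe

theorem norm_hom_le {A C : Type u} [NonUnitalCStarAlgebra A] [NonUnitalCStarAlgebra C]
    (f : A →⋆ₙₐ[ℂ] C) (a : A) : ‖f a‖ ≤ ‖a‖ := NonUnitalStarAlgHom.norm_apply_le f a

variable (ψ : I →⋆ₙₐ[ℂ] B)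

theorem mul_mem_rightIdeal {e : B} (he : e ∈ rightIdeal ψ) (b : B) : e * b ∈ rightIdeal ψ := by
  have hcl : IsClosed {e : B | e * b ∈ rightIdeal ψ} :=
    (isClosed_rightIdeal ψ).preimage (continuous_mul_const b)
  refine closure_minimal ?_ hcl he
  intro x hx
  induction hx using Submodule.span_induction with
  | mem x hx =>
    obtain ⟨y, c, rfl⟩ := hx
    exact Submodule.le_topologicalClosure _ (Submodule.subset_span ⟨y, c * b, mul_assoc _ _ _⟩)
  | zero => show (0 : B) * b ∈ rightIdeal ψ; simp
  | add x y _ _ hx hy => show (x + y) * b ∈ rightIdeal ψ; rw [add_mul]; exact add_mem hx hy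
  | smul c x _ hx =>
    show (c • x) * b ∈ rightIdeal ψ
    rw [smul_mul_assoc]; exact Submodule.smul_mem _ _ hx

theorem gen_mem (y : I) (b : B) : ψ y * b ∈ rightIdeal ψ :=
  Submodule.le_topologicalClosure _ (Submodule.subset_span ⟨y, b, rfl⟩)

theorem tendsto_unit {l : Filter I} (hl : ∀ᶠ u in l, ‖u‖ ≤ 1)
    (hl' : ∀ c : I, Filter.Tendsto (fun u => u * c) l (𝓝 c)) {e : B} (he : e ∈ rightIdeal ψ) :
    Filter.Tendsto (fun u => ψ u * e) l (𝓝 e) := by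
  have hs : ∀ x ∈ Submodule.span ℂ {x : B | ∃ (y : I) (b : B), x = ψ y * b},
      Filter.Tendsto (fun u => ψ u * x) l (𝓝 x) := by
    intro x hx
    induction hx using Submodule.span_induction with
    | mem x hx =>
      obtain ⟨y, c, rfl⟩ := hx
      have h1 : Filter.Tendsto (fun u => ψ (u * y)) l (𝓝 (ψ y)) :=
        ((hom_continuous ψ).tendsto y).comp (hl' y)
      simpa [map_mul, mul_assoc] using h1.mul_const c
    | zero => simpa using tendsto_const_nhds
    | add x y _ _ hx hy => simpa [mul_add] using hx.add hy
    | smul c x _ hx => simpa [mul_smul_comm] using hx.const_smul c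
  rw [Metric.tendsto_nhds]
  intro ε hε
  obtain ⟨x, hx, hxe⟩ := Metric.mem_closure_iff.mp he (ε / 3) (by positivity)
  filter_upwards [hl, Metric.tendsto_nhds.mp (hs x hx) (ε / 3) (by positivity)] with u h1 h2
  have h3 : ‖ψ u * e - ψ u * x‖ ≤ ‖e - x‖ := by
    rw [← mul_sub]
    calc _ ≤ ‖ψ u‖ * ‖e - x‖ := norm_mul_le _ _
      _ ≤ 1 * ‖e - x‖ := by gcongr; exact (norm_hom_le ψ u).trans h1
      _ = _ := one_mul _
  rw [dist_eq_norm] at h2 hxe ⊢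
  have : ψ u * e - e = (ψ u * e - ψ u * x) + (ψ u * x - x) + -(e - x) := by abel
  rw [this]
  calc _ ≤ ‖ψ u * e - ψ u * x‖ + ‖ψ u * x - x‖ + ‖-(e - x)‖ := norm_add₃_le
    _ < ε := by rw [norm_neg]; linarith

theorem eq_of_forall {e e' : B} (he : e ∈ rightIdeal ψ) (he' : e' ∈ rightIdeal ψ)
    (h : ∀ y : I, ψ y * e = ψ y * e') : e = e' := by
  obtain ⟨l, hl, h1, h2, -⟩ := exists_approxUnit I
  refine tendsto_nhds_unique (tendsto_unit ψ h1 h2 he) ?_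
  simp_rw [h]
  exact tendsto_unit ψ h1 h2 he'

theorem norm_le_of_forall {e e' : B} (z : R) (he' : e' ∈ rightIdeal ψ)
    (h : ∀ y : I, ψ y * e' = ψ (I.rmul y z) * e) : ‖e'‖ ≤ ‖z‖ * ‖e‖ := by
  obtain ⟨l, hl, h1, h2, -⟩ := exists_approxUnit I
  refine le_of_tendsto (tendsto_unit ψ h1 h2 he').norm ?_
  filter_upwards [h1] with u hu
  rw [h]
  calc _ ≤ ‖ψ (I.rmul u z)‖ * ‖e‖ := norm_mul_le _ _
    _ ≤ ‖z‖ * ‖e‖ := by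
      gcongr
      calc _ ≤ ‖I.rmul u z‖ := norm_hom_le ψ _
        _ = ‖(u : R) * z‖ := rfl
        _ ≤ ‖(u : R)‖ * ‖z‖ := norm_mul_le _ _
        _ ≤ 1 * ‖z‖ := by gcongr; exact hu
        _ = _ := one_mul _

/-- For `z ∈ R` and `e ∈ ψ(I)B` there is an element `z · e` of `ψ(I)B` with
`ψ(y) (z · e) = ψ(y z) e` for all `y ∈ I`. -/
theorem exists_ext (z : R) {e : B} (he : e ∈ rightIdeal ψ) :
    ∃ e' ∈ rightIdeal ψ, ∀ y : I, ψ y * e' = ψ (I.rmul y z) * e := by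
  have hs : ∀ x ∈ Submodule.span ℂ {x : B | ∃ (y : I) (b : B), x = ψ y * b},
      ∃ e' ∈ rightIdeal ψ, ∀ y : I, ψ y * e' = ψ (I.rmul y z) * x := by
    intro x hx
    induction hx using Submodule.span_induction with
    | mem x hx =>
      obtain ⟨w, c, rfl⟩ := hx
      refine ⟨_, gen_mem ψ (I.lmul z w) c, fun y => ?_⟩
      rw [← mul_assoc, ← mul_assoc, ← map_mul, ← map_mul]
      congr 2
      exact Subtype.ext (mul_assoc _ _ _).symm
    | zero => exact ⟨0, zero_mem _, fun y => by simp⟩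
    | add x x' _ _ hx hx' =>
      obtain ⟨f, hf, h⟩ := hx
      obtain ⟨f', hf', h'⟩ := hx'
      exact ⟨f + f', add_mem hf hf', fun y => by rw [mul_add, mul_add, h, h']⟩
    | smul c x _ hx =>
      obtain ⟨f, hf, h⟩ := hx
      exact ⟨c • f, Submodule.smul_mem _ _ hf, fun y => by rw [mul_smul_comm, mul_smul_comm, h]⟩
  obtain ⟨x, hx, hxe⟩ := mem_closure_iff_seq_limit.mp he
  choose f hf h using fun n => hs (x n) (hx n)
  have hc : CauchySeq f := by
    have hxc := Metric.cauchySeq_iff.mp hxe.cauchySeq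
    rw [Metric.cauchySeq_iff]
    intro ε hε
    obtain ⟨N, hN⟩ := hxc (ε / (‖z‖ + 1)) (by positivity)
    refine ⟨N, fun m hm n hn => ?_⟩
    have h1 := norm_le_of_forall ψ (e := x m - x n) z (sub_mem (hf m) (hf n))
      (fun y => by rw [mul_sub, mul_sub, h, h])
    have h2 := hN m hm n hn
    rw [dist_eq_norm] at h2 ⊢
    rw [lt_div_iff₀ (by positivity)] at h2
    nlinarith [norm_nonneg (x m - x n)]
  obtain ⟨e', he'⟩ := cauchySeq_tendsto_of_complete hc
  refine ⟨e', (isClosed_rightIdeal ψ).mem_of_tendsto he' (Filter.Eventually.of_forall hf),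
    fun y => ?_⟩
  refine tendsto_nhds_unique (he'.const_mul (ψ y)) ?_
  simp_rw [h]
  exact hxe.const_mul _

/-- The element `z · e` of `ψ(I)B`, determined by `ψ(y) (z · e) = ψ(y z) e` for `y ∈ I`. -/
def act (z : R) (e : rightIdeal ψ) : rightIdeal ψ :=
  ⟨(exists_ext ψ z e.2).choose, (exists_ext ψ z e.2).choose_spec.1⟩

theorem act_spec (z : R) (e : rightIdeal ψ) (y : I) :
    ψ y * (act ψ z e : B) = ψ (I.rmul y z) * e :=
  (exists_ext ψ z e.2).choose_spec.2 y

theorem act_unique {z : R} {e e' : rightIdeal ψ}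
    (h : ∀ y : I, ψ y * (e' : B) = ψ (I.rmul y z) * e) : act ψ z e = e' :=
  Subtype.ext (eq_of_forall ψ (act ψ z e).2 e'.2 fun y => by rw [act_spec, h])

/-- On generators the action of `R` on `ψ(I)B` is `z · ψ(y)b = ψ(zy)b`. -/
theorem act_gen (z : R) (y : I) (b : B) :
    act ψ z ⟨ψ y * b, gen_mem ψ y b⟩ = ⟨ψ (I.lmul z y) * b, gen_mem ψ _ b⟩ :=
  act_unique ψ fun w => by
    show ψ w * (ψ (I.lmul z y) * b) = ψ (I.rmul w z) * (ψ y * b)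
    rw [← mul_assoc, ← mul_assoc, ← map_mul, ← map_mul]
    congr 2
    exact Subtype.ext (mul_assoc _ _ _).symm

/-- For `y ∈ I` the action is left multiplication by `ψ y`. -/
theorem act_mem (y : I) (e : rightIdeal ψ) : (act ψ (y : R) e : B) = ψ y * e := by
  have hm : ψ y * (e : B) ∈ rightIdeal ψ := gen_mem ψ y e
  have : act ψ (y : R) e = ⟨ψ y * e, hm⟩ := act_unique ψ fun w => by
    show ψ w * (ψ y * (e : B)) = _
    rw [← mul_assoc, ← map_mul]; rfl
  rw [this]

/-- The action as a homomorphism from `R` to bounded operators on `ψ(I)B`. -/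
def actHom : R →ₙₐ[ℂ] (rightIdeal ψ →L[ℂ] rightIdeal ψ) where
  toFun z := LinearMap.mkContinuous
    { toFun := act ψ z
      map_add' := fun e f => act_unique ψ fun y => by
        rw [Submodule.coe_add, Submodule.coe_add, mul_add, mul_add, act_spec, act_spec]
      map_smul' := fun c e => act_unique ψ fun y => by
        simp only [RingHom.id_apply, Submodule.coe_smul, mul_smul_comm, act_spec] }
    ‖z‖ fun e => norm_le_of_forall ψ z (act ψ z e).2 (act_spec ψ z e)
  map_smul' c z := by
    ext1 e
    refine act_unique ψ fun y => ?_
    have : I.rmul y (c • z) = c • I.rmul y z := Subtype.ext (mul_smul_comm _ _ _)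
    rw [this, map_smul, smul_mul_assoc, ← act_spec, ← mul_smul_comm]; rfl
  map_zero' := by
    ext1 e
    refine act_unique ψ fun y => ?_
    have : I.rmul y (0 : R) = 0 := Subtype.ext (mul_zero _)
    rw [this, map_zero, zero_mul]; exact mul_zero _
  map_add' z w := by
    ext1 e
    refine act_unique ψ fun y => ?_
    have : I.rmul y (z + w) = I.rmul y z + I.rmul y w := Subtype.ext (mul_add _ _ _)
    rw [this, map_add, add_mul, ← act_spec, ← act_spec, ← mul_add]; rfl
  map_mul' z w := by
    ext1 e
    refine act_unique ψ fun y => ?_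
    have : I.rmul y (z * w) = I.rmul (I.rmul y z) w := Subtype.ext (mul_assoc _ _ _).symm
    rw [this, ← act_spec, ← act_spec]; rfl

theorem actHom_apply (z : R) (e : rightIdeal ψ) : actHom ψ z e = act ψ z e := rfl

theorem norm_actHom_le (z : R) : ‖actHom ψ z‖ ≤ ‖z‖ :=
  ContinuousLinearMap.opNorm_le_bound _ (norm_nonneg z) fun e =>
    norm_le_of_forall ψ z (act ψ z e).2 (act_spec ψ z e)

/-- `(z · e)* f = e* (z* · f)`. -/
theorem star_act_mul (z : R) (e f : rightIdeal ψ) :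
    star (act ψ z e : B) * f = star (e : B) * act ψ (star z) f := by
  obtain ⟨l, hl, h1, h2, -⟩ := exists_approxUnit I
  have hf := tendsto_unit ψ h1 h2 f.2
  have hg : Filter.Tendsto (fun u : I => (⟨ψ u * f, gen_mem ψ u f⟩ : rightIdeal ψ)) l (𝓝 f) :=
    tendsto_subtype_rng.mpr hf
  have hg' : Filter.Tendsto
      (fun u : I => star (e : B) * (actHom ψ (star z) ⟨ψ u * f, gen_mem ψ u f⟩ : B)) l
      (𝓝 (star (e : B) * (actHom ψ (star z) f : B))) :=
    (((continuous_subtype_val.comp (actHom ψ (star z)).continuous).tendsto f).comp hg).const_mul _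
  refine tendsto_nhds_unique (hf.const_mul (star (act ψ z e : B))) (hg'.congr fun u => ?_)
  rw [actHom_apply, act_gen]
  show star (e : B) * (ψ (I.lmul (star z) u) * f) = star (act ψ z e : B) * (ψ u * f)
  have h3 := congrArg star (act_spec ψ z e (star u))
  rw [star_mul, star_mul, ← map_star, ← map_star, star_star] at h3
  have h4 : star (I.rmul (star u) z) = I.lmul (star z) u :=
    Subtype.ext (by
      show star (star (u : R) * z) = star z * (u : R)
      rw [star_mul, star_star])
  rw [h4] at h3
  rw [← mul_assoc, ← mul_assoc, h3]

theorem hereditary_le {h : B} (hh : h ∈ hereditary ψ) : h ∈ rightIdeal ψ := by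
  have hs : ∀ x ∈ NonUnitalStarAlgebra.adjoin ℂ
      {x : B | ∃ (y : I) (b : B) (y' : I), x = ψ y * b * ψ y'},
      x ∈ rightIdeal ψ ∧ star x ∈ rightIdeal ψ := by
    intro x hx
    induction hx using NonUnitalStarAlgebra.adjoin_induction with
    | mem x hx =>
      obtain ⟨y, b, y', rfl⟩ := hx
      refine ⟨mul_mem_rightIdeal ψ (gen_mem ψ y b) _, ?_⟩
      rw [star_mul, ← map_star]
      exact gen_mem ψ _ _
    | add x y _ _ hx hy =>
      exact ⟨add_mem hx.1 hy.1, by rw [star_add]; exact add_mem hx.2 hy.2⟩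
    | zero => simp
    | mul x y _ _ hx hy =>
      exact ⟨mul_mem_rightIdeal ψ hx.1 y, by rw [star_mul]; exact mul_mem_rightIdeal ψ hy.2 _⟩
    | smul c x _ hx =>
      exact ⟨Submodule.smul_mem _ _ hx.1, by rw [star_smul]; exact Submodule.smul_mem _ _ hx.2⟩
    | star x _ hx => exact ⟨hx.2, by rw [star_star]; exact hx.1⟩
  exact closure_minimal (fun x hx => (hs x hx).1) (isClosed_rightIdeal ψ) hh

theorem mul_mem_hereditary (y : I) {h : B} (hh : h ∈ hereditary ψ) :
    ψ y * h ∈ hereditary ψ := by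
  have hH : IsClosed (hereditary ψ : Set B) := inferInstance
  have hcl : IsClosed {h : B | ψ y * h ∈ hereditary ψ} := hH.preimage (continuous_const_mul _)
  have hs : ∀ x ∈ NonUnitalStarAlgebra.adjoin ℂ
      {x : B | ∃ (y : I) (b : B) (y' : I), x = ψ y * b * ψ y'},
      ψ y * x ∈ hereditary ψ ∧ ψ y * star x ∈ hereditary ψ := by
    intro x hx
    induction hx using NonUnitalStarAlgebra.adjoin_induction with
    | mem x hx =>
      obtain ⟨w, b, w', rfl⟩ := hx
      constructor
      · exact NonUnitalStarSubalgebra.le_topologicalClosure _ (NonUnitalStarAlgebra.subset_adjoin ℂ _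
          ⟨y * w, b, w', by simp [map_mul, mul_assoc]⟩)
      · exact NonUnitalStarSubalgebra.le_topologicalClosure _ (NonUnitalStarAlgebra.subset_adjoin ℂ _
          ⟨y * star w', star b, star w, by simp [map_mul, map_star, mul_assoc]⟩)
    | add x y _ _ hx hy =>
      rw [star_add, mul_add, mul_add]; exact ⟨add_mem hx.1 hy.1, add_mem hx.2 hy.2⟩
    | zero => simp
    | mul x y hx' hy' hx hy =>
      rw [star_mul, ← mul_assoc, ← mul_assoc]
      exact ⟨mul_mem hx.1 (NonUnitalStarSubalgebra.le_topologicalClosure _ hy'),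
        mul_mem hy.2 (NonUnitalStarSubalgebra.le_topologicalClosure _ (star_mem hx'))⟩
    | smul c x _ hx =>
      rw [star_smul, mul_smul_comm, mul_smul_comm]
      exact ⟨SMulMemClass.smul_mem _ hx.1, SMulMemClass.smul_mem _ hx.2⟩
    | star x _ hx => rw [star_star]; exact hx.symm
  exact closure_minimal (fun x hx => (hs x hx).1) hcl hh

theorem act_mem_hereditary (z : R) {h : B} (hh : h ∈ hereditary ψ) :
    (act ψ z ⟨h, hereditary_le ψ hh⟩ : B) ∈ hereditary ψ := by
  have hH : IsClosed (hereditary ψ : Set B) := inferInstance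
  obtain ⟨l, hl, h1, h2, -⟩ := exists_approxUnit I
  refine hH.mem_of_tendsto (tendsto_unit ψ h1 h2 (act ψ z ⟨h, hereditary_le ψ hh⟩).2)
    (Filter.Eventually.of_forall fun u => ?_)
  rw [act_spec]
  exact mul_mem_hereditary ψ _ hh

/-- Left multiplication by `z` on the hereditary subalgebra. -/
def leftAct (z : R) : hereditary ψ →L[ℂ] hereditary ψ :=
  LinearMap.mkContinuous
    { toFun := fun h => ⟨act ψ z ⟨h, hereditary_le ψ h.2⟩, act_mem_hereditary ψ z h.2⟩
      map_add' := fun h k => by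
        have := map_add (actHom ψ z) ⟨h, hereditary_le ψ h.2⟩ ⟨k, hereditary_le ψ k.2⟩
        have h2 := congrArg Subtype.val this
        exact Subtype.ext h2
      map_smul' := fun c h => by
        have := map_smul (actHom ψ z) c ⟨h, hereditary_le ψ h.2⟩
        have h2 := congrArg Subtype.val this
        exact Subtype.ext h2 }
    ‖z‖ fun h => norm_le_of_forall ψ z (act ψ z ⟨h, hereditary_le ψ h.2⟩).2 (act_spec ψ z _)

theorem leftAct_apply (z : R) (h : hereditary ψ) :
    (leftAct ψ z h : B) = act ψ z ⟨h, hereditary_le ψ h.2⟩ := rfl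

/-- Right multiplication `h ↦ (z* · h*)*` by `z` on the hereditary subalgebra. -/
def rightAct (z : R) : hereditary ψ →L[ℂ] hereditary ψ :=
  LinearMap.mkContinuous
    { toFun := fun h => star (leftAct ψ (star z) (star h))
      map_add' := fun h k => by rw [star_add, map_add, star_add]
      map_smul' := fun c h => by simp [star_smul] }
    ‖z‖ fun h => by
      have := norm_le_of_forall ψ (star z)
        (act ψ (star z) ⟨star (h : B), hereditary_le ψ (star_mem h.2)⟩).2
        (act_spec ψ (star z) ⟨star (h : B), hereditary_le ψ (star_mem h.2)⟩)
      rw [norm_star, Submodule.coe_mk, norm_star] at this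
      show ‖star (leftAct ψ (star z) (star h))‖ ≤ ‖z‖ * ‖h‖
      rw [norm_star]
      exact this

theorem rightAct_apply (z : R) (h : hereditary ψ) :
    rightAct ψ z h = star (leftAct ψ (star z) (star h)) := rfl

theorem leftAct_smul (c : ℂ) (z : R) : leftAct ψ (c • z) = c • leftAct ψ z := by
  refine ContinuousLinearMap.ext fun h => Subtype.ext ?_
  have h1 : (act ψ (c • z) ⟨h, hereditary_le ψ h.2⟩ : B) =
      c • (act ψ z ⟨h, hereditary_le ψ h.2⟩ : B) := by
    rw [← actHom_apply, map_smul]; rfl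
  rw [leftAct_apply, h1, smul_apply, NonUnitalStarSubalgebra.coe_smul, leftAct_apply]

theorem leftAct_zero : leftAct ψ (0 : R) = 0 := by
  refine ContinuousLinearMap.ext fun h => Subtype.ext ?_
  have h1 : (act ψ (0 : R) ⟨h, hereditary_le ψ h.2⟩ : B) = 0 := by
    rw [← actHom_apply, map_zero]; rfl
  rw [leftAct_apply, h1, zero_apply, NonUnitalStarSubalgebra.coe_zero]

theorem leftAct_add (z w : R) : leftAct ψ (z + w) = leftAct ψ z + leftAct ψ w := by
  refine ContinuousLinearMap.ext fun h => Subtype.ext ?_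
  have h1 : (act ψ (z + w) ⟨h, hereditary_le ψ h.2⟩ : B) =
      act ψ z ⟨h, hereditary_le ψ h.2⟩ + act ψ w ⟨h, hereditary_le ψ h.2⟩ := by
    rw [← actHom_apply, map_add]; rfl
  rw [leftAct_apply, h1, add_apply, NonUnitalStarSubalgebra.coe_add, leftAct_apply, leftAct_apply]

theorem leftAct_mul (z w : R) : leftAct ψ (z * w) = leftAct ψ z * leftAct ψ w := by
  refine ContinuousLinearMap.ext fun h => Subtype.ext ?_
  have h1 : (act ψ (z * w) ⟨h, hereditary_le ψ h.2⟩ : B) =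
      act ψ z (act ψ w ⟨h, hereditary_le ψ h.2⟩) := by
    rw [← actHom_apply, map_mul]; rfl
  rw [leftAct_apply, h1, mul_apply_eq_comp, leftAct_apply]; rfl

theorem ext_fst_snd {f g : 𝓜(ℂ, hereditary ψ)} (h : f.fst = g.fst) (h' : f.snd = g.snd) :
    f = g :=
  DoubleCentralizer.ext _ _ _ _ (Prod.ext h h')

/-- The canonical extension `ψ° : R → M(closure (ψ(I) B ψ(I)))` of `ψ : I → B`, with
`ψ°(z) ψ(y) b = ψ(z y) b`. -/
def canonicalExt : R →⋆ₙₐ[ℂ] 𝓜(ℂ, hereditary ψ) where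
  toFun z :=
    { toProd := (leftAct ψ z, rightAct ψ z)
      central := fun h k => Subtype.ext (by
        show star (act ψ (star z) ⟨star (h : B), hereditary_le ψ (star_mem h.2)⟩ : B) * (k : B) =
          (h : B) * act ψ z ⟨k, hereditary_le ψ k.2⟩
        have := star_act_mul ψ (star z) ⟨star (h : B), hereditary_le ψ (star_mem h.2)⟩
          ⟨k, hereditary_le ψ k.2⟩
        rw [star_star, Submodule.coe_mk, star_star] at this
        exact this) }
  map_smul' c z := by
    refine ext_fst_snd ψ (leftAct_smul ψ c z) ?_
    refine ContinuousLinearMap.ext fun h => ?_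
    show star (leftAct ψ (star (c • z)) (star h)) = c • star (leftAct ψ (star z) (star h))
    rw [star_smul, leftAct_smul, smul_apply, star_smul, star_star]
  map_zero' := by
    refine ext_fst_snd ψ (leftAct_zero ψ) ?_
    refine ContinuousLinearMap.ext fun h => ?_
    show star (leftAct ψ (star (0 : R)) (star h)) = 0
    rw [star_zero, leftAct_zero, zero_apply, star_zero]
  map_add' z w := by
    refine ext_fst_snd ψ (leftAct_add ψ z w) ?_
    refine ContinuousLinearMap.ext fun h => ?_
    show star (leftAct ψ (star (z + w)) (star h)) =
      star (leftAct ψ (star z) (star h)) + star (leftAct ψ (star w) (star h))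
    rw [star_add, leftAct_add, add_apply, star_add]
  map_mul' z w := by
    refine ext_fst_snd ψ (leftAct_mul ψ z w) ?_
    refine ContinuousLinearMap.ext fun h => ?_
    show star (leftAct ψ (star (z * w)) (star h)) =
      star (leftAct ψ (star w) (star (star (leftAct ψ (star z) (star h)))))
    rw [star_mul, leftAct_mul, star_star]; rfl
  map_star' z := by
    refine ext_fst_snd ψ ?_ ?_
    · refine ContinuousLinearMap.ext fun h => ?_
      show leftAct ψ (star z) h = star (star (leftAct ψ (star z) (star (star h))))
      rw [star_star, star_star]
    · refine ContinuousLinearMap.ext fun h => ?_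
      show star (leftAct ψ (star (star z)) (star h)) = star (leftAct ψ z (star h))
      rw [star_star]

theorem eq_of_mul_left {C : Type u} [NonUnitalCStarAlgebra C] {x y : C}
    (h : ∀ w : C, w * x = w * y) : x = y := by
  have h1 : star (x - y) * (x - y) = 0 := by rw [mul_sub, h, sub_self]
  exact sub_eq_zero.mp ((CStarRing.star_mul_self_eq_zero_iff _).mp h1)

theorem eq_of_mul_right {C : Type u} [NonUnitalCStarAlgebra C] {x y : C}
    (h : ∀ w : C, x * w = y * w) : x = y := by
  have h1 : (x - y) * star (x - y) = 0 := by rw [sub_mul, h, sub_self]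
  exact sub_eq_zero.mp ((CStarRing.mul_star_self_eq_zero_iff _).mp h1)

/-- `ψ°` extends `ψ`: for `y ∈ I`, `ψ°(y)` acts on the hereditary subalgebra as left
multiplication by `ψ(y)`. -/
theorem canonicalExt_fst (y : I) (h : hereditary ψ) :
    (((canonicalExt ψ (y : R)).fst h : hereditary ψ) : B) = ψ y * h :=
  act_mem ψ y ⟨h, hereditary_le ψ h.2⟩

/-- A C*-algebra `C` as a closed ideal of its multiplier algebra. -/
def multiplierIdeal (C : Type u) [NonUnitalCStarAlgebra C] : ClosedIdeal 𝓜(ℂ, C) where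
  toNonUnitalStarSubalgebra :=
    NonUnitalStarAlgHom.range (DoubleCentralizer.coeHom : C →⋆ₙₐ[ℂ] 𝓜(ℂ, C))
  isClosed := by
    show IsClosed ((NonUnitalStarAlgHom.range
      (DoubleCentralizer.coeHom : C →⋆ₙₐ[ℂ] 𝓜(ℂ, C)) : NonUnitalStarSubalgebra ℂ 𝓜(ℂ, C)) :
        Set 𝓜(ℂ, C))
    rw [NonUnitalStarAlgHom.coe_range]
    refine (NonUnitalStarAlgHom.isometry _ ?_).isClosedEmbedding.isClosed_range
    rw [injective_iff_map_eq_zero]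
    intro c hc
    have h : (c : C) * star c = 0 :=
      DFunLike.congr_fun (congrArg (fun m : 𝓜(ℂ, C) => m.fst) hc) (star c)
    exact CStarRing.mul_star_self_eq_zero_iff c |>.mp h
  mul_mem_left e j hj := by
    obtain ⟨c, rfl⟩ := hj
    refine ⟨e.fst c, DoubleCentralizer.ext _ _ _ _ (Prod.ext ?_ ?_)⟩
    · refine ContinuousLinearMap.ext fun x => ?_
      show e.fst c * x = e.fst (c * x)
      refine eq_of_mul_left fun w => ?_
      rw [← mul_assoc, ← e.central, ← e.central, mul_assoc]
    · refine ContinuousLinearMap.ext fun x => ?_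
      exact (e.central x c).symm
  mul_mem_right e j hj := by
    obtain ⟨c, rfl⟩ := hj
    refine ⟨e.snd c, DoubleCentralizer.ext _ _ _ _ (Prod.ext ?_ ?_)⟩
    · refine ContinuousLinearMap.ext fun x => ?_
      exact e.central c x
    · refine ContinuousLinearMap.ext fun x => ?_
      show x * e.snd c = e.snd (x * c)
      refine eq_of_mul_right fun w => ?_
      rw [mul_assoc, e.central, e.central, mul_assoc]

end Extension
/-! ### Kasparov modules -/

section Kasparov

set_option linter.unusedSectionVars false

/-- The compact operators on a Hilbert `B`-module `E` (a `CStarModule` over `Bᵐᵒᵖ`, which acts on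
the right): the closed linear span of the operators `ζ ↦ ξ ⟨η, ζ⟩`. -/
def compactOperators (B E : Type u) [NonUnitalCStarAlgebra B] [PartialOrder B]
    [NormedAddCommGroup E] [NormedSpace ℂ E] [SMul Bᵐᵒᵖ E] [CStarModule Bᵐᵒᵖ E] :
    Submodule ℂ (E →L[ℂ] E) :=
  (Submodule.span ℂ {T : E →L[ℂ] E | ∃ ξ η : E, ∀ ζ, T ζ = inner Bᵐᵒᵖ η ζ • ξ}).topologicalClosure

/-- A Kasparov `A`-`B`-module for (trivially graded) C*-algebras `A` and `B`, on the Hilbert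
`B`-module `E`: a grading of `E`, an action of `A` on `E` by even adjointable operators and an odd
adjointable operator `F` such that `(F² - 1)a`, `(F - F*)a` and `[F, a]` are compact for all
`a ∈ A`. Right Hilbert `B`-modules are complete `CStarModule`s over `Bᵐᵒᵖ`. -/
structure KasparovModule (A B E : Type u) [NonUnitalCStarAlgebra A] [NonUnitalCStarAlgebra B]
    [PartialOrder B] [NormedAddCommGroup E] [NormedSpace ℂ E] [CompleteSpace E]
    [SMul Bᵐᵒᵖ E] [CStarModule Bᵐᵒᵖ E] where
  /-- The grading operator. -/
  grading : E →L[ℂ] E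
  grading_sq : grading * grading = 1
  inner_grading : ∀ ξ η, inner Bᵐᵒᵖ (grading ξ) η = inner Bᵐᵒᵖ ξ (grading η)
  /-- The action of `A`. -/
  action : A →ₙₐ[ℂ] (E →L[ℂ] E)
  inner_action : ∀ a ξ η, inner Bᵐᵒᵖ (action a ξ) η = inner Bᵐᵒᵖ ξ (action (star a) η)
  action_even : ∀ a, action a * grading = grading * action a
  F : E →L[ℂ] E
  /-- The adjoint of `F`. -/
  Fadj : E →L[ℂ] E
  inner_F : ∀ ξ η, inner Bᵐᵒᵖ (F ξ) η = inner Bᵐᵒᵖ ξ (Fadj η)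
  F_odd : F * grading = -(grading * F)
  compact_sq : ∀ a, (F * F - 1) * action a ∈ compactOperators B E
  compact_adj : ∀ a, (F - Fadj) * action a ∈ compactOperators B E
  compact_comm : ∀ a, F * action a - action a * F ∈ compactOperators B E

section Coefficients

variable {A B E : Type u} [NonUnitalCStarAlgebra A] [NonUnitalCStarAlgebra B]
  [PartialOrder B] [NormedAddCommGroup E] [NormedSpace ℂ E] [CompleteSpace E]
  [SMul Bᵐᵒᵖ E] [CStarModule Bᵐᵒᵖ E]

/-- The coefficient map `a ↦ ⟨ξ, a ξ⟩` from `A` to `B`. -/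
def KasparovModule.coefficient (M : KasparovModule A B E) (ξ : E) : A →ₗ[ℂ] B where
  toFun a := (inner Bᵐᵒᵖ ξ (M.action a ξ)).unop
  map_add' a b := by simp
  map_smul' c a := by simp

/-- A Kasparov module is nuclear in the sense of Skandalis if all the coefficient maps
`a ↦ ⟨ξ, a ξ⟩` are nuclear. -/
def KasparovModule.IsNuclear (M : KasparovModule A B E) : Prop :=
  ∀ ξ : E, QNuc.IsNuclear (M.coefficient ξ)

end Coefficients

variable {A B : Type u} [NonUnitalCStarAlgebra A] [NonUnitalCStarAlgebra B]
  [PartialOrder B] [StarOrderedRing B]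

section Module

variable {R : Type u} [NonUnitalCStarAlgebra R] {I : ClosedIdeal R} (ψ : I →⋆ₙₐ[ℂ] B)

instance : SMul Bᵐᵒᵖ (rightIdeal ψ) := ⟨fun b e => ⟨e * b.unop, mul_mem_rightIdeal ψ e.2 b.unop⟩⟩

/-- `ψ(I)B` as a Hilbert `B`-module with inner product `⟨e, f⟩ = e* f`. -/
instance : CStarModule Bᵐᵒᵖ (rightIdeal ψ) where
  inner e f := MulOpposite.op (star (e : B) * f)
  inner_add_right := by intro x y z; simp [mul_add]
  inner_self_nonneg := by
    intro x
    exact star_mul_self_nonneg (x : B)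
  inner_self := by
    intro x
    simp
  inner_op_smul_right := by
    intro b x y
    exact congrArg MulOpposite.op (mul_assoc (star (x : B)) y b.unop).symm
  inner_smul_right_complex := by
    intro c x y
    exact congrArg MulOpposite.op (mul_smul_comm c (star (x : B)) (y : B))
  star_inner x y := by
    rw [← MulOpposite.op_star]; simp
  norm_eq_sqrt_norm_inner_self x := by
    rw [MulOpposite.norm_op, CStarRing.norm_star_mul_self, Real.sqrt_mul_self (norm_nonneg _)]
    rfl

theorem inner_rightIdeal (e f : rightIdeal ψ) :
    inner Bᵐᵒᵖ e f = MulOpposite.op (star (e : B) * f) := rfl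

/-- The Hilbert module `ψ(I)B ⊕ ψ(I)B`. -/
abbrev DoubleModule : Type u := C⋆ᵐᵒᵈ(Bᵐᵒᵖ, rightIdeal ψ × rightIdeal ψ)

/-- `ψ(I)B ⊕ ψ(I)B` as a topological vector space. -/
abbrev doubleEquiv : DoubleModule ψ ≃L[ℂ] (rightIdeal ψ × rightIdeal ψ) :=
  WithCStarModule.equivL ℂ

/-- The operator `(e, f) ↦ (a e, d f)` on `ψ(I)B ⊕ ψ(I)B`. -/
def diagOp (a d : rightIdeal ψ →L[ℂ] rightIdeal ψ) : DoubleModule ψ →L[ℂ] DoubleModule ψ :=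
  (doubleEquiv ψ).symm.toContinuousLinearMap.comp
    (((a.comp (ContinuousLinearMap.fst ℂ _ _)).prod (d.comp (ContinuousLinearMap.snd ℂ _ _))).comp
      (doubleEquiv ψ).toContinuousLinearMap)

/-- The operator `(e, f) ↦ (b f, c e)` on `ψ(I)B ⊕ ψ(I)B`. -/
def offOp (b c : rightIdeal ψ →L[ℂ] rightIdeal ψ) : DoubleModule ψ →L[ℂ] DoubleModule ψ :=
  (doubleEquiv ψ).symm.toContinuousLinearMap.comp
    (((b.comp (ContinuousLinearMap.snd ℂ _ _)).prod (c.comp (ContinuousLinearMap.fst ℂ _ _))).comp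
      (doubleEquiv ψ).toContinuousLinearMap)

theorem diagOp_fst (a d : rightIdeal ψ →L[ℂ] rightIdeal ψ) (x : DoubleModule ψ) :
    (diagOp ψ a d x).1 = a x.1 := rfl

theorem diagOp_snd (a d : rightIdeal ψ →L[ℂ] rightIdeal ψ) (x : DoubleModule ψ) :
    (diagOp ψ a d x).2 = d x.2 := rfl

theorem offOp_fst (b c : rightIdeal ψ →L[ℂ] rightIdeal ψ) (x : DoubleModule ψ) :
    (offOp ψ b c x).1 = b x.2 := rfl

theorem offOp_snd (b c : rightIdeal ψ →L[ℂ] rightIdeal ψ) (x : DoubleModule ψ) :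
    (offOp ψ b c x).2 = c x.1 := rfl

theorem doubleOp_ext {S T : DoubleModule ψ →L[ℂ] DoubleModule ψ}
    (h : ∀ x, (S x).1 = (T x).1) (h' : ∀ x, (S x).2 = (T x).2) : S = T :=
  ContinuousLinearMap.ext fun x => Prod.ext (h x) (h' x)

theorem diagOp_mul (a d a' d' : rightIdeal ψ →L[ℂ] rightIdeal ψ) :
    diagOp ψ a d * diagOp ψ a' d' = diagOp ψ (a * a') (d * d') := rfl

theorem grading_sq : diagOp ψ 1 (-1) * diagOp ψ 1 (-1) = 1 :=
  doubleOp_ext ψ (fun _ => rfl) fun x => neg_neg x.2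

theorem grading_comm (a d : rightIdeal ψ →L[ℂ] rightIdeal ψ) :
    diagOp ψ a d * diagOp ψ 1 (-1) = diagOp ψ 1 (-1) * diagOp ψ a d :=
  doubleOp_ext ψ (fun _ => rfl) fun x => map_neg d x.2

theorem flip_odd : offOp ψ 1 1 * diagOp ψ 1 (-1) = -(diagOp ψ 1 (-1) * offOp ψ 1 1) :=
  doubleOp_ext ψ (fun _ => rfl) fun x => (neg_neg x.1).symm

theorem flip_sq : offOp ψ 1 1 * offOp ψ 1 1 = 1 :=
  doubleOp_ext ψ (fun _ => rfl) fun _ => rfl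

theorem flip_comm (a d : rightIdeal ψ →L[ℂ] rightIdeal ψ) :
    offOp ψ 1 1 * diagOp ψ a d - diagOp ψ a d * offOp ψ 1 1 =
      offOp ψ 0 (a - d) - offOp ψ (a - d) 0 := by
  refine doubleOp_ext ψ (fun x => ?_) fun x => ?_
  · show d x.2 - a x.2 = 0 - (a x.2 - d x.2)
    rw [zero_sub, neg_sub]
  · show a x.1 - d x.1 = (a x.1 - d x.1) - 0
    rw [sub_zero]

theorem inner_double (x y : DoubleModule ψ) :
    inner Bᵐᵒᵖ x y = MulOpposite.op (star (x.1 : B) * y.1 + star (x.2 : B) * y.2) := rfl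

theorem inner_diagOp {a d a' d' : rightIdeal ψ →L[ℂ] rightIdeal ψ}
    (ha : ∀ e f, star (a e : B) * f = star (e : B) * a' f)
    (hd : ∀ e f, star (d e : B) * f = star (e : B) * d' f) (x y : DoubleModule ψ) :
    inner Bᵐᵒᵖ (diagOp ψ a d x) y = inner Bᵐᵒᵖ x (diagOp ψ a' d' y) := by
  rw [inner_double, inner_double, diagOp_fst, diagOp_fst, diagOp_snd, diagOp_snd, ha, hd]

theorem inner_flip (x y : DoubleModule ψ) :
    inner Bᵐᵒᵖ (offOp ψ 1 1 x) y = inner Bᵐᵒᵖ x (offOp ψ 1 1 y) :=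
  congrArg MulOpposite.op (add_comm (star (x.2 : B) * y.1) (star (x.1 : B) * y.2))

theorem hom_mem_rightIdeal (y : I) : ψ y ∈ rightIdeal ψ := by
  obtain ⟨l, hl, -, -, h⟩ := exists_approxUnit I
  refine (isClosed_rightIdeal ψ).mem_of_tendsto (((hom_continuous ψ).tendsto y).comp (h y))
    (Filter.Eventually.of_forall fun u => ?_)
  show ψ (y * u) ∈ rightIdeal ψ
  rw [map_mul]
  exact gen_mem ψ y _

theorem tendsto_actHom {l : Filter I} {y : I} (h : Filter.Tendsto (fun u => y * u) l (𝓝 y)) :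
    Filter.Tendsto (fun u : I => actHom ψ ((y * u : I) : R)) l (𝓝 (actHom ψ (y : R))) := by
  have hc : Continuous (actHom ψ) :=
    AddMonoidHomClass.continuous_of_bound (actHom ψ) 1 fun z => by
      simpa using norm_actHom_le ψ z
  exact (hc.tendsto _).comp ((continuous_subtype_val.tendsto y).comp h)

theorem continuous_offOp_right : Continuous fun T => offOp ψ 0 T := by
  have : (fun T => offOp ψ 0 T) = fun T : rightIdeal ψ →L[ℂ] rightIdeal ψ =>
      ((doubleEquiv ψ).symm.toContinuousLinearMap.comp (ContinuousLinearMap.inr ℂ _ _)).comp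
        (T.comp ((ContinuousLinearMap.fst ℂ _ _).comp (doubleEquiv ψ).toContinuousLinearMap)) :=
    rfl
  rw [this]
  exact continuous_const.clm_comp (continuous_id.clm_comp continuous_const)

theorem continuous_offOp_left : Continuous fun T => offOp ψ T 0 := by
  have : (fun T => offOp ψ T 0) = fun T : rightIdeal ψ →L[ℂ] rightIdeal ψ =>
      ((doubleEquiv ψ).symm.toContinuousLinearMap.comp (ContinuousLinearMap.inl ℂ _ _)).comp
        (T.comp ((ContinuousLinearMap.snd ℂ _ _).comp (doubleEquiv ψ).toContinuousLinearMap)) :=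
    rfl
  rw [this]
  exact continuous_const.clm_comp (continuous_id.clm_comp continuous_const)

theorem actHom_mul_apply (y u : I) (e : rightIdeal ψ) :
    (actHom ψ ((y * u : I) : R) e : B) = ψ y * (ψ u * e) := by
  rw [actHom_apply, act_mem, map_mul, mul_assoc]

/-- The element `(e, f)` of `ψ(I)B ⊕ ψ(I)B`. -/
def pair (e f : rightIdeal ψ) : DoubleModule ψ := (doubleEquiv ψ).symm (e, f)

theorem compact_right (y : I) :
    offOp ψ 0 (actHom ψ (y : R)) ∈ compactOperators B (DoubleModule ψ) := by
  obtain ⟨l, hl, -, -, h⟩ := exists_approxUnit I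
  refine mem_closure_of_tendsto
    (((continuous_offOp_right ψ).tendsto _).comp (tendsto_actHom ψ (h y)))
    (Filter.Eventually.of_forall fun u => Submodule.subset_span ?_)
  refine ⟨pair ψ 0 ⟨ψ y, hom_mem_rightIdeal ψ y⟩,
    pair ψ ⟨ψ (star u), hom_mem_rightIdeal ψ _⟩ 0, fun ζ => ?_⟩
  refine Prod.ext (Subtype.ext ?_) (Subtype.ext ?_)
  · exact (zero_mul _).symm
  · show (actHom ψ ((y * u : I) : R) ζ.1 : B) =
      ψ y * (star (ψ (star u)) * ζ.1 + star (0 : B) * ζ.2)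
    rw [actHom_mul_apply, map_star, star_star, star_zero, zero_mul, add_zero]

theorem compact_left (y : I) :
    offOp ψ (actHom ψ (y : R)) 0 ∈ compactOperators B (DoubleModule ψ) := by
  obtain ⟨l, hl, -, -, h⟩ := exists_approxUnit I
  refine mem_closure_of_tendsto
    (((continuous_offOp_left ψ).tendsto _).comp (tendsto_actHom ψ (h y)))
    (Filter.Eventually.of_forall fun u => Submodule.subset_span ?_)
  refine ⟨pair ψ ⟨ψ y, hom_mem_rightIdeal ψ y⟩ 0,
    pair ψ 0 ⟨ψ (star u), hom_mem_rightIdeal ψ _⟩, fun ζ => ?_⟩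
  refine Prod.ext (Subtype.ext ?_) (Subtype.ext ?_)
  · show (actHom ψ ((y * u : I) : R) ζ.2 : B) =
      ψ y * (star (0 : B) * ζ.1 + star (ψ (star u)) * ζ.2)
    rw [actHom_mul_apply, map_star, star_star, star_zero, zero_mul, zero_add]
  · exact (zero_mul _).symm

/-- The action `ψ° i ⊕ ψ° j` of `A` on `ψ(I)B ⊕ ψ(I)B` given by homomorphisms `i, j : A → R`. -/
def doubleAction (i j : A →⋆ₙₐ[ℂ] R) : A →ₙₐ[ℂ] (DoubleModule ψ →L[ℂ] DoubleModule ψ) where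
  toFun a := diagOp ψ (actHom ψ (i a)) (actHom ψ (j a))
  map_smul' c a := by rw [map_smul, map_smul, map_smul, map_smul]; rfl
  map_zero' := by rw [map_zero, map_zero, map_zero, map_zero]; rfl
  map_add' a b := by rw [map_add, map_add, map_add, map_add]; rfl
  map_mul' a b := by rw [map_mul, map_mul, map_mul, map_mul]; rfl

theorem inner_doubleAction (i j : A →⋆ₙₐ[ℂ] R) (a : A) (x y : DoubleModule ψ) :
    inner Bᵐᵒᵖ (doubleAction ψ i j a x) y = inner Bᵐᵒᵖ x (doubleAction ψ i j (star a) y) :=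
  inner_diagOp ψ
    (fun e f => by rw [map_star i]; exact star_act_mul ψ (i a) e f)
    (fun e f => by rw [map_star j]; exact star_act_mul ψ (j a) e f) x y

theorem compact_flip_comm (i j : A →⋆ₙₐ[ℂ] R) (a : A)
    (h : i a - j a ∈ I.toNonUnitalStarSubalgebra) :
    offOp ψ 1 1 * doubleAction ψ i j a - doubleAction ψ i j a * offOp ψ 1 1 ∈
      compactOperators B (DoubleModule ψ) := by
  have h1 : offOp ψ 1 1 * doubleAction ψ i j a - doubleAction ψ i j a * offOp ψ 1 1 =
      offOp ψ 0 (actHom ψ (i a) - actHom ψ (j a)) - offOp ψ (actHom ψ (i a) - actHom ψ (j a)) 0 :=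
    flip_comm ψ (actHom ψ (i a)) (actHom ψ (j a))
  rw [h1, ← map_sub]
  exact sub_mem (compact_right ψ ⟨_, h⟩) (compact_left ψ ⟨_, h⟩)

/-- The Kasparov module `ψ(I)B ⊕ (ψ(I)B)ᵒᵖ` with the action of `A` given by two homomorphisms
`i, j : A → R` that agree modulo `I`, and the flip operator `F`. -/
def kasparovOf (i j : A →⋆ₙₐ[ℂ] R) (h : ∀ a, i a - j a ∈ I.toNonUnitalStarSubalgebra) :
    KasparovModule A B (DoubleModule ψ) where
  grading := diagOp ψ 1 (-1)
  grading_sq := grading_sq ψ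
  inner_grading := inner_diagOp ψ (fun _ _ => rfl) fun e f => by
    show star (-(e : B)) * f = star (e : B) * -(f : B)
    rw [star_neg, neg_mul, mul_neg]
  action := doubleAction ψ i j
  inner_action := inner_doubleAction ψ i j
  action_even a := grading_comm ψ _ _
  F := offOp ψ 1 1
  Fadj := offOp ψ 1 1
  inner_F := inner_flip ψ
  F_odd := flip_odd ψ
  compact_sq a := by
    rw [flip_sq, sub_self, zero_mul]
    exact zero_mem _
  compact_adj a := by
    rw [sub_self, zero_mul]
    exact zero_mem _
  compact_comm a := compact_flip_comm ψ i j a (h a)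

end Module

/-- The Kasparov module `(ψ°ι ⊕ ψ°ῑ : A → 𝓑(E ⊕ Eᵒᵖ), F)` of a homomorphism `ψ : qA → B`, where
`E = ψ(qA)B` and `F` exchanges the two summands. -/
def kasparovModule (ψ : qIdeal A →⋆ₙₐ[ℂ] B) : KasparovModule A B (DoubleModule ψ) :=
  kasparovOf ψ iota iotaBar fun a => (q a).2

end Kasparov
end QNuc

end

noncomputable section

namespace QNuc

/-! ### The minimal and maximal norms on algebraic tensor products -/

section NormLemmas

variable {A B D : Type u} [NonUnitalCStarAlgebra A] [NonUnitalCStarAlgebra B]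
  [NonUnitalCStarAlgebra D]

section Rep

variable {H K : Type u} [NormedAddCommGroup H] [InnerProductSpace ℂ H] [CompleteSpace H]
  [NormedAddCommGroup K] [InnerProductSpace ℂ K] [CompleteSpace K]

/-! Everything is compared with (ii). For `y` in `qA` and `i = ι` or `ῑ`, write `L_y(x) = ψ(i(x)y)`.
These maps satisfy `L_y(x)* L_y(x') = ψ(y)* L_y(x* x')`, and this relation drives the proof. Applied
on tensor products, together with the C*-identity in a commuting pair of representations, it shows
that `L_y` is nuclear as soon as `x ↦ ψ(y)* L_y(x)` is, with the square root of the bound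
(`NuclearBound.of_star_mul`). Iterating, a nuclear `L_y` automatically has nuclear norm at most
`‖ψ(y)‖` (`IsNuclear.nuclearBound_of_star_mul`). Hence the `y` with `L_y` nuclear form a closed set
(`isClosed_isNuclear`), and it is enough to check generators.

From (i) to (ii): the identities `ι(x)q(a) = q(xa) - q(x)ῑ(a)` and `ῑ(x)q(a) = q(xa) - q(x)ι(a)`
show that `L_y` is nuclear for `y = q(a)w`. Modulo the closed subspace of good elements, every `z ∈
QA` acts on `qA` like `ι` of its image in `A`, and for `z ∈ qA` that image is zero; an approximate
unit then gives all of `qA` (`mem_of_q_mul_mem`). From (ii) to (i): `q(x)u = ι(x)u - ῑ(x)u` for `u`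
in an approximate unit, with bounds uniform in `u`.

From (ii) to (iv) the target shrinks from `B` to the hereditary subalgebra `H`. For a generator `g =
ψ(y)bψ(y')` of `H`, the square root trick reduces nuclearity of `a ↦ i(a)g` to that of `a ↦ g* i(a)
g`, which is a nuclear map to `B` compressed by `k = ψ(y')`. Compression `b ↦ k* b k` is completely
positive from `B` to `H`, so a Stinespring dilation turns a commuting pair of representations of `H`
and `D` into one of `B` and `D` (`PositiveType.exists_dilation`, `NuclearBound.compress`).

Then (iv) gives (iii) by the canonical prequasihomomorphism into `M(H)`, and (iii) gives (ii) by
composing with the homomorphism `μ`. In (v) the coefficients are sums of maps `a ↦ e* (i(a) · e)`;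
they are nuclear under (ii) by density, and conversely the vector with the single entry `ψ(y)`
yields `ψ(y)* L_y`, so the square root trick applies again. -/

theorem tensorRep_tmul (π : A →⋆ₙₐ[ℂ] (H →L[ℂ] H)) (σ : D →⋆ₙₐ[ℂ] (K →L[ℂ] K)) (a : A) (d : D) :
    tensorRep π σ (a ⊗ₜ[ℂ] d) = TensorProduct.map (π a : H →ₗ[ℂ] H) (σ d : K →ₗ[ℂ] K) := rfl

theorem tensorRep_mul (π : A →⋆ₙₐ[ℂ] (H →L[ℂ] H)) (σ : D →⋆ₙₐ[ℂ] (K →L[ℂ] K)) (x y : A ⊗[ℂ] D)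
    (ζ : H ⊗[ℂ] K) : tensorRep π σ (x * y) ζ = tensorRep π σ x (tensorRep π σ y ζ) := by
  induction x with
  | zero => simp
  | add x x' hx hx' => simp [add_mul, hx, hx']
  | tmul a d =>
    induction y with
    | zero => simp
    | add y y' hy hy' => simp [mul_add, hy, hy']
    | tmul b e =>
      rw [Algebra.TensorProduct.tmul_mul_tmul, tensorRep_tmul, tensorRep_tmul, tensorRep_tmul,
        map_mul, map_mul, ← LinearMap.comp_apply, ← TensorProduct.map_comp]
      rfl

theorem inner_tensorRep (π : A →⋆ₙₐ[ℂ] (H →L[ℂ] H)) (σ : D →⋆ₙₐ[ℂ] (K →L[ℂ] K)) (x : A ⊗[ℂ] D)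
    (ζ η : H ⊗[ℂ] K) :
    inner ℂ (tensorRep π σ x ζ) η = inner ℂ ζ (tensorRep π σ (star x) η) := by
  induction x with
  | zero => simp
  | add x x' hx hx' => simp [inner_add_left, inner_add_right, hx, hx']
  | tmul a d =>
    rw [TensorProduct.star_tmul, tensorRep_tmul, tensorRep_tmul]
    induction ζ with
    | zero => simp
    | add x x' hx hx' => simp [inner_add_left, hx, hx']
    | tmul h k =>
      induction η with
      | zero => simp
      | add y y' hy hy' => rw [inner_add_right, map_add, inner_add_right, hy, hy']
      | tmul h' k' =>
        simp [map_star, ContinuousLinearMap.star_eq_adjoint,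
          ContinuousLinearMap.adjoint_inner_right]

theorem norm_tensorRep_tmul_le (π : A →⋆ₙₐ[ℂ] (H →L[ℂ] H)) (σ : D →⋆ₙₐ[ℂ] (K →L[ℂ] K)) (a : A)
    (d : D) (ζ : H ⊗[ℂ] K) : ‖tensorRep π σ (a ⊗ₜ[ℂ] d) ζ‖ ≤ ‖a‖ * ‖d‖ * ‖ζ‖ := by
  have h : tensorRep π σ (a ⊗ₜ[ℂ] d) ζ = (π a).rTensor K ((σ d).lTensor H ζ) := by
    rw [tensorRep_tmul, ContinuousLinearMap.rTensor_apply, ContinuousLinearMap.lTensor_apply,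
      ← LinearMap.comp_apply, LinearMap.rTensor_comp_lTensor]
  rw [h]
  calc _ ≤ ‖(π a).rTensor K‖ * (‖(σ d).lTensor H‖ * ‖ζ‖) :=
        (ContinuousLinearMap.le_opNorm _ _).trans (by
          gcongr; exact ContinuousLinearMap.le_opNorm _ _)
    _ ≤ ‖a‖ * (‖d‖ * ‖ζ‖) := by
      gcongr
      · exact (ContinuousLinearMap.norm_rTensor_le K _).trans (NonUnitalStarAlgHom.norm_apply_le π a)
      · exact (ContinuousLinearMap.norm_lTensor_le H _).trans (NonUnitalStarAlgHom.norm_apply_le σ d)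
    _ = _ := by ring

/-- Rescaling to the unit ball turns the supremum that defines `minNorm` into an operator bound. The
vectors stay in the algebraic tensor product, so no completion is needed. -/
theorem enorm_tensorRep_le (π : A →⋆ₙₐ[ℂ] (H →L[ℂ] H)) (σ : D →⋆ₙₐ[ℂ] (K →L[ℂ] K)) (x : A ⊗[ℂ] D)
    (ζ : H ⊗[ℂ] K) : ‖tensorRep π σ x ζ‖ₑ ≤ minNorm x * ‖ζ‖ₑ := by
  by_cases hζ : ζ = 0
  · rw [hζ, map_zero]
    rw [← ofReal_norm, norm_zero (E := H ⊗[ℂ] K), ENNReal.ofReal_zero]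
    exact zero_le
  have h0 : ‖ζ‖ ≠ 0 := norm_ne_zero_iff.mpr hζ
  set ζ' : H ⊗[ℂ] K := ((‖ζ‖⁻¹ : ℝ) : ℂ) • ζ with hζ'
  have h1 : ‖ζ'‖ ≤ 1 := by
    rw [hζ', norm_smul, Complex.norm_real, norm_inv, norm_norm, inv_mul_cancel₀ h0]
  have h2 : ζ = ((‖ζ‖ : ℝ) : ℂ) • ζ' := by
    rw [hζ', smul_smul, ← Complex.ofReal_mul, mul_inv_cancel₀ h0, Complex.ofReal_one, one_smul]
  have h3 : ‖tensorRep π σ x ζ'‖ₑ ≤ minNorm x := by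
    unfold minNorm
    refine le_iSup_of_le H <| le_iSup_of_le _ <| le_iSup_of_le _ <| le_iSup_of_le ‹_› <|
      le_iSup_of_le K <| le_iSup_of_le _ <| le_iSup_of_le _ <| le_iSup_of_le ‹_› <|
      le_iSup_of_le π <| le_iSup_of_le σ <| le_iSup_of_le ζ' <| le_iSup_of_le h1 le_rfl
  calc ‖tensorRep π σ x ζ‖ₑ = ‖ζ‖ₑ * ‖tensorRep π σ x ζ'‖ₑ := by
        conv_lhs => rw [h2, map_smul, enorm_smul]
        congr 1
        rw [← ofReal_norm, ← ofReal_norm, Complex.norm_real, norm_norm]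
    _ ≤ ‖ζ‖ₑ * minNorm x := by gcongr
    _ = _ := mul_comm _ _

theorem productRep_tmul (π : B →⋆ₙₐ[ℂ] (H →L[ℂ] H)) (σ : D →⋆ₙₐ[ℂ] (H →L[ℂ] H)) (b : B) (d : D) :
    productRep π σ (b ⊗ₜ[ℂ] d) = π b * σ d := rfl

theorem enorm_productRep_le (π : B →⋆ₙₐ[ℂ] (H →L[ℂ] H)) (σ : D →⋆ₙₐ[ℂ] (H →L[ℂ] H))
    (h : ∀ b d, Commute (π b) (σ d)) (x : B ⊗[ℂ] D) : ‖productRep π σ x‖ₑ ≤ maxNorm x := by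
  unfold maxNorm
  exact le_iSup_of_le H <| le_iSup_of_le _ <| le_iSup_of_le _ <| le_iSup_of_le ‹_› <|
    le_iSup_of_le π <| le_iSup_of_le σ <| le_iSup_of_le h le_rfl

end Rep

theorem minNorm_le_of {x : A ⊗[ℂ] D} {c : ℝ≥0∞}
    (h : ∀ (H : Type u) [NormedAddCommGroup H] [InnerProductSpace ℂ H] [CompleteSpace H]
      (K : Type u) [NormedAddCommGroup K] [InnerProductSpace ℂ K] [CompleteSpace K]
      (π : A →⋆ₙₐ[ℂ] (H →L[ℂ] H)) (σ : D →⋆ₙₐ[ℂ] (K →L[ℂ] K)) (ζ : H ⊗[ℂ] K),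
      ‖tensorRep π σ x ζ‖ₑ ≤ c * ‖ζ‖ₑ) : minNorm x ≤ c := by
  unfold minNorm
  refine iSup_le fun H => iSup_le fun _ => iSup_le fun _ => iSup_le fun _ => iSup_le fun K =>
    iSup_le fun _ => iSup_le fun _ => iSup_le fun _ => iSup_le fun π => iSup_le fun σ =>
    iSup_le fun ζ => iSup_le fun hζ => (h H K π σ ζ).trans ?_
  have : ‖ζ‖ₑ ≤ 1 := by rw [← ofReal_norm]; exact ENNReal.ofReal_le_one.mpr hζ
  calc _ ≤ c * 1 := by gcongr
    _ = c := mul_one c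

theorem maxNorm_le_of {x : B ⊗[ℂ] D} {c : ℝ≥0∞}
    (h : ∀ (H : Type u) [NormedAddCommGroup H] [InnerProductSpace ℂ H] [CompleteSpace H]
      (π : B →⋆ₙₐ[ℂ] (H →L[ℂ] H)) (σ : D →⋆ₙₐ[ℂ] (H →L[ℂ] H)),
      (∀ b d, Commute (π b) (σ d)) → ‖productRep π σ x‖ₑ ≤ c) : maxNorm x ≤ c := by
  unfold maxNorm
  exact iSup_le fun H => iSup_le fun _ => iSup_le fun _ => iSup_le fun _ => iSup_le fun π =>
    iSup_le fun σ => iSup_le fun hc => h H π σ hc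

theorem minNorm_add_le (x y : A ⊗[ℂ] D) : minNorm (x + y) ≤ minNorm x + minNorm y :=
  minNorm_le_of fun H _ _ _ K _ _ _ π σ ζ => by
    rw [map_add, LinearMap.add_apply, add_mul]
    exact (enorm_add_le _ _).trans
      (add_le_add (enorm_tensorRep_le π σ x ζ) (enorm_tensorRep_le π σ y ζ))

theorem minNorm_lt_top (x : A ⊗[ℂ] D) : minNorm x < ⊤ := by
  induction x with
  | zero => exact (minNorm_le_of (c := 0) fun H _ _ _ K _ _ _ π σ ζ => by simp).trans_lt (by simp)
  | add x y hx hy => exact (minNorm_add_le x y).trans_lt (ENNReal.add_lt_top.mpr ⟨hx, hy⟩)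
  | tmul a d =>
    refine (minNorm_le_of (c := ENNReal.ofReal (‖a‖ * ‖d‖)) fun H _ _ _ K _ _ _ π σ ζ => ?_).trans_lt
      ENNReal.ofReal_lt_top
    rw [← ofReal_norm, ← ofReal_norm, ← ENNReal.ofReal_mul (by positivity)]
    exact ENNReal.ofReal_le_ofReal (norm_tensorRep_tmul_le π σ a d ζ)

/-- With `minNorm_star_le` this gives `minNorm (star x * x) ≤ minNorm x ^ 2`, which is all that the
square root trick needs to know about the minimal norm. -/
theorem minNorm_mul_le (x y : A ⊗[ℂ] D) : minNorm (x * y) ≤ minNorm x * minNorm y :=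
  minNorm_le_of fun H _ _ _ K _ _ _ π σ ζ => by
    rw [tensorRep_mul]
    calc _ ≤ minNorm x * ‖tensorRep π σ y ζ‖ₑ := enorm_tensorRep_le π σ x _
      _ ≤ minNorm x * (minNorm y * ‖ζ‖ₑ) := by gcongr; exact enorm_tensorRep_le π σ y ζ
      _ = _ := (mul_assoc _ _ _).symm

/-- On the pre-Hilbert space `H ⊗ K` the operators only have formal adjoints, so the bound comes
from Cauchy–Schwarz: for `ω = x* ζ`, `‖ω‖² = ⟨ζ, xω⟩`, and one factor `‖ω‖` cancels. -/
theorem minNorm_star_le (x : A ⊗[ℂ] D) : minNorm (star x) ≤ minNorm x :=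
  minNorm_le_of fun H _ _ _ K _ _ _ π σ ζ => by
    set ω := tensorRep π σ (star x) ζ with hω
    by_cases h0 : ω = 0
    · rw [h0, ← ofReal_norm, norm_zero (E := H ⊗[ℂ] K), ENNReal.ofReal_zero]
      exact zero_le
    have h1 : ‖ω‖ * ‖ω‖ ≤ ‖tensorRep π σ x ω‖ * ‖ζ‖ := by
      rw [← inner_self_eq_norm_mul_norm (𝕜 := ℂ)]
      conv_lhs => rw [hω]
      rw [inner_tensorRep, star_star, ← hω, mul_comm]
      exact (RCLike.re_le_norm _).trans (norm_inner_le_norm (E := H ⊗[ℂ] K) ζ (tensorRep π σ x ω))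
    have h2 : ‖ω‖ₑ * ‖ω‖ₑ ≤ ‖tensorRep π σ x ω‖ₑ * ‖ζ‖ₑ := by
      simp only [← ofReal_norm]
      rw [← ENNReal.ofReal_mul (norm_nonneg _), ← ENNReal.ofReal_mul (norm_nonneg _)]
      exact ENNReal.ofReal_le_ofReal h1
    have h3 : ‖ω‖ₑ * ‖ω‖ₑ ≤ ‖ω‖ₑ * (minNorm x * ‖ζ‖ₑ) := by
      refine h2.trans ?_
      calc _ ≤ minNorm x * ‖ω‖ₑ * ‖ζ‖ₑ := by gcongr; exact enorm_tensorRep_le π σ x ω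
        _ = _ := by ring
    exact (ENNReal.mul_le_mul_iff_right (enorm_ne_zero.mpr h0) enorm_ne_top).mp h3

end NormLemmas

/-! ### Calculus of nuclear bounds and the square root trick -/

section NuclearCalculus

variable {A B C D : Type u} [NonUnitalCStarAlgebra A] [NonUnitalCStarAlgebra B]
  [NonUnitalCStarAlgebra C]

theorem isNuclear_iff {ρ : A →ₗ[ℂ] B} : IsNuclear ρ ↔ ∃ K, NuclearBound ρ K := by
  unfold IsNuclear nuclearNorm
  simp only [iInf_lt_iff]
  exact ⟨fun ⟨K, h, _⟩ => ⟨K, h⟩, fun ⟨K, h⟩ => ⟨K, h, ENNReal.coe_lt_top⟩⟩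

/-- A bound for `ρ ⊗ id` may be checked in each pair of commuting representations. -/
theorem nuclearBound_of {ρ : A →ₗ[ℂ] B} {K : ℝ≥0}
    (h : ∀ (D : Type u) [NonUnitalCStarAlgebra D] (x : A ⊗[ℂ] D)
      (H : Type u) [NormedAddCommGroup H] [InnerProductSpace ℂ H] [CompleteSpace H]
      (π : B →⋆ₙₐ[ℂ] (H →L[ℂ] H)) (σ : D →⋆ₙₐ[ℂ] (H →L[ℂ] H)), (∀ b d, Commute (π b) (σ d)) →
      ‖productRep π σ (ρ.rTensor D x)‖ₑ ≤ K * minNorm x) : NuclearBound ρ K :=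
  fun D _ x => maxNorm_le_of fun H _ _ _ π σ hc => h D x H π σ hc

theorem NuclearBound.enorm_le {ρ : A →ₗ[ℂ] B} {K : ℝ≥0} (h : NuclearBound ρ K)
    [NonUnitalCStarAlgebra D] {H : Type u} [NormedAddCommGroup H] [InnerProductSpace ℂ H]
    [CompleteSpace H] {π : B →⋆ₙₐ[ℂ] (H →L[ℂ] H)} {σ : D →⋆ₙₐ[ℂ] (H →L[ℂ] H)}
    (hc : ∀ b d, Commute (π b) (σ d)) (x : A ⊗[ℂ] D) :
    ‖productRep π σ (ρ.rTensor D x)‖ₑ ≤ K * minNorm x :=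
  (enorm_productRep_le π σ hc _).trans (h D x)

theorem NuclearBound.mono {ρ : A →ₗ[ℂ] B} {K K' : ℝ≥0} (h : NuclearBound ρ K) (hK : K ≤ K') :
    NuclearBound ρ K' := fun D _ x => (h D x).trans (by gcongr)

theorem NuclearBound.add {ρ ρ' : A →ₗ[ℂ] B} {K K' : ℝ≥0} (h : NuclearBound ρ K)
    (h' : NuclearBound ρ' K') : NuclearBound (ρ + ρ') (K + K') :=
  nuclearBound_of fun D _ x H _ _ _ π σ hc => by
    rw [LinearMap.rTensor_add, LinearMap.add_apply, map_add, ENNReal.coe_add, add_mul]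
    exact (enorm_add_le _ _).trans (add_le_add (h.enorm_le hc x) (h'.enorm_le hc x))

theorem NuclearBound.smul {ρ : A →ₗ[ℂ] B} {K : ℝ≥0} (h : NuclearBound ρ K) (c : ℂ) :
    NuclearBound (c • ρ) (‖c‖₊ * K) :=
  nuclearBound_of fun D _ x H _ _ _ π σ hc => by
    rw [LinearMap.rTensor_smul, LinearMap.smul_apply, map_smul, enorm_smul, ENNReal.coe_mul,
      mul_assoc]
    exact mul_le_mul_right (h.enorm_le hc x) _

theorem NuclearBound.sub {ρ ρ' : A →ₗ[ℂ] B} {K K' : ℝ≥0} (h : NuclearBound ρ K)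
    (h' : NuclearBound ρ' K') : NuclearBound (ρ - ρ') (K + K') := by
  have := h.add (h'.smul (-1))
  rwa [neg_one_smul, ← sub_eq_add_neg, nnnorm_neg, nnnorm_one, one_mul] at this

/-- A commuting pair of representations of `C` and `D` pulls back along `f` to one of `B` and `D`.
-/
theorem NuclearBound.hom_comp {ρ : A →ₗ[ℂ] B} {K : ℝ≥0} (h : NuclearBound ρ K)
    (f : B →⋆ₙₐ[ℂ] C) : NuclearBound (toLin f ∘ₗ ρ) K :=
  nuclearBound_of fun D _ x H _ _ _ π σ hc => by
    have h1 : productRep π σ ((toLin f ∘ₗ ρ).rTensor D x) =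
        productRep (π.comp f) σ (ρ.rTensor D x) := by
      induction x with
      | zero => simp
      | add x y hx hy => simp only [map_add, hx, hy]
      | tmul a d => rfl
    rw [h1]
    exact h.enorm_le (fun b d => hc (f b) d) x

theorem enorm_clm_mul_le {H : Type u} [NormedAddCommGroup H] [InnerProductSpace ℂ H]
    (S T : H →L[ℂ] H) : ‖S * T‖ₑ ≤ ‖S‖ₑ * ‖T‖ₑ := by
  rw [← ofReal_norm, ← ofReal_norm, ← ofReal_norm, ← ENNReal.ofReal_mul (norm_nonneg _)]
  exact ENNReal.ofReal_le_ofReal (norm_mul_le S T)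

theorem enorm_hom_le {H : Type u} [NormedAddCommGroup H] [InnerProductSpace ℂ H] [CompleteSpace H]
    (π : B →⋆ₙₐ[ℂ] (H →L[ℂ] H)) (b : B) : ‖π b‖ₑ ≤ ‖b‖₊ :=
  ENNReal.coe_le_coe.mpr (NonUnitalStarAlgHom.nnnorm_apply_le π b)

theorem NuclearBound.mul_left {ρ ρ' : A →ₗ[ℂ] B} {K : ℝ≥0} (h : NuclearBound ρ K) (b : B)
    (hb : ∀ x, ρ' x = b * ρ x) : NuclearBound ρ' (‖b‖₊ * K) :=
  nuclearBound_of fun D _ x H _ _ _ π σ hc => by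
    have h1 : productRep π σ (ρ'.rTensor D x) = π b * productRep π σ (ρ.rTensor D x) := by
      induction x with
      | zero => simp
      | add x y hx hy => simp only [map_add, hx, hy, mul_add]
      | tmul a d => simp [productRep_tmul, hb, mul_assoc]
    rw [h1, ENNReal.coe_mul, mul_assoc]
    calc _ ≤ ‖π b‖ₑ * ‖productRep π σ (ρ.rTensor D x)‖ₑ := enorm_clm_mul_le _ _
      _ ≤ _ := mul_le_mul' (enorm_hom_le π b) (h.enorm_le hc x)

theorem NuclearBound.mul_right {ρ ρ' : A →ₗ[ℂ] B} {K : ℝ≥0} (h : NuclearBound ρ K) (b : B)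
    (hb : ∀ x, ρ' x = ρ x * b) : NuclearBound ρ' (‖b‖₊ * K) :=
  nuclearBound_of fun D _ x H _ _ _ π σ hc => by
    have h1 : productRep π σ (ρ'.rTensor D x) = productRep π σ (ρ.rTensor D x) * π b := by
      induction x with
      | zero => simp
      | add x y hx hy => simp only [map_add, hx, hy, add_mul]
      | tmul a d => simp [productRep_tmul, hb, mul_assoc, (hc b d).eq]
    rw [h1, ENNReal.coe_mul, mul_assoc, mul_comm]
    calc _ ≤ ‖productRep π σ (ρ.rTensor D x)‖ₑ * ‖π b‖ₑ := enorm_clm_mul_le _ _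
      _ ≤ _ := mul_le_mul' (h.enorm_le hc x) (enorm_hom_le π b)

/-- There need be no element `a ⊗ 1` in `A ⊗ D`, so submultiplicativity does not apply; but the
operator `π(a) ⊗ 1` exists in each representation and has norm at most `‖a‖`. -/
theorem minNorm_rTensor_mulRight_le [NonUnitalCStarAlgebra D] (a : A) (x : A ⊗[ℂ] D) :
    minNorm ((LinearMap.mulRight ℂ a).rTensor D x) ≤ ‖a‖₊ * minNorm x :=
  minNorm_le_of fun H _ _ _ K _ _ _ π σ ζ => by
    have h1 : tensorRep π σ ((LinearMap.mulRight ℂ a).rTensor D x) ζ =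
        tensorRep π σ x ((π a).rTensor K ζ) := by
      induction x with
      | zero => simp
      | add x y hx hy => simp only [map_add, LinearMap.add_apply, hx, hy]
      | tmul b d =>
        rw [LinearMap.rTensor_tmul, tensorRep_tmul, tensorRep_tmul,
          ContinuousLinearMap.rTensor_apply, ← LinearMap.comp_apply, LinearMap.map_comp_rTensor,
          LinearMap.mulRight_apply, map_mul]
        rfl
    rw [h1]
    calc _ ≤ minNorm x * ‖(π a).rTensor K ζ‖ₑ := enorm_tensorRep_le π σ x _
      _ ≤ minNorm x * (‖a‖₊ * ‖ζ‖ₑ) := by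
        gcongr
        refine (ContinuousLinearMap.le_opENorm _ _).trans ?_
        gcongr
        refine ENNReal.coe_le_coe.mpr (?_ : ‖_‖ ≤ ‖_‖)
        exact (ContinuousLinearMap.norm_rTensor_le K _).trans (NonUnitalStarAlgHom.norm_apply_le π a)
      _ = _ := by ring

theorem NuclearBound.comp_mulRight {ρ : A →ₗ[ℂ] B} {K : ℝ≥0} (h : NuclearBound ρ K) (a : A) :
    NuclearBound (ρ ∘ₗ LinearMap.mulRight ℂ a) (K * ‖a‖₊) := fun D _ x => by
  rw [LinearMap.rTensor_comp, LinearMap.comp_apply, ENNReal.coe_mul, mul_assoc]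
  exact (h D _).trans (by gcongr; exact minNorm_rTensor_mulRight_le a x)

/-- A pointwise limit of maps with a common nuclear bound has the same bound. -/
theorem NuclearBound.of_tendsto {ι : Type*} {l : Filter ι} [l.NeBot] {ρ : ι → A →ₗ[ℂ] B}
    {ρ' : A →ₗ[ℂ] B} {K : ℝ≥0} (h : ∀ᶠ i in l, NuclearBound (ρ i) K)
    (hl : ∀ a, Filter.Tendsto (fun i => ρ i a) l (𝓝 (ρ' a))) : NuclearBound ρ' K :=
  nuclearBound_of fun D _ x H _ _ _ π σ hc => by
    have h1 : Filter.Tendsto (fun i => productRep π σ ((ρ i).rTensor D x)) l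
        (𝓝 (productRep π σ (ρ'.rTensor D x))) := by
      induction x with
      | zero => simp
      | add x y hx hy => simpa only [map_add] using hx.add hy
      | tmul a d =>
        have hπ : Continuous π := AddMonoidHomClass.continuous_of_bound π 1 fun b => by
          simpa using NonUnitalStarAlgHom.norm_apply_le π b
        exact ((hπ.tendsto _).comp (hl a)).mul_const (σ d)
    exact le_of_tendsto h1.enorm (h.mono fun i hi => hi.enorm_le hc x)

/-- If `L(x)* L(y) = c* L(x* y)`, then a nuclear bound for `x ↦ c* L(x)` gives one for `L`. -/
theorem NuclearBound.of_star_mul {L M : A →ₗ[ℂ] B} {K : ℝ≥0}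
    (hL : ∀ x y, star (L x) * L y = M (star x * y)) (h : NuclearBound M K) :
    NuclearBound L (NNReal.sqrt K) :=
  nuclearBound_of fun D _ x H _ _ _ π σ hc => by
    -- The relation between `L` and `M` passes to tensors because `σ(d)*` commutes with `π(L(a))*
    -- π(L(b))`.
    have h1 : ∀ x y : A ⊗[ℂ] D, star (productRep π σ (L.rTensor D x)) *
        productRep π σ (L.rTensor D y) = productRep π σ (M.rTensor D (star x * y)) := by
      intro x y
      induction x with
      | zero => simp
      | add x x' hx hx' => simp only [map_add, star_add, add_mul, hx, hx']
      | tmul a d =>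
        induction y with
        | zero => simp
        | add y y' hy hy' => simp only [map_add, mul_add, hy, hy']
        | tmul b e =>
          simp only [LinearMap.rTensor_tmul, productRep_tmul, TensorProduct.star_tmul,
            Algebra.TensorProduct.tmul_mul_tmul, ← hL, map_mul, star_mul, map_star]
          have := (hc (star (L a) * L b) (star d)).eq
          simp only [map_mul, map_star] at this
          rw [← mul_assoc (star (π (L a)) * π (L b)), this]
          simp only [mul_assoc]
    have h2 : ‖productRep π σ (L.rTensor D x)‖ₑ ^ 2 ≤ (NNReal.sqrt K * minNorm x) ^ 2 := by
      -- The C*-identity in the algebra of operators; this squares the estimate and produces the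
      -- square root of `K`.
      calc _ = ‖productRep π σ (M.rTensor D (star x * x))‖ₑ := by
            rw [← h1, sq]
            simp only [← ofReal_norm]
            rw [← ENNReal.ofReal_mul (norm_nonneg _), CStarRing.norm_star_mul_self]
        _ ≤ K * minNorm (star x * x) := h.enorm_le hc _
        _ ≤ K * (minNorm x * minNorm x) := by
          gcongr
          exact (minNorm_mul_le _ _).trans (by gcongr; exact minNorm_star_le x)
        _ = _ := by
          rw [mul_pow, sq (minNorm x), ← ENNReal.coe_pow, NNReal.sq_sqrt]
    exact (ENNReal.pow_le_pow_left_iff two_ne_zero).mp h2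

/-- If `L(x)* L(y) = c* L(x* y)` and `L` is nuclear, then its nuclear norm is at most `‖c‖`. -/
theorem IsNuclear.nuclearBound_of_star_mul {L : A →ₗ[ℂ] B} (c : B)
    (hL : ∀ x y, star (L x) * L y = star c * L (star x * y)) (h : IsNuclear L) :
    NuclearBound L ‖c‖₊ := by
  -- A bound `K` for `L` gives `‖c‖K` for `c* L`, and then the square root trick returns to `L`. The
  -- fixed point of this improvement is `K = ‖c‖`.
  have hstep : ∀ K, NuclearBound L K → NuclearBound L (NNReal.sqrt (‖c‖₊ * K)) := fun K hK => by
    have := hK.mul_left (ρ' := LinearMap.mulLeft ℂ (star c) ∘ₗ L) (star c) fun _ => rfl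
    rw [nnnorm_star] at this
    exact .of_star_mul (M := LinearMap.mulLeft ℂ (star c) ∘ₗ L) hL this
  -- Closedness means that the optimal bound `N` is attained, so the improvement step may be applied
  -- to `N` itself. Finiteness of `minNorm` is what makes the right-hand side continuous in `K`.
  have hcl : IsClosed {K : ℝ≥0 | NuclearBound L K} := by
    have : {K : ℝ≥0 | NuclearBound L K} = ⋂ (D : Type u) (_ : NonUnitalCStarAlgebra D)
        (x : A ⊗[ℂ] D), {K : ℝ≥0 | maxNorm (L.rTensor D x) ≤ K * minNorm x} := by
      ext K; simp [NuclearBound]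
    rw [this]
    refine isClosed_iInter fun D => isClosed_iInter fun _ => isClosed_iInter fun x =>
      isClosed_le continuous_const ?_
    exact (ENNReal.continuous_mul_const (minNorm_lt_top x).ne).comp ENNReal.continuous_coe
  obtain ⟨K, hK⟩ := isNuclear_iff.mp h
  have hne : {K : ℝ≥0 | NuclearBound L K}.Nonempty := ⟨K, hK⟩
  have hmem := hcl.csInf_mem hne (OrderBot.bddBelow _)
  set N := sInf {K : ℝ≥0 | NuclearBound L K}
  have h1 : N ≤ NNReal.sqrt (‖c‖₊ * N) := csInf_le (OrderBot.bddBelow _) (hstep N hmem)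
  refine NuclearBound.mono hmem ?_
  rw [NNReal.le_sqrt_iff_sq_le, sq] at h1
  by_cases h0 : N = 0
  · rw [h0]; exact zero_le
  · exact le_of_mul_le_mul_right h1 (pos_iff_ne_zero.mpr h0)

end NuclearCalculus

end QNuc
end

noncomputable section

namespace QNuc

/-! ### Representations on pre-Hilbert spaces -/

section PreHilbert

variable {D : Type u} [NonUnitalCStarAlgebra D]

/-- The element `s` is a square root of `‖d‖² - d* d ≥ 0`. It lives in the unitization, since `D`
may have no unit. -/
theorem exists_sqrt_norm_sub (d : D) : ∃ s : Unitization ℂ D,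
    star s * s + star (d : Unitization ℂ D) * d = algebraMap ℝ _ (‖d‖ ^ 2) := by
  let _ := CStarAlgebra.spectralOrder (Unitization ℂ D)
  have := CStarAlgebra.spectralOrderedRing (Unitization ℂ D)
  have h := CStarAlgebra.star_mul_le_algebraMap_norm_sq (a := (d : Unitization ℂ D))
  rw [Unitization.norm_inr] at h
  obtain ⟨s, hs⟩ := CStarAlgebra.nonneg_iff_eq_star_mul_self.mp (sub_nonneg.mpr h)
  exact ⟨s, eq_sub_iff_add_eq.mp hs.symm⟩

variable {E : Type u} [SeminormedAddCommGroup E] [InnerProductSpace ℂ E]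

/-- A *-representation of a C*-algebra on a pre-Hilbert space is contractive. -/
theorem norm_starRep_le (π : D →ₗ[ℂ] E →ₗ[ℂ] E) (hmul : ∀ a b x, π (a * b) x = π a (π b x))
    (hadj : ∀ d x y, inner ℂ (π d x) y = inner ℂ x (π (star d) y)) (d : D) (x : E) :
    ‖π d x‖ ≤ ‖d‖ * ‖x‖ := by
  obtain ⟨s, hs⟩ := exists_sqrt_norm_sub d
  -- The identity for `s` is split into its scalar part and its part in `D`, because only `D` is
  -- given a representation; the unitization acts by `s.fst + π(s.snd)`.
  have h1 : star s.fst * s.fst = ((‖d‖ ^ 2 : ℝ) : ℂ) := by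
    have := congrArg (fun t : Unitization ℂ D => t.fst) hs
    simpa [Unitization.algebraMap_eq_inl_comp] using this
  have h2 : star s.fst • s.snd + s.fst • star s.snd + star s.snd * s.snd = -(star d * d) := by
    rw [← add_eq_zero_iff_eq_neg]
    have := congrArg (fun t : Unitization ℂ D => t.snd) hs
    simpa [Unitization.algebraMap_eq_inl_comp] using this
  -- This is `‖s x‖² = ‖d‖² ‖x‖² - ‖d x‖²`; its left side is nonnegative, which is the claimed
  -- contractivity.
  have h3 : inner ℂ (s.fst • x + π s.snd x) (s.fst • x + π s.snd x) =
      ((‖d‖ ^ 2 : ℝ) : ℂ) * inner ℂ x x - inner ℂ (π d x) (π d x) := by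
    have e1 := congrArg (fun t => inner ℂ x (π t x)) h2
    simp only [map_add, map_smul, LinearMap.add_apply, LinearMap.smul_apply, map_neg,
      LinearMap.neg_apply, inner_add_right, inner_smul_right, inner_neg_right, hmul, ← hadj] at e1
    simp only [inner_add_left, inner_add_right, inner_smul_left, inner_smul_right]
    rw [← h1]
    simp only [starRingEnd_apply]
    linear_combination e1
  have h4 := congrArg Complex.re h3
  rw [Complex.sub_re, Complex.re_ofReal_mul] at h4
  have h5 : ∀ y : E, (inner ℂ y y).re = ‖y‖ ^ 2 := fun y => inner_self_eq_norm_sq (𝕜 := ℂ) y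
  rw [h5, h5, h5] at h4
  refine le_of_sq_le_sq ?_ (by positivity)
  rw [mul_pow]
  nlinarith [sq_nonneg ‖s.fst • x + π s.snd x‖]

theorem completion_clm_ext {S T : UniformSpace.Completion E →L[ℂ] UniformSpace.Completion E}
    (h : ∀ x : E, S x = T x) : S = T :=
  DFunLike.coe_injective (UniformSpace.Completion.ext S.continuous T.continuous h)

/-- The operators of a *-representation of a C*-algebra on a pre-Hilbert space as bounded
operators. -/
def repCLM (π : D →ₗ[ℂ] E →ₗ[ℂ] E) (hmul : ∀ a b x, π (a * b) x = π a (π b x))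
    (hadj : ∀ d x y, inner ℂ (π d x) y = inner ℂ x (π (star d) y)) (d : D) : E →L[ℂ] E :=
  (π d).mkContinuous ‖d‖ (norm_starRep_le π hmul hadj d)

theorem repCLM_completion_coe (π : D →ₗ[ℂ] E →ₗ[ℂ] E)
    (hmul : ∀ a b x, π (a * b) x = π a (π b x))
    (hadj : ∀ d x y, inner ℂ (π d x) y = inner ℂ x (π (star d) y)) (d : D) (x : E) :
    (repCLM π hmul hadj d).completion (x : UniformSpace.Completion E) = (π d x : E) :=
  ContinuousLinearMap.completion_apply_coe _ _

/-- The extension of a *-representation of a C*-algebra on a pre-Hilbert space to the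
completion. -/
def completionRep (π : D →ₗ[ℂ] E →ₗ[ℂ] E) (hmul : ∀ a b x, π (a * b) x = π a (π b x))
    (hadj : ∀ d x y, inner ℂ (π d x) y = inner ℂ x (π (star d) y)) :
    D →⋆ₙₐ[ℂ] (UniformSpace.Completion E →L[ℂ] UniformSpace.Completion E) where
  toFun d := (repCLM π hmul hadj d).completion
  map_smul' c a := completion_clm_ext fun x => by
    rw [repCLM_completion_coe, map_smul, LinearMap.smul_apply, UniformSpace.Completion.coe_smul,
      ← repCLM_completion_coe π hmul hadj]
    rfl
  map_zero' := completion_clm_ext fun x => by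
    rw [repCLM_completion_coe, map_zero, LinearMap.zero_apply, UniformSpace.Completion.coe_zero]
    rfl
  map_add' a b := completion_clm_ext fun x => by
    rw [repCLM_completion_coe, map_add, LinearMap.add_apply, UniformSpace.Completion.coe_add,
      ← repCLM_completion_coe π hmul hadj, ← repCLM_completion_coe π hmul hadj]
    rfl
  map_mul' a b := completion_clm_ext fun x => by
    rw [repCLM_completion_coe, hmul, mul_apply_eq_comp, repCLM_completion_coe,
      repCLM_completion_coe]
  map_star' d := by
    refine (ContinuousLinearMap.eq_adjoint_iff _ _).mpr fun x y => ?_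
    induction x, y using UniformSpace.Completion.induction_on₂ with
    | hp => exact isClosed_eq (by fun_prop) (by fun_prop)
    | ih x y =>
      rw [repCLM_completion_coe, repCLM_completion_coe, UniformSpace.Completion.inner_coe,
        UniformSpace.Completion.inner_coe, hadj, star_star]

theorem completionRep_coe (π : D →ₗ[ℂ] E →ₗ[ℂ] E) (hmul : ∀ a b x, π (a * b) x = π a (π b x))
    (hadj : ∀ d x y, inner ℂ (π d x) y = inner ℂ x (π (star d) y)) (d : D) (x : E) :
    completionRep π hmul hadj d (x : UniformSpace.Completion E) = (π d x : E) :=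
  repCLM_completion_coe π hmul hadj d x

end PreHilbert

/-! ### Dilation of maps of positive type -/

section Dilation

variable {C D H : Type u} [CStarAlgebra C] [NonUnitalCStarAlgebra D]
  [NormedAddCommGroup H] [InnerProductSpace ℂ H] [CompleteSpace H]

variable (C H) in
/-- A (completely positive) linear map `T` from `C` to the operators on `H`, such that
`∑ ⟨ξᵢ, T(cᵢ* cⱼ) ξⱼ⟩ ≥ 0`. -/
structure PositiveType where
  /-- The underlying linear map. -/
  toLin : C →ₗ[ℂ] (H →L[ℂ] H)
  map_star : ∀ c, toLin (star c) = star (toLin c)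
  nonneg : ∀ (n : ℕ) (c : Fin n → C) (ξ : Fin n → H),
    0 ≤ (∑ i, ∑ j, inner ℂ (ξ i) (toLin (star (c i) * c j) (ξ j))).re

namespace PositiveType

variable (T : PositiveType C H)

/-- The sesquilinear form `⟨c ⊗ ξ, c' ⊗ η⟩ = ⟨ξ, T(c* c') η⟩` on `C ⊗ H`. -/
def form : C ⊗[ℂ] H →ₗ⋆[ℂ] C ⊗[ℂ] H →ₗ[ℂ] ℂ :=
  TensorProduct.lift (LinearMap.mk₂'ₛₗ (starRingEnd ℂ) (starRingEnd ℂ)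
    (fun c ξ => TensorProduct.lift (LinearMap.mk₂ ℂ
      (fun c' η => inner ℂ ξ (T.toLin (star c * c') η))
      (fun a b η => by simp [mul_add])
      (fun z a η => by simp)
      (fun a η ζ => by simp)
      (fun z a η => by simp)))
    (fun a b ξ => by ext; simp [add_mul])
    (fun z a ξ => by ext; simp)
    (fun a ξ η => by ext; simp)
    (fun z a ξ => by ext; simp [mul_comm]))

theorem form_tmul (c c' : C) (ξ η : H) :
    T.form (c ⊗ₜ ξ) (c' ⊗ₜ η) = inner ℂ ξ (T.toLin (star c * c') η) := rfl

/-- `C ⊗ H` with the semi-inner product given by `T`. -/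
def PreDilation (_ : PositiveType C H) : Type u := C ⊗[ℂ] H

instance : AddCommGroup T.PreDilation := inferInstanceAs (AddCommGroup (C ⊗[ℂ] H))
instance : Module ℂ T.PreDilation := inferInstanceAs (Module ℂ (C ⊗[ℂ] H))

/-- The identity map from `C ⊗ H` to the pre-Hilbert space of the dilation. -/
def toPre : C ⊗[ℂ] H ≃ₗ[ℂ] T.PreDilation := LinearEquiv.refl ℂ _

theorem form_symm (x y : C ⊗[ℂ] H) : starRingEnd ℂ (T.form y x) = T.form x y := by
  induction x with
  | zero => simp
  | add x x' hx hx' => simp [hx, hx']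
  | tmul c ξ =>
    induction y with
    | zero => simp
    | add y y' hy hy' => simp [hy, hy']
    | tmul d η =>
      rw [form_tmul, form_tmul, inner_conj_symm]
      have : star c * d = star (star d * c) := by simp
      rw [this, T.map_star, ContinuousLinearMap.star_eq_adjoint,
        ContinuousLinearMap.adjoint_inner_right]

/-- For a finite sum of elementary tensors this is exactly the positivity required of `T`. -/
theorem form_self_nonneg (x : C ⊗[ℂ] H) : 0 ≤ (T.form x x).re := by
  obtain ⟨n, c, ξ, rfl⟩ := TensorProduct.exists_sum_tmul_eq x
  simp only [map_sum, LinearMap.sum_apply, form_tmul]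
  rw [← Finset.sum_comm]
  exact T.nonneg n c ξ

/-- The semi-inner product on the pre-Hilbert space of the dilation. -/
abbrev core : PreInnerProductSpace.Core ℂ T.PreDilation where
  inner x y := T.form (T.toPre.symm x) (T.toPre.symm y)
  conj_inner_symm x y := T.form_symm _ _
  re_inner_nonneg x := T.form_self_nonneg _
  add_left x y z := by simp
  smul_left x y c := by simp

instance : SeminormedAddCommGroup T.PreDilation :=
  InnerProductSpace.Core.toSeminormedAddCommGroup (c := T.core)
instance : InnerProductSpace ℂ T.PreDilation := InnerProductSpace.ofCore T.core

theorem inner_toPre (x y : C ⊗[ℂ] H) : inner ℂ (T.toPre x) (T.toPre y) = T.form x y := rfl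

/-- The action of `C` on `C ⊗ H` by left multiplication. -/
def leftRep : C →ₗ[ℂ] T.PreDilation →ₗ[ℂ] T.PreDilation :=
  LinearMap.rTensorHom H ∘ₗ LinearMap.mul ℂ C

theorem leftRep_tmul (a c : C) (ξ : H) :
    T.leftRep a (T.toPre (c ⊗ₜ ξ)) = T.toPre ((a * c) ⊗ₜ ξ) := rfl

/-- The action on the second factor of `C ⊗ H` of a representation on `H`. -/
def rightRep (σ : D →⋆ₙₐ[ℂ] (H →L[ℂ] H)) : D →ₗ[ℂ] T.PreDilation →ₗ[ℂ] T.PreDilation :=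
  LinearMap.lTensorHom C ∘ₗ ContinuousLinearMap.coeLM ℂ ∘ₗ
    ((σ : D →ₙₐ[ℂ] (H →L[ℂ] H)) : D →ₗ[ℂ] (H →L[ℂ] H))

theorem rightRep_tmul (σ : D →⋆ₙₐ[ℂ] (H →L[ℂ] H)) (d : D) (c : C) (ξ : H) :
    T.rightRep σ d (T.toPre (c ⊗ₜ ξ)) = T.toPre (c ⊗ₜ σ d ξ) := rfl

variable {T} in
theorem pre_induction {p : T.PreDilation → Prop} (zero : p 0)
    (tmul : ∀ c ξ, p (T.toPre (c ⊗ₜ ξ))) (add : ∀ x y, p x → p y → p (x + y)) (x) : p x :=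
  TensorProduct.induction_on (motive := fun x => p (T.toPre x)) x zero tmul
    fun _ _ hx hy => add _ _ hx hy

theorem leftRep_mul (a b : C) (x : T.PreDilation) :
    T.leftRep (a * b) x = T.leftRep a (T.leftRep b x) := by
  induction x using pre_induction with
  | zero => simp
  | add x y hx hy => simp only [map_add, hx, hy]
  | tmul c ξ => simp only [leftRep_tmul, mul_assoc]

theorem rightRep_mul (σ : D →⋆ₙₐ[ℂ] (H →L[ℂ] H)) (a b : D) (x : T.PreDilation) :
    T.rightRep σ (a * b) x = T.rightRep σ a (T.rightRep σ b x) := by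
  induction x using pre_induction with
  | zero => simp
  | add x y hx hy => simp only [map_add, hx, hy]
  | tmul c ξ => simp only [rightRep_tmul, map_mul]; rfl

theorem leftRep_rightRep (σ : D →⋆ₙₐ[ℂ] (H →L[ℂ] H)) (a : C) (d : D) (x : T.PreDilation) :
    T.leftRep a (T.rightRep σ d x) = T.rightRep σ d (T.leftRep a x) := by
  induction x using pre_induction with
  | zero => simp
  | add x y hx hy => simp only [map_add, hx, hy]
  | tmul c ξ => rfl

theorem inner_leftRep (a : C) (x y : T.PreDilation) :
    inner ℂ (T.leftRep a x) y = inner ℂ x (T.leftRep (star a) y) := by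
  induction x using pre_induction with
  | zero => simp
  | add x x' hx hx' => simp only [map_add, inner_add_left, hx, hx']
  | tmul c ξ =>
    induction y using pre_induction with
    | zero => simp
    | add y y' hy hy' => simp only [map_add, inner_add_right, hy, hy']
    | tmul c' η => simp only [leftRep_tmul, inner_toPre, form_tmul, star_mul, mul_assoc]

/-- Commutation with `T` is what makes the second action a *-representation for the form of the
dilation. Its boundedness then comes for free from `norm_starRep_le`. -/
theorem inner_rightRep (σ : D →⋆ₙₐ[ℂ] (H →L[ℂ] H)) (hσ : ∀ c d, Commute (T.toLin c) (σ d)) (d : D)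
    (x y : T.PreDilation) :
    inner ℂ (T.rightRep σ d x) y = inner ℂ x (T.rightRep σ (star d) y) := by
  induction x using pre_induction with
  | zero => simp
  | add x x' hx hx' => simp only [map_add, inner_add_left, hx, hx']
  | tmul c ξ =>
    induction y using pre_induction with
    | zero => simp
    | add y y' hy hy' => simp only [map_add, inner_add_right, hy, hy']
    | tmul c' η =>
      simp only [rightRep_tmul, inner_toPre, form_tmul]
      rw [← mul_apply_eq_comp, (hσ _ _).eq, mul_apply_eq_comp, StarHomClass.map_star σ,
        ContinuousLinearMap.star_eq_adjoint, ContinuousLinearMap.adjoint_inner_right]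

/-- The map `ξ ↦ 1 ⊗ ξ`. -/
def embed : H →L[ℂ] UniformSpace.Completion T.PreDilation :=
  UniformSpace.Completion.toComplL.comp
    -- The constant comes from `‖1 ⊗ ξ‖² = ⟨ξ, T(1)ξ⟩`.
    (LinearMap.mkContinuous (T.toPre.toLinearMap ∘ₗ TensorProduct.mk ℂ C H 1) (√‖T.toLin 1‖)
      fun ξ => by
        refine le_of_sq_le_sq ?_ (by positivity)
        rw [mul_pow, Real.sq_sqrt (norm_nonneg _), ← inner_self_eq_norm_sq (𝕜 := ℂ)]
        show (inner ℂ ξ (T.toLin (star 1 * 1) ξ)).re ≤ _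
        rw [star_one, mul_one]
        calc _ ≤ ‖ξ‖ * ‖T.toLin 1 ξ‖ := re_inner_le_norm (𝕜 := ℂ) _ _
          _ ≤ ‖ξ‖ * (‖T.toLin 1‖ * ‖ξ‖) := by gcongr; exact ContinuousLinearMap.le_opNorm _ _
          _ = _ := by ring)

theorem embed_apply (ξ : H) : T.embed ξ = (T.toPre (1 ⊗ₜ ξ) : T.PreDilation) := rfl

/-- Dilation of a map of positive type together with a commuting representation. -/
theorem exists_dilation (σ : D →⋆ₙₐ[ℂ] (H →L[ℂ] H)) (hσ : ∀ c d, Commute (T.toLin c) (σ d)) :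
    ∃ (K : Type u) (_ : NormedAddCommGroup K) (_ : InnerProductSpace ℂ K) (_ : CompleteSpace K)
      (π' : C →⋆ₙₐ[ℂ] (K →L[ℂ] K)) (σ' : D →⋆ₙₐ[ℂ] (K →L[ℂ] K)) (V : H →L[ℂ] K),
      (∀ c d, Commute (π' c) (σ' d)) ∧ V.adjoint ∘L V = T.toLin 1 ∧
      ∀ c d, V.adjoint ∘L (π' c * σ' d) ∘L V = T.toLin c * σ d := by
  refine ⟨UniformSpace.Completion T.PreDilation, inferInstance, inferInstance, inferInstance,
    completionRep T.leftRep T.leftRep_mul T.inner_leftRep,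
    completionRep (T.rightRep σ) (T.rightRep_mul σ) (T.inner_rightRep σ hσ), T.embed, ?_, ?_, ?_⟩
  · intro c d
    refine ContinuousLinearMap.ext fun x => ?_
    induction x using UniformSpace.Completion.induction_on with
    | hp => apply isClosed_eq <;> fun_prop
    | ih x =>
      simp only [mul_apply_eq_comp, completionRep_coe, leftRep_rightRep]
  · refine ContinuousLinearMap.ext fun η => ext_inner_left ℂ fun ξ => ?_
    rw [ContinuousLinearMap.comp_apply, ContinuousLinearMap.adjoint_inner_right, embed_apply,
      embed_apply, UniformSpace.Completion.inner_coe, inner_toPre, form_tmul, star_one, mul_one]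
  · intro c d
    refine ContinuousLinearMap.ext fun η => ext_inner_left ℂ fun ξ => ?_
    rw [ContinuousLinearMap.comp_apply, ContinuousLinearMap.adjoint_inner_right,
      ContinuousLinearMap.comp_apply, mul_apply_eq_comp, embed_apply, embed_apply,
      completionRep_coe, completionRep_coe, rightRep_tmul, leftRep_tmul,
      UniformSpace.Completion.inner_coe, inner_toPre, form_tmul, star_one, one_mul, mul_one]
    rfl

end PositiveType

end Dilation

end QNuc
end

noncomputable section

namespace QNuc

/-! ### Square roots in subalgebras and compression to a hereditary subalgebra -/

section Compression

variable {A B : Type u} [NonUnitalCStarAlgebra A] [NonUnitalCStarAlgebra B]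
  (S : NonUnitalStarSubalgebra ℂ B)

/-- If `R* R` is in the closed *-subalgebra `S`, then it is of the form `X* X` with `X ∈ S`. -/
theorem exists_mem_star_mul_self [IsClosed (S : Set B)] {R : B} (hR : star R * R ∈ S) :
    ∃ X ∈ S, star X * X = star R * R := by
  let _ := CStarAlgebra.spectralOrder B
  have := CStarAlgebra.spectralOrderedRing B
  have hpos : 0 ≤ star R * R := star_mul_self_nonneg R
  -- The non-unital functional calculus of `R* R` stays inside any closed *-subalgebra that contains
  -- it.
  refine ⟨CFC.sqrt (star R * R), ?_, ?_⟩
  · rw [CFC.sqrt, cfcₙ_nnreal_eq_real _ _ hpos]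
    exact cfcₙ_mem (𝕜' := ℂ) _ hR
  · rw [(CFC.sqrt_nonneg _).isSelfAdjoint.star_eq, CFC.sqrt_mul_sqrt_self _ hpos]

/-- The matrices with entries in a *-subalgebra. -/
def matrixSubalgebra (n : ℕ) : NonUnitalStarSubalgebra ℂ (CStarMatrix (Fin n) (Fin n) B) where
  carrier := {M | ∀ i j, M i j ∈ S}
  zero_mem' i j := zero_mem S
  add_mem' hM hN i j := add_mem (hM i j) (hN i j)
  mul_mem' {M N} hM hN i j := by
    rw [CStarMatrix.mul_apply]
    exact sum_mem fun k _ => mul_mem (hM i k) (hN k j)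
  smul_mem' c M hM i j := SMulMemClass.smul_mem c (hM i j)
  star_mem' hM i j := star_mem (hM j i)

theorem isClosed_matrixSubalgebra [hS : IsClosed (S : Set B)] (n : ℕ) :
    IsClosed (matrixSubalgebra S n : Set (CStarMatrix (Fin n) (Fin n) B)) := by
  have : (matrixSubalgebra S n : Set (CStarMatrix (Fin n) (Fin n) B)) =
      ⋂ (i : Fin n) (j : Fin n), {M | M i j ∈ (S : Set B)} := by
    ext M
    simp only [Set.mem_iInter]
    rfl
  rw [this]
  refine isClosed_iInter fun i => isClosed_iInter fun j => hS.preimage ?_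
  exact (continuous_apply j).comp (continuous_apply i)

/-- If the entries of the positive matrix `(rᵢ* rⱼ)` are in `S`, then it is of the form `X* X` for a
matrix `X` with entries in `S`. -/
theorem exists_matrix_sqrt [IsClosed (S : Set B)] {n : ℕ} (r : Fin n → B)
    (hr : ∀ i j, star (r i) * r j ∈ S) :
    ∃ X : Fin n → Fin n → S, ∀ i j, star (r i) * r j = ∑ m, (star (X m i : B) * X m j) := by
  let _ := CStarAlgebra.spectralOrder B
  have := CStarAlgebra.spectralOrderedRing B
  -- The row that carries `r` needs an index `0`, so the empty matrix is treated apart.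
  cases n with
  | zero => exact ⟨fun i => i.elim0, fun i => i.elim0⟩
  | succ n =>
  -- The first row of `R` is `r` and the others vanish, so `R* R` is the matrix `(rᵢ* rⱼ)`. The
  -- entries of `R` need not be in `S`, only those of `R* R`.
  let R : CStarMatrix (Fin (n + 1)) (Fin (n + 1)) B :=
    CStarMatrix.ofMatrix (Matrix.of fun i j => if i = 0 then r j else 0)
  have hR : ∀ i j, (star R * R) i j = star (r i) * r j := fun i j => by
    rw [CStarMatrix.mul_apply, Finset.sum_eq_single 0]
    · simp [R, CStarMatrix.star_apply]
    · intro m _ hm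
      simp [R, hm]
    · simp
  have hmem : star R * R ∈ matrixSubalgebra S (n + 1) := fun i j => by rw [hR]; exact hr i j
  have hcl := isClosed_matrixSubalgebra S (n + 1)
  obtain ⟨X, hXmem, hXX⟩ := exists_mem_star_mul_self (matrixSubalgebra S (n + 1)) hmem
  refine ⟨fun m j => ⟨X m j, hXmem m j⟩, fun i j => ?_⟩
  rw [← hR, ← hXX, CStarMatrix.mul_apply]
  rfl

variable {S}

/-- The element `c k` of `B`, for `c` in the unitization of `B` and `k ∈ B`. -/
def unitizationMul (k : B) (c : Unitization ℂ B) : B := c.fst • k + c.snd * k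

/-- The compression `c ↦ k* c k` from the unitization of `B` to a subalgebra. -/
def compress (k : S) (hk : ∀ b : B, star (k : B) * b * k ∈ S) : Unitization ℂ B →ₗ[ℂ] S where
  toFun c := ⟨star (k : B) * unitizationMul (k : B) c, by
    rw [unitizationMul, mul_add, ← mul_assoc, mul_smul_comm]
    exact add_mem (SMulMemClass.smul_mem _ (mul_mem (star_mem k.2) k.2)) (hk _)⟩
  map_add' c d := Subtype.ext (by simp [unitizationMul, add_smul, add_mul, mul_add]; abel)
  map_smul' z c := Subtype.ext (by simp [unitizationMul, mul_smul, smul_mul_assoc, mul_add, mul_smul_comm])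

/-- This exhibits `k* c* d k` as `(ck)* (dk)`, the form that `exists_matrix_sqrt` asks for. The
factors `ck` lie in `B` and in general not in `S`. -/
theorem compress_star_mul (k : S) (hk : ∀ b : B, star (k : B) * b * k ∈ S)
    (c d : Unitization ℂ B) :
    (compress k hk (star c * d) : B) = star (unitizationMul (k : B) c) * unitizationMul (k : B) d := by
  show star (k : B) * unitizationMul (k : B) (star c * d) = _
  simp only [unitizationMul, Unitization.fst_mul, Unitization.snd_mul, Unitization.fst_star,
    Unitization.snd_star, star_add, star_smul, star_mul, add_mul, mul_add, smul_mul_assoc,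
    mul_smul_comm, mul_assoc, smul_add, smul_smul]
  rw [mul_comm d.fst]
  abel

theorem compress_star (k : S) (hk : ∀ b : B, star (k : B) * b * k ∈ S) (c : Unitization ℂ B) :
    compress k hk (star c) = star (compress k hk c) := by
  refine Subtype.ext ?_
  show star (k : B) * unitizationMul (k : B) (star c) = star (star (k : B) * unitizationMul (k : B) c)
  simp [unitizationMul, mul_add, mul_assoc, mul_smul_comm]

variable {H : Type u} [NormedAddCommGroup H] [InnerProductSpace ℂ H] [CompleteSpace H]

/-- The map of positive type `c ↦ π(k* c k)` on the unitization of `B`, for a representation `π` of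
a closed *-subalgebra. -/
def compressType [IsClosed (S : Set B)] (k : S) (hk : ∀ b : B, star (k : B) * b * k ∈ S)
    (π : S →⋆ₙₐ[ℂ] (H →L[ℂ] H)) : PositiveType (Unitization ℂ B) H where
  toLin := ((π : S →ₙₐ[ℂ] (H →L[ℂ] H)) : S →ₗ[ℂ] (H →L[ℂ] H)) ∘ₗ compress k hk
  map_star c := by
    show π (compress k hk (star c)) = star (π (compress k hk c))
    rw [compress_star, map_star]
  nonneg n c ξ := by
    -- Since `π` is defined only on `S`, positivity is transported by a square root with entries in
    -- `S`: the double sum becomes a sum of squared norms.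
    obtain ⟨X, hX⟩ := exists_matrix_sqrt S (fun i => unitizationMul (k : B) (c i)) fun i j => by
      rw [← compress_star_mul k hk]; exact Subtype.prop _
    have h1 : ∀ i j, compress k hk (star (c i) * c j) = ∑ m, star (X m i) * X m j := fun i j =>
      Subtype.ext (by rw [compress_star_mul, hX]; simp)
    have h2 : ∑ i, ∑ j, inner ℂ (ξ i) (π (compress k hk (star (c i) * c j)) (ξ j)) =
        ∑ m, inner ℂ (∑ i, π (X m i) (ξ i)) (∑ j, π (X m j) (ξ j)) := by
      simp only [h1, map_sum, sum_apply, inner_sum, sum_inner, map_mul,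
        map_star, mul_apply_eq_comp, ContinuousLinearMap.star_eq_adjoint,
        ContinuousLinearMap.adjoint_inner_right]
      rw [Finset.sum_congr rfl fun i _ => Finset.sum_comm, Finset.sum_comm]
      exact Finset.sum_congr rfl fun m _ => Finset.sum_comm
    show 0 ≤ (∑ i, ∑ j, inner ℂ (ξ i) (π (compress k hk (star (c i) * c j)) (ξ j))).re
    rw [h2, Complex.re_sum]
    exact Finset.sum_nonneg fun m _ => inner_self_nonneg (𝕜 := ℂ)

/-- Compression of a nuclear map to a hereditary subalgebra is nuclear as a map to the
subalgebra. -/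
theorem NuclearBound.compress [IsClosed (S : Set B)] {ρ : A →ₗ[ℂ] B} {K : ℝ≥0}
    (h : NuclearBound ρ K) (k : S) (hk : ∀ b : B, star (k : B) * b * k ∈ S) {ρ' : A →ₗ[ℂ] S}
    (hρ : ∀ x, (ρ' x : B) = star (k : B) * ρ x * k) : NuclearBound ρ' (‖k‖₊ ^ 2 * K) :=
  nuclearBound_of fun D _ x H _ _ _ π σ hc => by
    -- The pair `(π, σ)` for `S` and `D` is dilated to a commuting pair for the unitization of `B`
    -- and `D`, where the bound for `ρ` can be used.
    obtain ⟨L, _, _, _, π', σ', V, hcomm, hV, hVc⟩ :=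
      (compressType k hk π).exists_dilation σ fun c d => hc _ d
    let π₀ : B →⋆ₙₐ[ℂ] (L →L[ℂ] L) := π'.comp (Unitization.inrNonUnitalStarAlgHom ℂ B)
    have h1 : productRep π σ (ρ'.rTensor D x) =
        V.adjoint ∘L productRep π₀ σ' (ρ.rTensor D x) ∘L V := by
      induction x with
      | zero => simp
      | add x y hx hy =>
        simp only [map_add, hx, hy, ContinuousLinearMap.add_comp, ContinuousLinearMap.comp_add]
      | tmul a d =>
        rw [LinearMap.rTensor_tmul, LinearMap.rTensor_tmul, productRep_tmul, productRep_tmul]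
        refine Eq.trans ?_ (hVc (ρ a : Unitization ℂ B) d).symm
        congr 1
        refine congrArg π (Subtype.ext ?_)
        rw [hρ]
        show _ = star (k : B) * ((0 : ℂ) • (k : B) + ρ a * k)
        rw [zero_smul, zero_add, mul_assoc]
    -- `V* V` is the value of the compression at the unit, namely `π(k* k)`.
    have h2 : ‖V‖ ^ 2 ≤ ‖k‖ ^ 2 := by
      rw [sq, ← ContinuousLinearMap.norm_adjoint_comp_self, hV]
      refine (NonUnitalStarAlgHom.norm_apply_le π _).trans ?_
      have : QNuc.compress k hk 1 = star k * k := Subtype.ext (by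
        show star (k : B) * ((1 : ℂ) • (k : B) + 0 * k) = star (k : B) * k
        rw [one_smul, zero_mul, add_zero])
      rw [this, CStarRing.norm_star_mul_self, sq]
    rw [h1, ENNReal.coe_mul, mul_assoc]
    have h3 : ‖V.adjoint ∘L productRep π₀ σ' (ρ.rTensor D x) ∘L V‖ ≤
        ‖k‖ ^ 2 * ‖productRep π₀ σ' (ρ.rTensor D x)‖ := by
      calc _ ≤ ‖V.adjoint‖ * (‖productRep π₀ σ' (ρ.rTensor D x)‖ * ‖V‖) :=
            (ContinuousLinearMap.opNorm_comp_le _ _).trans (by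
              gcongr; exact ContinuousLinearMap.opNorm_comp_le _ _)
        _ = ‖V‖ ^ 2 * ‖productRep π₀ σ' (ρ.rTensor D x)‖ := by
          rw [LinearIsometryEquiv.norm_map]; ring
        _ ≤ _ := by gcongr
    calc _ ≤ ((‖k‖₊ ^ 2 : ℝ≥0) : ℝ≥0∞) * ‖productRep π₀ σ' (ρ.rTensor D x)‖ₑ :=
          ENNReal.coe_le_coe.mpr (show ‖V.adjoint ∘L productRep π₀ σ' (ρ.rTensor D x) ∘L V‖₊ ≤
            ‖k‖₊ ^ 2 * ‖productRep π₀ σ' (ρ.rTensor D x)‖₊ from h3)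
      _ ≤ _ := by
        gcongr
        exact h.enorm_le (fun b d => hcomm _ d) x

end Compression

end QNuc
end

noncomputable section

namespace QNuc

/-! ### Permanence properties of nuclear maps -/

section IsNuclear

variable {A B C : Type u} [NonUnitalCStarAlgebra A] [NonUnitalCStarAlgebra B]
  [NonUnitalCStarAlgebra C]

theorem IsNuclear.add {ρ ρ' : A →ₗ[ℂ] B} (h : IsNuclear ρ) (h' : IsNuclear ρ') :
    IsNuclear (ρ + ρ') :=
  have ⟨_, hK⟩ := isNuclear_iff.mp h
  have ⟨_, hK'⟩ := isNuclear_iff.mp h'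
  isNuclear_iff.mpr ⟨_, hK.add hK'⟩

theorem IsNuclear.sub {ρ ρ' : A →ₗ[ℂ] B} (h : IsNuclear ρ) (h' : IsNuclear ρ') :
    IsNuclear (ρ - ρ') :=
  have ⟨_, hK⟩ := isNuclear_iff.mp h
  have ⟨_, hK'⟩ := isNuclear_iff.mp h'
  isNuclear_iff.mpr ⟨_, hK.sub hK'⟩

theorem IsNuclear.smul {ρ : A →ₗ[ℂ] B} (h : IsNuclear ρ) (c : ℂ) : IsNuclear (c • ρ) :=
  have ⟨_, hK⟩ := isNuclear_iff.mp h
  isNuclear_iff.mpr ⟨_, hK.smul c⟩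

theorem isNuclear_zero : IsNuclear (0 : A →ₗ[ℂ] B) :=
  isNuclear_iff.mpr ⟨0, nuclearBound_of fun D _ x H _ _ _ π σ hc => by simp⟩

theorem IsNuclear.hom_comp {ρ : A →ₗ[ℂ] B} (h : IsNuclear ρ) (f : B →⋆ₙₐ[ℂ] C) :
    IsNuclear (toLin f ∘ₗ ρ) :=
  have ⟨_, hK⟩ := isNuclear_iff.mp h
  isNuclear_iff.mpr ⟨_, hK.hom_comp f⟩

theorem IsNuclear.mul_left {ρ : A →ₗ[ℂ] B} (h : IsNuclear ρ) (b : B) :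
    IsNuclear (LinearMap.mulLeft ℂ b ∘ₗ ρ) :=
  have ⟨_, hK⟩ := isNuclear_iff.mp h
  isNuclear_iff.mpr ⟨_, hK.mul_left b fun _ => rfl⟩

theorem IsNuclear.mul_right {ρ : A →ₗ[ℂ] B} (h : IsNuclear ρ) (b : B) :
    IsNuclear (LinearMap.mulRight ℂ b ∘ₗ ρ) :=
  have ⟨_, hK⟩ := isNuclear_iff.mp h
  isNuclear_iff.mpr ⟨_, hK.mul_right b fun _ => rfl⟩

theorem IsNuclear.comp_mulRight {ρ : A →ₗ[ℂ] B} (h : IsNuclear ρ) (a : A) :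
    IsNuclear (ρ ∘ₗ LinearMap.mulRight ℂ a) :=
  have ⟨_, hK⟩ := isNuclear_iff.mp h
  isNuclear_iff.mpr ⟨_, hK.comp_mulRight a⟩

theorem IsNuclear.of_star_mul {L M : A →ₗ[ℂ] B}
    (hL : ∀ x y, star (L x) * L y = M (star x * y)) (h : IsNuclear M) : IsNuclear L :=
  have ⟨_, hK⟩ := isNuclear_iff.mp h
  isNuclear_iff.mpr ⟨_, hK.of_star_mul hL⟩

/-- In a continuous family of maps `f t` with `f t(x)* f t(y) = c(t)* f t(x* y)`, the nuclear ones
form a closed subset. -/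
theorem isClosed_isNuclear {X : Type*} [TopologicalSpace X] (f : X → A →ₗ[ℂ] B) (c : X → B)
    (hc : Continuous c) (hf : ∀ a, Continuous fun t => f t a)
    (h : ∀ t x y, star (f t x) * f t y = star (c t) * f t (star x * y)) :
    IsClosed {t | IsNuclear (f t)} := by
  -- A nuclear `f s` has nuclear norm at most `‖c s‖`, which is below `‖c t‖ + 1` for `s` near `t`.
  -- So the nuclear maps near `t` have a common bound, and it passes to the pointwise limit.
  refine isClosed_iff_clusterPt.mpr fun t ht => isNuclear_iff.mpr ⟨‖c t‖₊ + 1, ?_⟩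
  have : (𝓝[{t | IsNuclear (f t)}] t).NeBot := ht
  refine NuclearBound.of_tendsto (ρ := f) (l := 𝓝[{t | IsNuclear (f t)}] t) ?_ fun a =>
    ((hf a).tendsto t).mono_left nhdsWithin_le_nhds
  have h1 : ∀ᶠ s in 𝓝 t, ‖c s‖₊ < ‖c t‖₊ + 1 :=
    (hc.nnnorm.tendsto t).eventually_lt_const (lt_add_one _)
  filter_upwards [self_mem_nhdsWithin, h1.filter_mono nhdsWithin_le_nhds] with s hs hs'
  exact (IsNuclear.nuclearBound_of_star_mul (c s) (h s) hs).mono hs'.le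

end IsNuclear

/-! ### Nuclearity of the action on the right ideal and on the hereditary subalgebra -/

section Extension

variable {A R B : Type u} [NonUnitalCStarAlgebra A] [NonUnitalCStarAlgebra R]
  [NonUnitalCStarAlgebra B] {I : ClosedIdeal R} (ψ : I →⋆ₙₐ[ℂ] B) (i : A →⋆ₙₐ[ℂ] R)

/-- The basic relation `(i(x)y)* (i(x')y) = y* (i(x* x')y)`, which makes the square root trick and
the closedness result available for these maps. -/
theorem homMul_star_mul (y : I) (x x' : A) :
    star ((toLin ψ ∘ₗ mulRight I i y) x) * (toLin ψ ∘ₗ mulRight I i y) x' =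
      star (ψ y) * (toLin ψ ∘ₗ mulRight I i y) (star x * x') := by
  show star (ψ (I.lmul (i x) y)) * ψ (I.lmul (i x') y) = star (ψ y) * ψ (I.lmul (i (star x * x')) y)
  rw [← map_star, ← map_star, ← map_mul, ← map_mul]
  refine congrArg ψ (Subtype.ext ?_)
  show star (i x * y) * (i x' * y) = star (y : R) * (i (star x * x') * y)
  rw [star_mul, map_mul, map_star]
  simp only [mul_assoc]

theorem continuous_homMul (x : A) :
    Continuous fun y : I => (toLin ψ ∘ₗ mulRight I i y) x :=
  (hom_continuous ψ).comp
    (Continuous.subtype_mk (continuous_const.mul continuous_subtype_val) _)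

theorem isClosed_isNuclear_homMul : IsClosed {y : I | IsNuclear (toLin ψ ∘ₗ mulRight I i y)} :=
  isClosed_isNuclear _ ψ (hom_continuous ψ) (continuous_homMul ψ i) (homMul_star_mul ψ i)

theorem gen_mem_hereditary (y : I) (b : B) (y' : I) : ψ y * b * ψ y' ∈ hereditary ψ :=
  NonUnitalStarSubalgebra.le_topologicalClosure _
    (NonUnitalStarAlgebra.subset_adjoin ℂ _ ⟨y, b, y', rfl⟩)

/-- With an approximate unit on each side, `y` is an iterated limit of products `w y u`, and
`ψ(w)ψ(y)ψ(u)` is a generator. -/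
theorem hom_mem_hereditary (y : I) : ψ y ∈ hereditary ψ := by
  have hH : IsClosed (hereditary ψ : Set B) := inferInstance
  obtain ⟨l, hl, -, h, -⟩ := exists_approxUnit I
  have h' : ∀ w : I, w * y ∈ {z : I | ψ z ∈ hereditary ψ} := fun w => by
    obtain ⟨l', hl', -, -, h'⟩ := exists_approxUnit I
    refine hH.mem_of_tendsto (((hom_continuous ψ).tendsto _).comp (h' (w * y)))
      (Filter.Eventually.of_forall fun u => ?_)
    show ψ (w * y * u) ∈ hereditary ψ
    rw [map_mul, map_mul]
    exact gen_mem_hereditary ψ w _ u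
  exact hH.mem_of_tendsto (((hom_continuous ψ).tendsto y).comp (h y))
    (Filter.Eventually.of_forall h')

theorem act_hom (z : R) (y : I) (hy : ψ y ∈ rightIdeal ψ) :
    (act ψ z ⟨ψ y, hy⟩ : B) = ψ (I.lmul z y) := by
  have hm : ψ (I.lmul z y) ∈ rightIdeal ψ := hereditary_le ψ (hom_mem_hereditary ψ _)
  have : act ψ z ⟨ψ y, hy⟩ = ⟨ψ (I.lmul z y), hm⟩ := act_unique ψ fun w => by
    show ψ w * ψ (I.lmul z y) = ψ (I.rmul w z) * ψ y
    rw [← map_mul, ← map_mul]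
    exact congrArg ψ (Subtype.ext (mul_assoc _ _ _).symm)
  rw [this]

theorem act_mul_right (z : R) (e : rightIdeal ψ) (b : B) (he : (e : B) * b ∈ rightIdeal ψ) :
    (act ψ z ⟨e * b, he⟩ : B) = act ψ z e * b := by
  have : act ψ z ⟨e * b, he⟩ = ⟨act ψ z e * b, mul_mem_rightIdeal ψ (act ψ z e).2 b⟩ :=
    act_unique ψ fun w => by
      show ψ w * ((act ψ z e : B) * b) = ψ (I.rmul w z) * ((e : B) * b)
      rw [← mul_assoc, act_spec, mul_assoc]
  rw [this]

/-- The linear map `a ↦ i(a) · e` from `A` to `B`, for `e ∈ ψ(I)B`. -/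
def actMap (e : rightIdeal ψ) : A →ₗ[ℂ] B where
  toFun a := act ψ (i a) e
  map_add' a b := by rw [map_add, ← actHom_apply, map_add]; rfl
  map_smul' c a := by rw [map_smul, ← actHom_apply, map_smul]; rfl

theorem isClosed_isNuclear_actMap : IsClosed {e : rightIdeal ψ | IsNuclear (actMap ψ i e)} := by
  refine isClosed_isNuclear (actMap ψ i) (fun e => (e : B)) continuous_subtype_val (fun a => ?_) ?_
  · exact continuous_subtype_val.comp (actHom ψ (i a)).continuous
  · intro e x y
    show star (act ψ (i x) e : B) * act ψ (i y) e = star (e : B) * act ψ (i (star x * y)) e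
    rw [star_act_mul, map_mul, map_star, ← actHom_apply ψ (star (i x) * i y), map_mul]
    rfl

/-- On a generator `ψ(y)b` the map is `x ↦ ψ(i(x)y)` followed by right multiplication by `b`.
Linearity and closedness extend this to all of `ψ(I)B`. -/
theorem isNuclear_actMap (h : ∀ y : I, IsNuclear (toLin ψ ∘ₗ mulRight I i y))
    (e : rightIdeal ψ) : IsNuclear (actMap ψ i e) := by
  have hspan : ∀ x ∈ Submodule.span ℂ {x : B | ∃ (y : I) (b : B), x = ψ y * b},
      ∀ hx : x ∈ rightIdeal ψ, IsNuclear (actMap ψ i ⟨x, hx⟩) := by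
    intro x hx
    induction hx using Submodule.span_induction with
    | mem x hx =>
      obtain ⟨y, b, rfl⟩ := hx
      intro hx
      convert! (h y).mul_right b using 1
      ext a
      exact congrArg Subtype.val (act_gen ψ (i a) y b)
    | zero =>
      intro hx
      convert! isNuclear_zero using 1
      ext a
      exact congrArg Subtype.val (map_zero (actHom ψ (i a)))
    | add x y hx' hy' hx hy =>
      intro hxy
      have h1 := Submodule.le_topologicalClosure _ hx'
      have h2 := Submodule.le_topologicalClosure _ hy'
      convert! (hx h1).add (hy h2) using 1
      ext a
      exact congrArg Subtype.val (map_add (actHom ψ (i a)) ⟨x, h1⟩ ⟨y, h2⟩)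
    | smul c x hx' hx =>
      intro hcx
      have h1 := Submodule.le_topologicalClosure _ hx'
      convert! (hx h1).smul c using 1
      ext a
      exact congrArg Subtype.val (map_smul (actHom ψ (i a)) c ⟨x, h1⟩)
  have hd : e ∈ closure {e : rightIdeal ψ |
      (e : B) ∈ Submodule.span ℂ {x : B | ∃ (y : I) (b : B), x = ψ y * b}} := by
    rw [closure_subtype]
    refine closure_mono ?_ e.2
    exact fun x hx => ⟨⟨x, Submodule.le_topologicalClosure _ hx⟩, hx, rfl⟩
  exact closure_minimal (fun (e : rightIdeal ψ) he => hspan e he e.2) (isClosed_isNuclear_actMap ψ i) hd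

/-- The linear map `a ↦ i(a) · h` from `A` to the hereditary subalgebra `H`, for `h ∈ H`. -/
def hereditaryMap (h : hereditary ψ) : A →ₗ[ℂ] hereditary ψ where
  toFun a := leftAct ψ (i a) h
  map_add' a b := by rw [map_add, leftAct_add]; rfl
  map_smul' c a := by rw [map_smul, leftAct_smul]; rfl

theorem coe_hereditaryMap (h : hereditary ψ) (a : A) :
    (hereditaryMap ψ i h a : B) = act ψ (i a) ⟨h, hereditary_le ψ h.2⟩ := rfl

theorem hereditaryMap_zero : hereditaryMap ψ i 0 = 0 :=
  LinearMap.ext fun a => map_zero (leftAct ψ (i a))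

theorem hereditaryMap_add (h k : hereditary ψ) :
    hereditaryMap ψ i (h + k) = hereditaryMap ψ i h + hereditaryMap ψ i k :=
  LinearMap.ext fun a => map_add (leftAct ψ (i a)) h k

theorem hereditaryMap_smul (c : ℂ) (h : hereditary ψ) :
    hereditaryMap ψ i (c • h) = c • hereditaryMap ψ i h :=
  LinearMap.ext fun a => map_smul (leftAct ψ (i a)) c h

theorem hereditaryMap_mul (h k : hereditary ψ) :
    hereditaryMap ψ i (h * k) = LinearMap.mulRight ℂ k ∘ₗ hereditaryMap ψ i h :=
  LinearMap.ext fun a => Subtype.ext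
    (act_mul_right ψ (i a) ⟨h, hereditary_le ψ h.2⟩ k _)

theorem hereditaryMap_star_mul (h : hereditary ψ) (x y : A) :
    star (hereditaryMap ψ i h x) * hereditaryMap ψ i h y =
      star h * hereditaryMap ψ i h (star x * y) := by
  refine Subtype.ext ?_
  show star (act ψ (i x) ⟨h, hereditary_le ψ h.2⟩ : B) * act ψ (i y) ⟨h, hereditary_le ψ h.2⟩ =
    star (h : B) * act ψ (i (star x * y)) ⟨h, hereditary_le ψ h.2⟩
  rw [star_act_mul, map_mul, map_star, ← actHom_apply ψ (star (i x) * i y), map_mul]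
  rfl

theorem isClosed_isNuclear_hereditaryMap :
    IsClosed {h : hereditary ψ | IsNuclear (hereditaryMap ψ i h)} :=
  isClosed_isNuclear (hereditaryMap ψ i) id continuous_id (fun a => (leftAct ψ (i a)).continuous)
    (hereditaryMap_star_mul ψ i)

/-- Nuclearity into `B` has to be upgraded to nuclearity into `H`. For `g = ψ(y)bψ(y')`, the map `a
↦ g* (i(a) · g)` is the compression by `ψ(y')` of the nuclear map `a ↦ b* ψ(y)* ψ(i(a)y) b` to `B`;
the square root trick inside `H` then removes the factor `g*`. -/
theorem isNuclear_hereditaryMap_gen (y : I) (h : IsNuclear (toLin ψ ∘ₗ mulRight I i y)) (b : B)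
    (y' : I) : IsNuclear (hereditaryMap ψ i ⟨_, gen_mem_hereditary ψ y b y'⟩) := by
  set g : hereditary ψ := ⟨_, gen_mem_hereditary ψ y b y'⟩ with hg
  let M : A →ₗ[ℂ] hereditary ψ := LinearMap.mulLeft ℂ (star g) ∘ₗ hereditaryMap ψ i g
  refine IsNuclear.of_star_mul (M := M) (hereditaryMap_star_mul ψ i g) ?_
  obtain ⟨K, hK⟩ := isNuclear_iff.mp ((h.mul_left (star b * star (ψ y))).mul_right b)
  refine isNuclear_iff.mpr ⟨_, hK.compress ⟨ψ y', hom_mem_hereditary ψ y'⟩ (fun c => ?_)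
    (ρ' := M) fun x => ?_⟩
  · show star (ψ y') * c * ψ y' ∈ hereditary ψ
    rw [← map_star]
    exact gen_mem_hereditary ψ _ c y'
  · have h1 : (hereditaryMap ψ i g x : B) = ψ (I.lmul (i x) y) * (b * ψ y') := by
      rw [coe_hereditaryMap]
      refine Eq.trans ?_ (congrArg Subtype.val (act_gen ψ (i x) y (b * ψ y')))
      congr 2
      exact Subtype.ext (mul_assoc _ _ _)
    show star (ψ y * b * ψ y') * (hereditaryMap ψ i g x : B) =
      star (ψ y') * (star b * star (ψ y) * ψ (I.lmul (i x) y) * b) * ψ y'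
    rw [h1]
    simp only [star_mul, mul_assoc]

theorem isNuclear_hereditaryMap (h : ∀ y : I, IsNuclear (toLin ψ ∘ₗ mulRight I i y))
    (g : hereditary ψ) : IsNuclear (hereditaryMap ψ i g) := by
  set G := {x : B | ∃ (y : I) (b : B) (y' : I), x = ψ y * b * ψ y'}
  have hle : ∀ {x}, x ∈ NonUnitalStarAlgebra.adjoin ℂ G → x ∈ hereditary ψ := fun hx =>
    NonUnitalStarSubalgebra.le_topologicalClosure _ hx
  -- The adjoint is carried along because nuclearity of the map of `t` does not directly give that
  -- of `star t`; for generators it holds as the adjoint of a generator is a generator.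
  have hadj : ∀ x ∈ NonUnitalStarAlgebra.adjoin ℂ G, ∃ t : hereditary ψ, (t : B) = x ∧
      IsNuclear (hereditaryMap ψ i t) ∧ IsNuclear (hereditaryMap ψ i (star t)) := by
    intro x hx
    induction hx using NonUnitalStarAlgebra.adjoin_induction with
    | mem x hx =>
      obtain ⟨y, b, y', rfl⟩ := hx
      refine ⟨_, rfl, isNuclear_hereditaryMap_gen ψ i y (h y) b y', ?_⟩
      have h1 := isNuclear_hereditaryMap_gen ψ i (star y') (h _) (star b) (star y)
      have h2 : star (⟨_, gen_mem_hereditary ψ y b y'⟩ : hereditary ψ) =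
          ⟨_, gen_mem_hereditary ψ (star y') (star b) (star y)⟩ := by
        refine Subtype.ext ?_
        show star (ψ y * b * ψ y') = ψ (star y') * star b * ψ (star y)
        simp only [star_mul, map_star, mul_assoc]
      rwa [h2]
    | add x y _ _ hx hy =>
      obtain ⟨s, rfl, h1, h2⟩ := hx
      obtain ⟨t, rfl, h3, h4⟩ := hy
      refine ⟨s + t, rfl, ?_, ?_⟩
      · rw [hereditaryMap_add]; exact h1.add h3
      · rw [star_add, hereditaryMap_add]; exact h2.add h4
    | zero =>
      refine ⟨0, rfl, ?_⟩
      rw [star_zero, hereditaryMap_zero]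
      exact ⟨isNuclear_zero, isNuclear_zero⟩
    | mul x y _ _ hx hy =>
      obtain ⟨s, rfl, h1, h2⟩ := hx
      obtain ⟨t, rfl, h3, h4⟩ := hy
      refine ⟨s * t, rfl, ?_, ?_⟩
      · rw [hereditaryMap_mul]; exact h1.mul_right t
      · rw [star_mul, hereditaryMap_mul]; exact h4.mul_right (star s)
    | smul c x _ hx =>
      obtain ⟨s, rfl, h1, h2⟩ := hx
      refine ⟨c • s, rfl, ?_, ?_⟩
      · rw [hereditaryMap_smul]; exact h1.smul c
      · rw [star_smul, hereditaryMap_smul]; exact h2.smul (star c)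
    | star x _ hx =>
      obtain ⟨s, rfl, h1, h2⟩ := hx
      refine ⟨star s, rfl, h2, ?_⟩
      have h3 : star (star s) = s := Subtype.ext (star_star (s : B))
      rw [h3]
      exact h1
  have hd : g ∈ closure {g : hereditary ψ | (g : B) ∈ NonUnitalStarAlgebra.adjoin ℂ G} := by
    rw [closure_subtype]
    refine closure_mono ?_ g.2
    exact fun x hx => ⟨⟨x, hle hx⟩, hx, rfl⟩
  refine closure_minimal (fun x hx => ?_) (isClosed_isNuclear_hereditaryMap ψ i) hd
  obtain ⟨t, ht, h1, -⟩ := hadj x hx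
  rwa [Subtype.ext ht] at h1

/-- A C*-algebra is isomorphic to its image in the multiplier algebra. -/
def multiplierEquiv (C : Type u) [NonUnitalCStarAlgebra C] : C ≃⋆ₐ[ℂ] multiplierIdeal C :=
  StarAlgEquiv.ofBijective
    (NonUnitalStarAlgHom.codRestrict (DoubleCentralizer.coeHom : C →⋆ₙₐ[ℂ] 𝓜(ℂ, C))
      (multiplierIdeal C).toNonUnitalStarSubalgebra fun c => ⟨c, rfl⟩) (by
    constructor
    · rw [injective_iff_map_eq_zero]
      intro c hc
      have h : (c : C) * star c = 0 :=
        DFunLike.congr_fun (congrArg (fun m : 𝓜(ℂ, C) => m.fst) (congrArg Subtype.val hc)) (star c)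
      exact CStarRing.mul_star_self_eq_zero_iff c |>.mp h
    · rintro ⟨_, c, rfl⟩
      exact ⟨c, rfl⟩)

theorem mulRight_multiplierEquiv (h : hereditary ψ) (a : A) :
    mulRight (multiplierIdeal (hereditary ψ)) ((canonicalExt ψ).comp i)
      (multiplierEquiv _ h) a = multiplierEquiv _ (hereditaryMap ψ i h a) := by
  refine Subtype.ext (ext_fst_snd ψ ?_ ?_)
  · refine ContinuousLinearMap.ext fun k => Subtype.ext ?_
    exact act_mul_right ψ (i a) ⟨h, hereditary_le ψ h.2⟩ k _
  · refine ContinuousLinearMap.ext fun k => ?_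
    exact (canonicalExt ψ (i a)).central k h

/-- The ideal in the multiplier algebra is an isomorphic copy of `H`, under which `x ↦ ψ°(i(x))h`
corresponds to `hereditaryMap`. -/
theorem isWeaklyNuclear_canonicalExt (hn : ∀ h, IsNuclear (hereditaryMap ψ i h)) :
    IsWeaklyNuclear (multiplierIdeal (hereditary ψ)) ((canonicalExt ψ).comp i) := by
  intro b
  obtain ⟨h, rfl⟩ := EquivLike.surjective (multiplierEquiv (hereditary ψ)) b
  have h1 : mulRight _ ((canonicalExt ψ).comp i) (multiplierEquiv _ h) =
      toLin ((multiplierEquiv (hereditary ψ)) :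
        hereditary ψ →⋆ₙₐ[ℂ] multiplierIdeal (hereditary ψ)) ∘ₗ hereditaryMap ψ i h :=
    LinearMap.ext fun a => mulRight_multiplierEquiv ψ i h a
  rw [h1]
  exact IsNuclear.hom_comp (hn h) _

/-- This places the differences `ψ°(ι(x)) - ψ°(ῑ(x))` in the ideal `H` and shows that the canonical
prequasihomomorphism induces `ψ`. -/
theorem canonicalExt_coe (y : I) :
    canonicalExt ψ (y : R) = ((⟨ψ y, hom_mem_hereditary ψ y⟩ : hereditary ψ) :
      𝓜(ℂ, hereditary ψ)) := by
  refine ext_fst_snd ψ ?_ ?_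
  · exact ContinuousLinearMap.ext fun h => Subtype.ext (canonicalExt_fst ψ y h)
  · refine ContinuousLinearMap.ext fun h => Subtype.ext ?_
    show star (act ψ ((star y : I) : R) ⟨star (h : B), hereditary_le ψ (star_mem h.2)⟩ : B) =
      (h : B) * ψ y
    rw [act_mem, star_mul, map_star, star_star, star_star]

end Extension

end QNuc
end

noncomputable section

namespace QNuc

/-! ### Generation of `qA` and the equivalences for prequasihomomorphisms -/

section FreeProduct

variable {A B : Type u} [NonUnitalCStarAlgebra A] [NonUnitalCStarAlgebra B]

section lmul

variable {R : Type u} [NonUnitalCStarAlgebra R] (I : ClosedIdeal R)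

theorem ClosedIdeal.lmul_zero_left (w : I) : I.lmul 0 w = 0 := Subtype.ext (zero_mul _)

theorem ClosedIdeal.lmul_add_left (x y : R) (w : I) :
    I.lmul (x + y) w = I.lmul x w + I.lmul y w := Subtype.ext (add_mul _ _ _)

theorem ClosedIdeal.lmul_smul_left (c : ℂ) (x : R) (w : I) :
    I.lmul (c • x) w = c • I.lmul x w := Subtype.ext (smul_mul_assoc _ _ _)

theorem ClosedIdeal.lmul_mul_left (x y : R) (w : I) :
    I.lmul (x * y) w = I.lmul x (I.lmul y w) := Subtype.ext (mul_assoc _ _ _)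

theorem ClosedIdeal.lmul_sub_right (x : R) (v w : I) :
    I.lmul x (v - w) = I.lmul x v - I.lmul x w := Subtype.ext (mul_sub _ _ _)

theorem ClosedIdeal.continuous_lmul_left (w : I) : Continuous fun x => I.lmul x w :=
  Continuous.subtype_mk (continuous_id.mul continuous_const) _

variable {I}

/-- Suppose that `R` is generated by the images of `i, j : A → R` and that `f : R → A` is a left
inverse of both. A closed subspace `N` of the ideal `I` that contains `(i(a) - j(a))w` for `a ∈ A` and
`w ∈ I` and is invariant under left multiplication by `i(A)` contains `(z - i(f(z)))w` for
`z ∈ R`. -/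
theorem lmul_sub_lmul_mem {i j : A →⋆ₙₐ[ℂ] R} (hij : (NonUnitalStarAlgebra.adjoin ℂ
      (Set.range i ∪ Set.range j)).topologicalClosure = ⊤) {f : R →⋆ₙₐ[ℂ] A}
    (hi : ∀ a, f (i a) = a) (hj : ∀ a, f (j a) = a) (N : Submodule ℂ I)
    (hcl : IsClosed (N : Set I)) (hN : ∀ a w, I.lmul (i a) w - I.lmul (j a) w ∈ N)
    (hiN : ∀ a, ∀ w ∈ N, I.lmul (i a) w ∈ N) (z : R) :
    ∀ w, I.lmul z w - I.lmul (i (f z)) w ∈ N := by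
  let p : R → Prop := fun z => ∀ w, I.lmul z w - I.lmul (i (f z)) w ∈ N
  have hpcl : IsClosed {z | p z} := by
    have : {z | p z} = ⋂ w : I, {z | I.lmul z w - I.lmul (i (f z)) w ∈ N} := by
      ext z; simp [p]
    rw [this]
    exact isClosed_iInter fun w => hcl.preimage ((I.continuous_lmul_left w).sub
      ((I.continuous_lmul_left w).comp ((hom_continuous i).comp (hom_continuous f))))
  have hpi : ∀ a, p (i a) := fun a w => by rw [hi, sub_self]; exact zero_mem N
  have hpj : ∀ a, p (j a) := fun a w => by rw [hj, ← neg_sub]; exact neg_mem (hN a w)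
  have hadd : ∀ {x y}, p x → p y → p (x + y) := fun {x y} hx hy w => by
    rw [map_add, map_add, I.lmul_add_left, I.lmul_add_left, add_sub_add_comm]
    exact add_mem (hx w) (hy w)
  have hmul : ∀ {x y}, p x → p y → p (x * y) := fun {x y} hx hy w => by
    -- With `g = i ∘ f`, this is `(xy - g(xy))w = (x - g(x))(yw) + g(x)(y - g(y))w`; the second
    -- summand needs the invariance of `N` under `i(A)`.
    have h1 := add_mem (hx (I.lmul y w)) (hiN (f x) _ (hy w))
    rwa [I.lmul_sub_right, sub_add_sub_cancel, ← I.lmul_mul_left, ← I.lmul_mul_left, ← map_mul,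
      ← map_mul] at h1
  have hsmul : ∀ {x} (c : ℂ), p x → p (c • x) := fun {x} c hx w => by
    rw [map_smul, map_smul, I.lmul_smul_left, I.lmul_smul_left, ← smul_sub]
    exact N.smul_mem c (hx w)
  have hz : z ∈ (NonUnitalStarAlgebra.adjoin ℂ (Set.range i ∪ Set.range j)).topologicalClosure := by
    rw [hij]; exact NonUnitalStarAlgebra.mem_top
  refine closure_minimal (fun x hx => ?_) hpcl hz
  -- The property `p` concerns left multiplication and is not visibly stable under adjoints, so both
  -- are proved together.
  suffices p x ∧ p (star x) from this.1
  induction hx using NonUnitalStarAlgebra.adjoin_induction with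
  | mem x hx =>
    rcases hx with ⟨a, rfl⟩ | ⟨a, rfl⟩
    · exact ⟨hpi a, by rw [← map_star]; exact hpi _⟩
    · exact ⟨hpj a, by rw [← map_star]; exact hpj _⟩
  | add x y _ _ hx hy => exact ⟨hadd hx.1 hy.1, by rw [star_add]; exact hadd hx.2 hy.2⟩
  | zero =>
    have h0 := hpi 0
    rw [map_zero] at h0
    exact ⟨h0, by rwa [star_zero]⟩
  | mul x y _ _ hx hy => exact ⟨hmul hx.1 hy.1, by rw [star_mul]; exact hmul hy.2 hx.2⟩
  | smul c x _ hx => exact ⟨hsmul c hx.1, by rw [star_smul]; exact hsmul _ hx.2⟩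
  | star x _ hx => exact ⟨hx.2, by rw [star_star]; exact hx.1⟩

end lmul

/-- A closed subspace of `qA` that contains `q(a)w` for `a ∈ A` and `w ∈ qA` and is invariant under
left multiplication by `ι(A)` is all of `qA`. -/
theorem mem_of_q_mul_mem (N : Submodule ℂ (qIdeal A)) (hcl : IsClosed (N : Set (qIdeal A)))
    (hq : ∀ (a : A) (w : qIdeal A), q a * w ∈ N)
    (hι : ∀ (a : A), ∀ w ∈ N, (qIdeal A).lmul (iota a) w ∈ N) (y : qIdeal A) : y ∈ N := by
  obtain ⟨l, hl, -, -, hu⟩ := exists_approxUnit (qIdeal A)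
  refine hcl.mem_of_tendsto (hu y) (Filter.Eventually.of_forall fun u => ?_)
  have h1 := lmul_sub_lmul_mem (I := qIdeal A)
    (f := Q.lift (NonUnitalStarAlgHom.id ℂ A) (NonUnitalStarAlgHom.id ℂ A)) Q.closure_adjoin
    (fun a => Q.lift_iota _ _ a) (fun a => Q.lift_iotaBar _ _ a) N hcl (fun a w => ?_) hι y u
  -- For `y` in `qA` the comparison term `ι(f(y))u` vanishes, which leaves `yu ∈ N`.
  · rw [mem_kernel.mp y.2, map_zero, ClosedIdeal.lmul_zero_left, sub_zero] at h1
    exact h1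
  · have h2 : (qIdeal A).lmul (iota a) w - (qIdeal A).lmul (iotaBar a) w = q a * w :=
      Subtype.ext (sub_mul _ _ _).symm
    rw [h2]
    exact hq a w

variable (ψ : qIdeal A →⋆ₙₐ[ℂ] B)

/-- Multiplication in the first variable: `x ↦ ψ(i(x) y)` depends linearly on `y`. -/
theorem homMul_add {R : Type u} [NonUnitalCStarAlgebra R] {I : ClosedIdeal R} (ψ : I →⋆ₙₐ[ℂ] B)
    (i : A →⋆ₙₐ[ℂ] R) (y z : I) : toLin ψ ∘ₗ mulRight I i (y + z) =
      toLin ψ ∘ₗ mulRight I i y + toLin ψ ∘ₗ mulRight I i z := by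
  ext x
  show ψ (I.lmul (i x) (y + z)) = ψ (I.lmul (i x) y) + ψ (I.lmul (i x) z)
  rw [← map_add]
  exact congrArg ψ (Subtype.ext (mul_add _ _ _))

theorem homMul_smul {R : Type u} [NonUnitalCStarAlgebra R] {I : ClosedIdeal R} (ψ : I →⋆ₙₐ[ℂ] B)
    (i : A →⋆ₙₐ[ℂ] R) (c : ℂ) (y : I) : toLin ψ ∘ₗ mulRight I i (c • y) =
      c • (toLin ψ ∘ₗ mulRight I i y) := by
  ext x
  show ψ (I.lmul (i x) (c • y)) = c • ψ (I.lmul (i x) y)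
  rw [← map_smul]
  exact congrArg ψ (Subtype.ext (mul_smul_comm _ _ _))

/-- The elements `y` of `qA` for which `x ↦ ψ(ι(x)y)` and `x ↦ ψ(ῑ(x)y)` are nuclear. -/
def nuclearSubmodule : Submodule ℂ (qIdeal A) where
  carrier := {y | IsNuclear (toLin ψ ∘ₗ mulRight (qIdeal A) iota y) ∧
    IsNuclear (toLin ψ ∘ₗ mulRight (qIdeal A) iotaBar y)}
  zero_mem' := by
    have h : ∀ i : A →⋆ₙₐ[ℂ] Q A, IsNuclear (toLin ψ ∘ₗ mulRight (qIdeal A) i 0) := fun i => by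
      have h1 := homMul_smul ψ i 0 0
      rw [zero_smul, zero_smul] at h1
      rw [h1]
      exact isNuclear_zero
    exact ⟨h _, h _⟩
  add_mem' {y z} hy hz := by
    simp only [Set.mem_ofPred_eq, homMul_add]
    exact ⟨hy.1.add hz.1, hy.2.add hz.2⟩
  smul_mem' c y hy := by
    simp only [Set.mem_ofPred_eq, homMul_smul]
    exact ⟨hy.1.smul c, hy.2.smul c⟩

/-- By `ι(x)q(a) = q(xa) - q(x)ῑ(a)`, the variable `x` occurs only inside `q`, up to multiplication
by fixed elements. -/
theorem isNuclear_homMul_iota_q_mul (h : IsNuclear (toLin ψ ∘ₗ q)) (a : A) (w : qIdeal A) :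
    IsNuclear (toLin ψ ∘ₗ mulRight (qIdeal A) iota (q a * w)) := by
  have h1 : toLin ψ ∘ₗ mulRight (qIdeal A) iota (q a * w) =
      LinearMap.mulRight ℂ (ψ w) ∘ₗ ((toLin ψ ∘ₗ q) ∘ₗ LinearMap.mulRight ℂ a) -
        LinearMap.mulRight ℂ (ψ ((qIdeal A).lmul (iotaBar a) w)) ∘ₗ (toLin ψ ∘ₗ q) := by
    ext x
    show ψ ((qIdeal A).lmul (iota x) (q a * w)) =
      ψ (q (x * a)) * ψ w - ψ (q x) * ψ ((qIdeal A).lmul (iotaBar a) w)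
    rw [← map_mul, ← map_mul, ← map_sub]
    refine congrArg ψ (Subtype.ext ?_)
    show iota x * ((iota a - iotaBar a) * (w : Q A)) =
      (iota (x * a) - iotaBar (x * a)) * (w : Q A) - (iota x - iotaBar x) * (iotaBar a * (w : Q A))
    rw [map_mul, map_mul]
    simp only [sub_mul, mul_sub, mul_assoc]
    abel
  rw [h1]
  exact ((h.comp_mulRight a).mul_right _).sub (h.mul_right _)

/-- The companion identity is `ῑ(x)q(a) = q(xa) - q(x)ι(a)`. -/
theorem isNuclear_homMul_iotaBar_q_mul (h : IsNuclear (toLin ψ ∘ₗ q)) (a : A) (w : qIdeal A) :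
    IsNuclear (toLin ψ ∘ₗ mulRight (qIdeal A) iotaBar (q a * w)) := by
  have h1 : toLin ψ ∘ₗ mulRight (qIdeal A) iotaBar (q a * w) =
      LinearMap.mulRight ℂ (ψ w) ∘ₗ ((toLin ψ ∘ₗ q) ∘ₗ LinearMap.mulRight ℂ a) -
        LinearMap.mulRight ℂ (ψ ((qIdeal A).lmul (iota a) w)) ∘ₗ (toLin ψ ∘ₗ q) := by
    ext x
    show ψ ((qIdeal A).lmul (iotaBar x) (q a * w)) =
      ψ (q (x * a)) * ψ w - ψ (q x) * ψ ((qIdeal A).lmul (iota a) w)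
    rw [← map_mul, ← map_mul, ← map_sub]
    refine congrArg ψ (Subtype.ext ?_)
    show iotaBar x * ((iota a - iotaBar a) * (w : Q A)) =
      (iota (x * a) - iotaBar (x * a)) * (w : Q A) - (iota x - iotaBar x) * (iota a * (w : Q A))
    rw [map_mul, map_mul]
    simp only [sub_mul, mul_sub, mul_assoc]
    abel
  rw [h1]
  exact ((h.comp_mulRight a).mul_right _).sub (h.mul_right _)

theorem isNuclear_homMul_of_isNuclear_q (h : IsNuclear (toLin ψ ∘ₗ q)) (y : qIdeal A) :
    IsNuclear (toLin ψ ∘ₗ mulRight (qIdeal A) iota y) ∧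
      IsNuclear (toLin ψ ∘ₗ mulRight (qIdeal A) iotaBar y) := by
  have hcl : IsClosed (nuclearSubmodule ψ : Set (qIdeal A)) :=
    (isClosed_isNuclear_homMul ψ iota).inter (isClosed_isNuclear_homMul ψ iotaBar)
  refine mem_of_q_mul_mem (nuclearSubmodule ψ) hcl (fun a w =>
    ⟨isNuclear_homMul_iota_q_mul ψ h a w, isNuclear_homMul_iotaBar_q_mul ψ h a w⟩) ?_ y
  intro a w hw
  constructor
  · have h1 : toLin ψ ∘ₗ mulRight (qIdeal A) iota ((qIdeal A).lmul (iota a) w) =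
        (toLin ψ ∘ₗ mulRight (qIdeal A) iota w) ∘ₗ LinearMap.mulRight ℂ a := by
      ext x
      refine congrArg ψ (Subtype.ext ?_)
      show iota x * (iota a * (w : Q A)) = iota (x * a) * (w : Q A)
      rw [map_mul, mul_assoc]
    rw [h1]
    exact hw.1.comp_mulRight a
  -- For `ῑ` the invariance is not immediate, since `ῑ(x)ι(a)` is not of the form `ῑ(xa)`; the
  -- defect is `ῑ(x)q(a)`, already known to be harmless.
  · have h1 : toLin ψ ∘ₗ mulRight (qIdeal A) iotaBar ((qIdeal A).lmul (iota a) w) =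
        toLin ψ ∘ₗ mulRight (qIdeal A) iotaBar (q a * w) +
          (toLin ψ ∘ₗ mulRight (qIdeal A) iotaBar w) ∘ₗ LinearMap.mulRight ℂ a := by
      ext x
      show ψ ((qIdeal A).lmul (iotaBar x) ((qIdeal A).lmul (iota a) w)) =
        ψ ((qIdeal A).lmul (iotaBar x) (q a * w)) + ψ ((qIdeal A).lmul (iotaBar (x * a)) w)
      rw [← map_add]
      refine congrArg ψ (Subtype.ext ?_)
      show iotaBar x * (iota a * (w : Q A)) =
        iotaBar x * ((iota a - iotaBar a) * (w : Q A)) + iotaBar (x * a) * (w : Q A)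
      rw [map_mul]
      simp only [sub_mul, mul_sub, mul_assoc]
      abel
    rw [h1]
    exact (isNuclear_homMul_iotaBar_q_mul ψ h a w).add (hw.2.comp_mulRight a)

theorem isNuclear_q_of_isNuclear_homMul
    (h : ∀ y : qIdeal A, IsNuclear (toLin ψ ∘ₗ mulRight (qIdeal A) iota y) ∧
      IsNuclear (toLin ψ ∘ₗ mulRight (qIdeal A) iotaBar y)) : IsNuclear (toLin ψ ∘ₗ q) := by
  obtain ⟨l, hl, hu, -, hl'⟩ := exists_approxUnit (qIdeal A)
  -- Each of the two maps has nuclear norm at most `‖ψ(u)‖ ≤ 1`, whence the bound `1 + 1`. This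
  -- uniformity in `u` is what lets the limit along the approximate unit be nuclear.
  refine isNuclear_iff.mpr ⟨1 + 1, NuclearBound.of_tendsto (l := l) (ρ := fun u =>
    toLin ψ ∘ₗ mulRight (qIdeal A) iota u - toLin ψ ∘ₗ mulRight (qIdeal A) iotaBar u) ?_ ?_⟩
  · filter_upwards [hu] with u hu
    have hb : ‖ψ u‖₊ ≤ 1 := (NonUnitalStarAlgHom.norm_apply_le ψ u).trans hu
    exact (((h u).1.nuclearBound_of_star_mul _ (homMul_star_mul ψ iota u)).mono hb).sub
      (((h u).2.nuclearBound_of_star_mul _ (homMul_star_mul ψ iotaBar u)).mono hb)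
  · intro a
    refine (((hom_continuous ψ).tendsto (q a)).comp (hl' (q a))).congr fun u => ?_
    show ψ (q a * u) = ψ ((qIdeal A).lmul (iota a) u) - ψ ((qIdeal A).lmul (iotaBar a) u)
    rw [← map_sub]
    exact congrArg ψ (Subtype.ext (sub_mul _ _ _))

/-- The image `b` of `y` lies in `J`, and `x ↦ ψ(ι(x)y)` is `x ↦ φ(x)b` followed by the homomorphism
`μ`; likewise for the other copy. -/
theorem isNuclear_homMul_of_prequasihom {E : Type u} [NonUnitalCStarAlgebra E] {J : ClosedIdeal E}
    (P : Prequasihom A B E J) (h : IsWeaklyNuclear J P.φ) (h' : IsWeaklyNuclear J P.φbar)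
    (y : qIdeal A) : IsNuclear (toLin P.hom ∘ₗ mulRight (qIdeal A) iota y) ∧
      IsNuclear (toLin P.hom ∘ₗ mulRight (qIdeal A) iotaBar y) := by
  let b : J := ⟨Q.lift P.φ P.φbar y, lift_mem J P.φ P.φbar P.sub_mem y⟩
  have h1 : toLin P.hom ∘ₗ mulRight (qIdeal A) iota y = toLin P.μ ∘ₗ mulRight J P.φ b := by
    ext x
    refine congrArg P.μ (Subtype.ext ?_)
    show Q.lift P.φ P.φbar (iota x * y) = P.φ x * Q.lift P.φ P.φbar y
    rw [map_mul, Q.lift_iota]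
  have h2 : toLin P.hom ∘ₗ mulRight (qIdeal A) iotaBar y = toLin P.μ ∘ₗ mulRight J P.φbar b := by
    ext x
    refine congrArg P.μ (Subtype.ext ?_)
    show Q.lift P.φ P.φbar (iotaBar x * y) = P.φbar x * Q.lift P.φ P.φbar y
    rw [map_mul, Q.lift_iotaBar]
  rw [h1, h2]
  exact ⟨(h b).hom_comp P.μ, (h' b).hom_comp P.μ⟩

/-- The prequasihomomorphism `(ψ°ι, ψ°ῑ) : A ⇉ M(H) ▷ H → B`. -/
def canonicalPrequasihom :
    Prequasihom A B 𝓜(ℂ, hereditary ψ) (multiplierIdeal (hereditary ψ)) where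
  φ := (canonicalExt ψ).comp iota
  φbar := (canonicalExt ψ).comp iotaBar
  sub_mem x := by
    show canonicalExt ψ (iota x) - canonicalExt ψ (iotaBar x) ∈ _
    rw [← map_sub]
    exact ⟨_, (canonicalExt_coe ψ (q x)).symm⟩
  μ := (NonUnitalStarSubalgebraClass.subtype (hereditary ψ)).comp
    ((multiplierEquiv (hereditary ψ)).symm : multiplierIdeal (hereditary ψ) →⋆ₙₐ[ℂ] hereditary ψ)

theorem canonicalPrequasihom_μ_apply (h : hereditary ψ) :
    (canonicalPrequasihom ψ).μ (multiplierEquiv _ h) = h :=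
  congrArg Subtype.val ((multiplierEquiv (hereditary ψ)).symm_apply_apply h)

theorem canonicalPrequasihom_injective : Function.Injective (canonicalPrequasihom ψ).μ := by
  intro x y hxy
  exact EquivLike.injective (multiplierEquiv (hereditary ψ)).symm (Subtype.val_injective hxy)

theorem canonicalPrequasihom_hom : (canonicalPrequasihom ψ).hom = ψ := by
  -- Uniqueness in the universal property of `QA`.
  have h1 : Q.lift ((canonicalExt ψ).comp iota) ((canonicalExt ψ).comp iotaBar) =
      canonicalExt ψ :=
    ((Q.existsUnique_lift _ _).choose_spec.2 (canonicalExt ψ) ⟨rfl, rfl⟩).symm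
  refine DFunLike.ext _ _ fun y => ?_
  have h2 : (⟨Q.lift ((canonicalExt ψ).comp iota) ((canonicalExt ψ).comp iotaBar) y,
      lift_mem _ _ _ (canonicalPrequasihom ψ).sub_mem y⟩ : multiplierIdeal (hereditary ψ)) =
      multiplierEquiv _ ⟨ψ y, hom_mem_hereditary ψ y⟩ :=
    Subtype.ext ((DFunLike.congr_fun h1 (y : Q A)).trans (canonicalExt_coe ψ y))
  exact (congrArg (canonicalPrequasihom ψ).μ h2).trans (canonicalPrequasihom_μ_apply ψ _)

end FreeProduct

/-! ### Nuclearity in the sense of Skandalis -/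

section Kasparov

variable {A B : Type u} [NonUnitalCStarAlgebra A] [NonUnitalCStarAlgebra B]
  [PartialOrder B] [StarOrderedRing B] (ψ : qIdeal A →⋆ₙₐ[ℂ] B)

theorem coefficient_kasparovModule (ξ : DoubleModule ψ) :
    (kasparovModule ψ).coefficient ξ =
      LinearMap.mulLeft ℂ (star (ξ.1 : B)) ∘ₗ actMap ψ iota ξ.1 +
        LinearMap.mulLeft ℂ (star (ξ.2 : B)) ∘ₗ actMap ψ iotaBar ξ.2 := rfl

theorem isNuclear_kasparovModule
    (h : ∀ y : qIdeal A, IsNuclear (toLin ψ ∘ₗ mulRight (qIdeal A) iota y) ∧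
      IsNuclear (toLin ψ ∘ₗ mulRight (qIdeal A) iotaBar y)) : (kasparovModule ψ).IsNuclear := by
  intro ξ
  rw [coefficient_kasparovModule]
  exact ((isNuclear_actMap ψ iota (fun y => (h y).1) ξ.1).mul_left _).add
    ((isNuclear_actMap ψ iotaBar (fun y => (h y).2) ξ.2).mul_left _)

/-- The coefficient of the vector with one entry `ψ(y)` and the other zero is `a ↦ ψ(y)* ψ(i(a)y)`,
and the square root trick removes the factor `ψ(y)*`. -/
theorem isNuclear_homMul_of_kasparovModule (h : (kasparovModule ψ).IsNuclear) (y : qIdeal A) :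
    IsNuclear (toLin ψ ∘ₗ mulRight (qIdeal A) iota y) ∧
      IsNuclear (toLin ψ ∘ₗ mulRight (qIdeal A) iotaBar y) := by
  have hy := hom_mem_rightIdeal ψ y
  constructor
  · refine IsNuclear.of_star_mul (homMul_star_mul ψ iota y)
      (M := LinearMap.mulLeft ℂ (star (ψ y)) ∘ₗ (toLin ψ ∘ₗ mulRight (qIdeal A) iota y)) ?_
    have h1 := h (pair ψ ⟨ψ y, hy⟩ 0)
    have h2 : (kasparovModule ψ).coefficient (pair ψ ⟨ψ y, hy⟩ 0) =
        LinearMap.mulLeft ℂ (star (ψ y)) ∘ₗ (toLin ψ ∘ₗ mulRight (qIdeal A) iota y) := by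
      ext a
      show star (ψ y) * (act ψ (iota a) ⟨ψ y, hy⟩ : B) + star (0 : B) * (act ψ (iotaBar a) 0 : B) =
        star (ψ y) * ψ ((qIdeal A).lmul (iota a) y)
      rw [act_hom, star_zero, zero_mul, add_zero]
    rwa [h2] at h1
  · refine IsNuclear.of_star_mul (homMul_star_mul ψ iotaBar y)
      (M := LinearMap.mulLeft ℂ (star (ψ y)) ∘ₗ (toLin ψ ∘ₗ mulRight (qIdeal A) iotaBar y)) ?_
    have h1 := h (pair ψ 0 ⟨ψ y, hy⟩)
    have h2 : (kasparovModule ψ).coefficient (pair ψ 0 ⟨ψ y, hy⟩) =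
        LinearMap.mulLeft ℂ (star (ψ y)) ∘ₗ (toLin ψ ∘ₗ mulRight (qIdeal A) iotaBar y) := by
      ext a
      show star (0 : B) * (act ψ (iota a) 0 : B) + star (ψ y) * (act ψ (iotaBar a) ⟨ψ y, hy⟩ : B) =
        star (ψ y) * ψ ((qIdeal A).lmul (iotaBar a) y)
      rw [act_hom, star_zero, zero_mul, zero_add]
    rwa [h2] at h1

end Kasparov

end QNuc
end

theorem proposition5p8 {A B : Type u} [NonUnitalCStarAlgebra A] [NonUnitalCStarAlgebra B]
    [PartialOrder B] [StarOrderedRing B] (ψ : QNuc.qIdeal A →⋆ₙₐ[ℂ] B) :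
    List.TFAE [
      QNuc.IsNuclear (QNuc.toLin ψ ∘ₗ QNuc.q),
      ∀ y : QNuc.qIdeal A,
        QNuc.IsNuclear (QNuc.toLin ψ ∘ₗ
          QNuc.mulRight (QNuc.qIdeal A) QNuc.iota y) ∧
        QNuc.IsNuclear (QNuc.toLin ψ ∘ₗ
          QNuc.mulRight (QNuc.qIdeal A) QNuc.iotaBar y),
      ∃ (E : Type u) (_ : NonUnitalCStarAlgebra E) (J : QNuc.ClosedIdeal E)
        (P : QNuc.Prequasihom A B E J), Function.Injective P.μ ∧ P.hom = ψ ∧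
          QNuc.IsWeaklyNuclear J P.φ ∧ QNuc.IsWeaklyNuclear J P.φbar,
      QNuc.IsWeaklyNuclear (QNuc.multiplierIdeal (QNuc.hereditary ψ))
          ((QNuc.canonicalExt ψ).comp QNuc.iota) ∧
        QNuc.IsWeaklyNuclear (QNuc.multiplierIdeal (QNuc.hereditary ψ))
          ((QNuc.canonicalExt ψ).comp QNuc.iotaBar),
      (QNuc.kasparovModule ψ).IsNuclear] := by
  tfae_have 1 → 2 := QNuc.isNuclear_homMul_of_isNuclear_q ψ
  tfae_have 2 → 1 := QNuc.isNuclear_q_of_isNuclear_homMul ψ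
  tfae_have 2 → 4 := fun h =>
    ⟨QNuc.isWeaklyNuclear_canonicalExt ψ _
      (QNuc.isNuclear_hereditaryMap ψ QNuc.iota fun y => (h y).1),
    QNuc.isWeaklyNuclear_canonicalExt ψ _
      (QNuc.isNuclear_hereditaryMap ψ QNuc.iotaBar fun y => (h y).2)⟩
  tfae_have 4 → 3 := fun h =>
    ⟨_, _, _, QNuc.canonicalPrequasihom ψ, QNuc.canonicalPrequasihom_injective ψ,
      QNuc.canonicalPrequasihom_hom ψ, h.1, h.2⟩
  tfae_have 3 → 2 := by
    rintro ⟨E, _, J, P, -, rfl, h, h'⟩ y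
    exact QNuc.isNuclear_homMul_of_prequasihom P h h' y
  tfae_have 2 → 5 := QNuc.isNuclear_kasparovModule ψ
  tfae_have 5 → 2 := QNuc.isNuclear_homMul_of_kasparovModule ψ
  tfae_finish
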